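/- Let $p$ be a prime, let $D>1$ be a product of an even number of distinct primes and $M\ge 1$ an integer, with $\gcd(D,M)=1$ and $p\nmid DM$. Let $B$ be the quaternion algebra over $\mathbb{Q}$ of discriminant $D$, and for each prime $\ell\mid pM$ fix an isomorphism $\iota_\ell: B\otimes\mathbb{Q}_\ell\simeq M_2(\mathbb{Q}_\ell)$. Let $R_0(M)\subset B$ be an Eichler order of level $M$ such that, for every $\ell\mid pM$, $\iota_\ell(R_0(M)\otimes\mathbb{Z}_\ell)$ is the ring of matrices $\begin{pmatrix}a&b\\c&d\end{pmatrix}\in M_2(\mathbb{Z}_\ell)$ with $c\equiv 0$ modulo the exact power of $\ell$ dividing $M$, and let $R_0(pM)\subset R_0(M)$ be the Eichler order of level $pM$ of the elements $x\in R_0(M)$ such that $\iota_p(x)$ is upper triangular modulo $p$. Let $\Gamma_0^D(M)$, $\Gamma_0^D(pM)$ and $\Gamma$ be the groups of units of reduced norm $1$ of $R_0(M)$, $R_0(pM)$ and $R_0(M)\otimes\mathbb{Z}[1/p]$. They act through $\iota_p$ on $\mathbb{P}^1(\mathbb{Q}_p)$ and on the Bruhat--Tits tree of $\mathrm{PGL}_2(\mathbb{Q}_p)$.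 Let $\Gamma_0^{loc}(p)\subset SL_2(\mathbb{Z}_p)$ be the subgroup of matrices that are upper triangular modulo $p$. Fix representatives $\gamma_0=1,\gamma_1,\dots,\gamma_p$ of $\Gamma_0^D(pM)\backslash\Gamma_0^D(M)$ with $\iota_p(\gamma_i)\in\Gamma_0^{loc}(p)\begin{pmatrix}0&-1\\1&i\end{pmatrix}$ for $i\ge1$, and $\omega_p\in R_0(pM)$ normalizing $\Gamma_0^D(pM)$ with $\iota_p(\omega_p)\in\Gamma_0^{loc}(p)\begin{pmatrix}0&-1\\p&0\end{pmatrix}$. Put $\tilde\gamma_0=1$ and $\tilde\gamma_i=p^{-1}\omega_p\gamma_i\omega_p$ for $i\ge 1$, and $\hat\Gamma_0^D(M)=\omega_p^{-1}\Gamma_0^D(M)\omega_p$. For $k=1,\dots,p$ put $s_k=\gamma_k^{-1}\omega_p^{-1}$, and for $g\in\Gamma_0^D(pM)$ let $t_k(g)\in\Gamma_0^D(pM)$ be the element with $g^{-1}s_k=s_jt_k(g)^{-1}$ for some $j\in\{1,\dots,p\}$. Let $v_*$, $\hat v_*$ be the vertices of the tree given by the lattices $\mathbb{Z}_p\oplus\mathbb{Z}_p$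 and $\mathbb{Z}_p\oplus p\mathbb{Z}_p$, let $d$ be the distance, and let $e_*=(v_*,\hat v_*)$. A vertex $v$ is even if $d(v,v_*)$ is even, and odd otherwise; an edge $e$ with source $s(e)$ and target $t(e)$ is even if $s(e)$ is even. Let $\{\gamma_e\}$ ($e$ an even edge) and $\{\gamma_v\}$ ($v$ a vertex) be the radial system: elements of $\Gamma$ with $\gamma_e e=e_*$, $\gamma_vv=v_*$ for $v$ even and $\gamma_vv=\hat v_*$ for $v$ odd, such that 1. $\gamma_{v_*}=\gamma_{\hat v_*}=1$; 2. $\{\gamma_e\}_{s(e)=v}=\{\gamma_i\gamma_v\}_{i=0}^p$ for $v$ even; 3. $\{\gamma_e\}_{t(e)=v}=\{\tilde\gamma_i\gamma_v\}_{i=0}^p$ for $v$ odd; 4. $\gamma_{s(e)}=\gamma_e$ if $e$ is even and $d(t(e),v_*)<d(s(e),v_*)$; 5. $\gamma_{t(e)}=\gamma_e$ if $e$ is even and $d(t(e),v_*)>d(s(e),v_*)$. For $g\in\Gamma$ and $e$ even let $h(g,e)\in\Gamma_0^D(pM)$ be the element with $\gamma_eg=h(g,e)\gamma_{g^{-1}(e)}$.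 Let $e\mapsto U_e$ be the $\mathrm{GL}_2(\mathbb{Q}_p)$-equivariant map from edges to compact-open balls of $\mathbb{P}^1(\mathbb{Q}_p)$ with $U_{e_*}=\mathbb{Z}_p$. Let $\mathrm{Meas}_0$ be the group of finitely additive $\mathbb{Z}$-valued functions of total mass $0$ on the compact-open subsets of $\mathbb{P}^1(\mathbb{Q}_p)$, with $\mathrm{GL}_2(\mathbb{Q}_p)$-action $(gm)(U)=m(g^{-1}U)$. Let $\varphi\in Z^1(\Gamma_0^D(pM),\mathbb{Z})=\mathrm{Hom}(\Gamma_0^D(pM),\mathbb{Z})$ be $p$-new, that is, its corestrictions to $\Gamma_0^D(M)$ and to $\hat\Gamma_0^D(M)$ vanish, and suppose that $U_p\varphi=a_p\varphi$ with $a_p\in\mathbb{Z}$, where $(U_p\varphi)(g)=\sum_{k=1}^p\varphi(t_k(g))$. (In particular, $\varphi$ may be the cocycle $\varphi_E$ attached to an elliptic curve $E/\mathbb{Q}$ of conductor $pDM$ and a sign at infinity, with $a_p=p+1-|E(\mathbb{F}_p)|$.) Then there is a unique family $(\mu_g)_{g\in\Gamma}$ in $\mathrm{Meas}_0$ with $\mu_g(U_e)=\varphi(h(g,e))$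 for all $g\in\Gamma$ and all even edges $e$. For every $g\in\Gamma_0^D(pM)$ and every $k=1,\dots,p$, the measures $\mu_{t_k(g)}$ and $a_p\,s_k^{-1}\mu_g$ coincide when restricted to $\mathbb{Z}_p$: for every compact-open $U\subseteq\mathbb{Z}_p$, $$\mu_{t_k(g)}(U)=a_p\,\mu_g(s_kU).$$ -/

import Mathlib

open scoped Quaternion TensorProduct Pointwise Matrix
open TopologicalSpace

noncomputable section

namespace QuatMeasure

/-! ### The projective line over `ℚ_p`, its compact-open sets, and integer-valued measures -/

section ProjectiveLine

variable (p : ℕ) [Fact p.Prime]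

/-- `GL₂(ℚ_p)`. -/
abbrev GLp : Type := GL (Fin 2) ℚ_[p]

/-- `ℙ¹(ℚ_p) = ℚ_p ∪ {∞}`, with its usual (compact) topology. -/
abbrev P1 : Type := OnePoint ℚ_[p]

variable {p}

open Classical in
/-- The action of `GL₂(ℚ_p)` on `ℙ¹(ℚ_p)` by fractional linear transformations. -/
def mobius (g : GLp p) (x : P1 p) : P1 p := g • x

theorem mobius_mul (g h : GLp p) (x : P1 p) : mobius (g * h) x = mobius g (mobius h x) := by
  classical
  simp only [mobius, mul_smul]

theorem mobius_one (x : P1 p) : mobius (1 : GLp p) x = x := by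
  classical
  simp only [mobius, one_smul]

theorem tendsto_coe_cobounded :
    Filter.Tendsto ((↑) : ℚ_[p] → P1 p) (Bornology.cobounded ℚ_[p]) (nhds OnePoint.infty) := by
  rw [Metric.cobounded_eq_cocompact, ← Filter.coclosedCompact_eq_cocompact]
  exact OnePoint.tendsto_coe_infty

theorem continuous_mobius (g : GLp p) : Continuous (mobius g : P1 p → P1 p) := by
  classical
  have hdet : g 0 0 * g 1 1 - g 0 1 * g 1 0 ≠ 0 := by
    rw [← Matrix.det_fin_two]
    exact g.det_ne_zero
  have hsome : ∀ x : ℚ_[p], mobius g (x : P1 p) =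
      if g 1 0 * x + g 1 1 = 0 then OnePoint.infty
      else (((g 0 0 * x + g 0 1) / (g 1 0 * x + g 1 1) : ℚ_[p]) : P1 p) := by
    intro x
    simp only [mobius]
    convert OnePoint.smul_some_eq_ite using 2
  have hinf : mobius g (OnePoint.infty : P1 p) =
      if g 1 0 = 0 then OnePoint.infty else ((g 0 0 / g 1 0 : ℚ_[p]) : P1 p) := by
    simp only [mobius]
    convert OnePoint.smul_infty_eq_ite g using 2
  generalize g 0 0 = a at *
  generalize g 0 1 = b at *
  generalize g 1 0 = c at *
  generalize g 1 1 = d at *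
  by_cases hc : c = 0
  · subst hc
    have had : a ≠ 0 ∧ d ≠ 0 := by
      constructor <;> rintro rfl <;> simp at hdet
    obtain ⟨ha, hd⟩ := had
    have hs : ∀ x : ℚ_[p], mobius g (x : P1 p) = ((a / d * x + b / d : ℚ_[p]) : P1 p) := by
      intro x
      rw [hsome, if_neg (by simpa using hd)]
      congr 1
      rw [zero_mul, zero_add, add_div, mul_div_right_comm]
    let e : ℚ_[p] ≃ₜ ℚ_[p] :=
      (Homeomorph.mulLeft₀ (a / d) (div_ne_zero ha hd)).trans (Homeomorph.addRight (b / d))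
    have he : (mobius g : P1 p → P1 p) = OnePoint.map e := by
      funext x
      induction x using OnePoint.rec with
      | infty => rw [hinf, if_pos rfl]; rfl
      | coe x => rw [hs]; rfl
    rw [he]
    exact e.onePointCongr.continuous
  · -- `g x = a / c + m / (x + d / c)`
    set m : ℚ_[p] := -(a * d - b * c) / c ^ 2 with hm
    have hm0 : m ≠ 0 := div_ne_zero (neg_ne_zero.mpr hdet) (pow_ne_zero 2 hc)
    have hs : ∀ x : ℚ_[p], x + d / c ≠ 0 → mobius g (x : P1 p) =
        ((a / c + m * (x + d / c)⁻¹ : ℚ_[p]) : P1 p) := by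
      intro x hx
      have hx' : c * x + d ≠ 0 := by
        intro h
        apply hx
        field_simp
        linear_combination h
      rw [hsome, if_neg hx']
      congr 1
      have : x + d / c = (c * x + d) / c := by field_simp
      rw [this, hm, inv_div, div_eq_iff hx', add_mul, mul_assoc, div_mul_cancel₀ c hx']
      field_simp
      ring
    have hpole : mobius g ((-(d / c) : ℚ_[p]) : P1 p) = OnePoint.infty := by
      rw [hsome, if_pos (by field_simp; ring)]
    rw [OnePoint.continuous_iff, hinf, if_neg hc]
    have hcob : Filter.Tendsto (fun x : ℚ_[p] => x + d / c) (Bornology.cobounded _)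
        (Bornology.cobounded _) := by
      rw [Metric.cobounded_eq_cocompact]
      exact (Homeomorph.addRight (d / c)).isClosedEmbedding.tendsto_cocompact
    constructor
    · rw [Filter.coclosedCompact_eq_cocompact, ← Metric.cobounded_eq_cocompact]
      have h1 : Filter.Tendsto (fun x : ℚ_[p] => a / c + m * (x + d / c)⁻¹)
          (Bornology.cobounded _) (nhds (a / c)) := by
        have := ((Filter.tendsto_inv₀_cobounded.comp hcob).const_mul m).const_add (a / c)
        simpa using this
      refine ((OnePoint.continuous_coe.tendsto _).comp h1).congr' ?_
      filter_upwards [hcob (Bornology.le_cofinite _ (Set.finite_singleton 0).compl_mem_cofinite)]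
        with x hx
      exact (hs x hx).symm
    · rw [continuous_iff_continuousAt]
      intro x
      by_cases hx : x + d / c = 0
      · obtain rfl : x = -(d / c) := by linear_combination hx
        rw [ContinuousAt, hpole, ← nhdsNE_sup_pure, Filter.tendsto_sup]
        refine ⟨?_, by rw [Filter.tendsto_pure_left]; intro s hs; rw [hpole]; exact mem_of_mem_nhds hs⟩
        have h0 : Filter.Tendsto (fun x : ℚ_[p] => x + d / c) (nhdsWithin (-(d / c)) {-(d / c)}ᶜ)
            (nhdsWithin 0 {0}ᶜ) := by
          refine tendsto_nhdsWithin_iff.mpr ⟨?_, ?_⟩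
          · have : Continuous fun x : ℚ_[p] => x + d / c := by fun_prop
            have h := this.tendsto (-(d / c))
            rw [neg_add_cancel] at h
            exact h.mono_left nhdsWithin_le_nhds
          · filter_upwards [self_mem_nhdsWithin] with y hy h
            exact hy (by simp only [Set.mem_singleton_iff] at h ⊢; linear_combination h)
        have h1 := Filter.tendsto_inv₀_nhdsNE_zero.comp h0
        let e : ℚ_[p] ≃ₜ ℚ_[p] :=
          (Homeomorph.mulLeft₀ m hm0).trans (Homeomorph.addLeft (a / c))
        have h2 : Filter.Tendsto e (Bornology.cobounded _) (Bornology.cobounded _) := by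
          rw [Metric.cobounded_eq_cocompact]
          exact e.isClosedEmbedding.tendsto_cocompact
        refine (tendsto_coe_cobounded.comp (h2.comp h1)).congr' ?_
        filter_upwards [self_mem_nhdsWithin] with y hy
        refine (hs y fun h => hy ?_).symm
        simp only [Set.mem_singleton_iff]
        linear_combination h
      · have h1 : ContinuousAt (fun x : ℚ_[p] => a / c + m * (x + d / c)⁻¹) x := by
          refine continuousAt_const.add (continuousAt_const.mul (ContinuousAt.inv₀ ?_ hx))
          fun_prop
        refine (OnePoint.continuous_coe.continuousAt.comp h1).congr ?_
        have : ∀ᶠ y in nhds x, y + d / c ≠ 0 :=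
          (Continuous.continuousAt (by fun_prop)).eventually_ne hx
        filter_upwards [this] with y hy
        exact (hs y hy).symm

/-- The translate `g U` of a compact-open set `U ⊆ ℙ¹(ℚ_p)`. -/
instance : SMul (GLp p) (Clopens (P1 p)) where
  smul g U := ⟨mobius g⁻¹ ⁻¹' U, U.isClopen.preimage (continuous_mobius g⁻¹)⟩

theorem mem_smul_clopens (g : GLp p) (U : Clopens (P1 p)) (x : P1 p) :
    x ∈ g • U ↔ mobius g⁻¹ x ∈ U := Iff.rfl

/-- `g U` is the image of `U` under `g`. -/
theorem coe_smul_clopens (g : GLp p) (U : Clopens (P1 p)) :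
    ((g • U : Clopens (P1 p)) : Set (P1 p)) = mobius g '' U := by
  ext x
  constructor
  · intro hx
    exact ⟨mobius g⁻¹ x, hx, by rw [← mobius_mul, mul_inv_cancel, mobius_one]⟩
  · rintro ⟨y, hy, rfl⟩
    change mobius g⁻¹ (mobius g y) ∈ U
    rwa [← mobius_mul, inv_mul_cancel, mobius_one]

theorem smul_clopens_sup (g : GLp p) (U V : Clopens (P1 p)) : g • (U ⊔ V) = g • U ⊔ g • V := rfl

theorem smul_clopens_top (g : GLp p) : g • (⊤ : Clopens (P1 p)) = ⊤ := rfl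

theorem smul_clopens_disjoint (g : GLp p) {U V : Clopens (P1 p)} (h : Disjoint U V) :
    Disjoint (g • U) (g • V) := by
  rw [← Clopens.coe_disjoint] at h ⊢
  exact h.preimage (mobius g⁻¹)

variable (p)

/-- `ℤ_p` as a compact-open subset of `ℙ¹(ℚ_p)`. -/
def Zp : Clopens (P1 p) where
  carrier := ((↑) : ℚ_[p] → P1 p) '' {x | ‖x‖ ≤ 1}
  isClopen' := by
    have h : {x : ℚ_[p] | ‖x‖ ≤ 1} = Metric.closedBall 0 1 := by ext; simp
    rw [h]
    refine ⟨((isCompact_closedBall _ _).image OnePoint.continuous_coe).isClosed, ?_⟩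
    exact OnePoint.isOpenEmbedding_coe.isOpenMap _
      (IsUltrametricDist.isOpen_closedBall _ one_ne_zero)

/-- `Meas₀(ℙ¹(ℚ_p), ℤ)`: finitely additive `ℤ`-valued functions on the compact-open subsets of
`ℙ¹(ℚ_p)`, of total mass `0`. -/
@[ext]
structure Meas0 where
  toFun : Clopens (P1 p) → ℤ
  map_sup' : ∀ U V, Disjoint U V → toFun (U ⊔ V) = toFun U + toFun V
  map_top' : toFun ⊤ = 0

variable {p}

instance : CoeFun (Meas0 p) (fun _ => Clopens (P1 p) → ℤ) := ⟨Meas0.toFun⟩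

/-- `(g m)(U) = m(g⁻¹ U)`. -/
instance : SMul (GLp p) (Meas0 p) where
  smul g m :=
    { toFun := fun U => m (g⁻¹ • U)
      map_sup' := fun U V h => by
        rw [smul_clopens_sup, m.map_sup' _ _ (smul_clopens_disjoint g⁻¹ h)]
      map_top' := by rw [smul_clopens_top, m.map_top'] }

/-- `(n m)(U) = n · m(U)`. -/
instance : SMul ℤ (Meas0 p) where
  smul n m :=
    { toFun := fun U => n * m U
      map_sup' := fun U V h => by rw [m.map_sup' _ _ h, mul_add]
      map_top' := by rw [m.map_top', mul_zero] }

end ProjectiveLine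

/-! ### The Bruhat–Tits tree of `PGL₂(ℚ_p)` -/

section Tree

variable (p : ℕ) [Fact p.Prime]

/-- `ℤ_p`-lattices in `ℚ_p²`. -/
def Lat : Type := {L : Submodule ℤ_[p] (Fin 2 → ℚ_[p]) // L.IsLattice ℚ_[p]}

variable {p}

/-- `g ∈ GL₂(ℚ_p)` as a `ℤ_p`-linear automorphism of the column space `ℚ_p²`. -/
def glMap (g : GLp p) : (Fin 2 → ℚ_[p]) →ₗ[ℤ_[p]] (Fin 2 → ℚ_[p]) :=
  (Matrix.mulVecLin (g : Matrix (Fin 2) (Fin 2) ℚ_[p])).restrictScalars ℤ_[p]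

theorem glMap_mul (g h : GLp p) : glMap (g * h) = (glMap g).comp (glMap h) := by
  ext1 v
  simp [glMap]

theorem glMap_one : glMap (1 : GLp p) = LinearMap.id := by
  ext1 v
  simp [glMap]

theorem glMap_injective (g : GLp p) : Function.Injective (glMap g) := by
  apply Function.LeftInverse.injective (g := glMap g⁻¹)
  intro v
  rw [← LinearMap.comp_apply, ← glMap_mul, inv_mul_cancel, glMap_one, LinearMap.id_apply]

theorem glMap_smul (g : GLp p) (c : ℚ_[p]ˣ) (L : Submodule ℤ_[p] (Fin 2 → ℚ_[p])) :
    (c • L).map (glMap g) = c • L.map (glMap g) := by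
  ext x
  simp only [Submodule.mem_map]
  constructor
  · rintro ⟨_, ⟨y, hy, rfl⟩, rfl⟩
    refine ⟨_, ⟨y, hy, rfl⟩, ?_⟩
    simp [glMap]
  · rintro ⟨_, ⟨y, hy, rfl⟩, rfl⟩
    refine ⟨_, ⟨y, hy, rfl⟩, ?_⟩
    simp [glMap]

theorem isLattice_map (g : GLp p) (L : Submodule ℤ_[p] (Fin 2 → ℚ_[p]))
    (hL : L.IsLattice ℚ_[p]) : (L.map (glMap g)).IsLattice ℚ_[p] where
  fg := hL.fg.map _
  span_eq_top := by
    have h1 : ((L.map (glMap g) : Submodule ℤ_[p] (Fin 2 → ℚ_[p])) : Set (Fin 2 → ℚ_[p]))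
        = Matrix.mulVecLin (g : Matrix (Fin 2) (Fin 2) ℚ_[p]) '' L := rfl
    rw [h1, ← Submodule.map_span, hL.span_eq_top, Submodule.map_top, LinearMap.range_eq_top]
    intro v
    refine ⟨Matrix.mulVecLin ((g⁻¹ : GLp p) : Matrix (Fin 2) (Fin 2) ℚ_[p]) v, ?_⟩
    simp only [Matrix.mulVecLin_apply, Matrix.mulVec_mulVec, ← Units.val_mul, mul_inv_cancel,
      Units.val_one, Matrix.one_mulVec]

/-- Two lattices are homothetic if one is a multiple of the other by some `c ∈ ℚ_pˣ`. -/
instance homothety : Setoid (Lat p) where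
  r L L' := ∃ c : ℚ_[p]ˣ, L'.1 = c • L.1
  iseqv :=
    { refl := fun L => ⟨1, (one_smul _ _).symm⟩
      symm := fun {L L'} ⟨c, h⟩ => ⟨c⁻¹, by rw [h, inv_smul_smul]⟩
      trans := fun {L L' L''} ⟨c, h⟩ ⟨d, h'⟩ => ⟨d * c, by rw [h', h, mul_smul]⟩ }

variable (p)

/-- Vertices of the tree: homothety classes of lattices. -/
def Vertex : Type := Quotient (homothety (p := p))

variable {p}

instance : MulAction (GLp p) (Vertex p) where
  smul g := Quotient.map (fun L => ⟨L.1.map (glMap g), isLattice_map g L.1 L.2⟩)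
    (fun L L' ⟨c, h⟩ => ⟨c, by
      change L'.1.map (glMap g) = c • L.1.map (glMap g)
      rw [h, glMap_smul]⟩)
  one_smul v := by
    induction v using Quotient.inductionOn with | _ L =>
    refine congrArg (Quotient.mk _) (Subtype.ext ?_)
    change L.1.map (glMap 1) = L.1
    rw [glMap_one, Submodule.map_id]
  mul_smul g h v := by
    induction v using Quotient.inductionOn with | _ L =>
    refine congrArg (Quotient.mk _) (Subtype.ext ?_)
    change L.1.map (glMap (g * h)) = (L.1.map (glMap h)).map (glMap g)
    rw [glMap_mul, Submodule.map_comp]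

/-- The class of a lattice. -/
def cls (L : Lat p) : Vertex p := Quotient.mk _ L

theorem smul_cls (g : GLp p) (L : Lat p) :
    g • cls L = cls ⟨L.1.map (glMap g), isLattice_map g L.1 L.2⟩ := rfl

/-- `v₁` and `v₂` are represented by lattices with `p Λ₁ ⊊ Λ₂ ⊊ Λ₁`. -/
def Nbr (v₁ v₂ : Vertex p) : Prop :=
  ∃ L₁ L₂ : Lat p, v₁ = cls L₁ ∧ v₂ = cls L₂ ∧
    (p : ℤ_[p]) • L₁.1 < L₂.1 ∧ L₂.1 < L₁.1

theorem Nbr.smul (g : GLp p) {v w : Vertex p} (h : Nbr v w) : Nbr (g • v) (g • w) := by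
  obtain ⟨L₁, L₂, rfl, rfl, h₁, h₂⟩ := h
  refine ⟨_, _, smul_cls g L₁, smul_cls g L₂, ?_, ?_⟩
  · have := Submodule.map_strictMono_of_injective (glMap_injective g) h₁
    rwa [Submodule.map_pointwise_smul] at this
  · exact Submodule.map_strictMono_of_injective (glMap_injective g) h₂

variable (p)

/-- The Bruhat–Tits tree as a graph. -/
def tree : SimpleGraph (Vertex p) := SimpleGraph.fromRel Nbr

/-- Directed edges `e = (s(e), t(e))`. -/
@[ext]
structure Edge where
  s : Vertex p
  t : Vertex p
  nbr : Nbr s t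

variable {p}

instance : MulAction (GLp p) (Edge p) where
  smul g e := ⟨g • e.s, g • e.t, e.nbr.smul g⟩
  one_smul _ := Edge.ext (one_smul _ _) (one_smul _ _)
  mul_smul _ _ _ := Edge.ext (mul_smul _ _ _) (mul_smul _ _ _)

variable (p)

theorem isLattice_span (c : ℚ_[p]) (hc : c ≠ 0) :
    (Submodule.span ℤ_[p] {![1, 0], ![0, c]} : Submodule ℤ_[p] (Fin 2 → ℚ_[p])).IsLattice
      ℚ_[p] where
  fg := Submodule.fg_span (by simp)
  span_eq_top := by
    rw [Submodule.span_span_of_tower, eq_top_iff]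
    intro v _
    rw [Submodule.mem_span_pair]
    refine ⟨v 0, v 1 / c, ?_⟩
    ext i
    fin_cases i <;> simp [hc]

theorem p_ne_zero : (p : ℚ_[p]) ≠ 0 := Nat.cast_ne_zero.mpr (Fact.out : p.Prime).ne_zero

/-- The standard lattice `ℤ_p ⊕ ℤ_p`. -/
def stdLat : Lat p := ⟨Submodule.span ℤ_[p] {![1, 0], ![0, 1]}, isLattice_span p 1 one_ne_zero⟩

/-- The lattice `ℤ_p ⊕ p ℤ_p`. -/
def hatLat : Lat p :=
  ⟨Submodule.span ℤ_[p] {![1, 0], ![0, (p : ℚ_[p])]}, isLattice_span p p (p_ne_zero p)⟩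

theorem p_smul_stdLat_lt : (p : ℤ_[p]) • (stdLat p).1 < (hatLat p).1 := by
  rw [lt_iff_le_and_ne]
  constructor
  · rintro _ ⟨y, hy, rfl⟩
    obtain ⟨u, v, rfl⟩ := Submodule.mem_span_pair.mp hy
    refine Submodule.mem_span_pair.mpr ⟨p * u, v, ?_⟩
    ext i
    fin_cases i <;> simp [Algebra.smul_def, mul_comm]
  · intro h
    have h1 : (![1, 0] : Fin 2 → ℚ_[p]) ∈ (p : ℤ_[p]) • (stdLat p).1 := by
      rw [h]
      exact Submodule.subset_span (by simp)
    obtain ⟨y, hy, h2⟩ := h1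
    obtain ⟨u, v, rfl⟩ := Submodule.mem_span_pair.mp hy
    have h3 := congrFun h2 0
    simp [Algebra.smul_def] at h3
    have h4 : (p : ℤ_[p]) * u = 1 := Subtype.ext (by simpa using h3)
    exact PadicInt.prime_p.not_isUnit (IsUnit.of_mul_eq_one _ h4)

theorem hatLat_lt_stdLat : (hatLat p).1 < (stdLat p).1 := by
  rw [lt_iff_le_and_ne]
  constructor
  · intro y hy
    obtain ⟨u, v, rfl⟩ := Submodule.mem_span_pair.mp hy
    refine Submodule.mem_span_pair.mpr ⟨u, p * v, ?_⟩
    ext i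
    fin_cases i <;> simp [Algebra.smul_def, mul_comm]
  · intro h
    have h1 : (![0, 1] : Fin 2 → ℚ_[p]) ∈ (hatLat p).1 := by
      rw [h]
      exact Submodule.subset_span (by simp)
    obtain ⟨u, v, h2⟩ := Submodule.mem_span_pair.mp h1
    have h3 := congrFun h2 1
    simp [Algebra.smul_def] at h3
    have h4 : v * (p : ℤ_[p]) = 1 := Subtype.ext (by simpa using h3)
    exact PadicInt.prime_p.not_isUnit (IsUnit.of_mul_eq_one_right _ h4)

/-- The vertex `v_*` of `ℤ_p²`. -/
def vStar : Vertex p := cls (stdLat p)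

/-- The vertex `v̂_*` of `ℤ_p ⊕ p ℤ_p`. -/
def vHat : Vertex p := cls (hatLat p)

/-- The edge `e_* = (v_*, v̂_*)`. -/
def eStar : Edge p where
  s := vStar p
  t := vHat p
  nbr := ⟨_, _, rfl, rfl, p_smul_stdLat_lt p, hatLat_lt_stdLat p⟩

variable {p}

/-- The distance `d(v, v_*)` in the tree. -/
def depth (v : Vertex p) : ℕ := (tree p).dist v (vStar p)

/-- Even vertices. -/
def Vertex.IsEven (v : Vertex p) : Prop := Even (depth v)

/-- Even edges: those with even source. -/
def Edge.IsEven (e : Edge p) : Prop := e.s.IsEven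

end Tree

/-! ### Quaternion algebras and Eichler orders -/

section Quaternion

variable {a b : ℚ}

/-- The reduced norm. -/
def nrd : ℍ[ℚ,a,b] →* ℚ where
  toFun x := (x * star x).re
  map_one' := by simp
  map_mul' x y := by
    simp only [QuaternionAlgebra.re_mul, QuaternionAlgebra.re_star, QuaternionAlgebra.imI_star,
      QuaternionAlgebra.imJ_star, QuaternionAlgebra.imK_star, QuaternionAlgebra.imI_mul,
      QuaternionAlgebra.imJ_mul, QuaternionAlgebra.imK_mul]
    ring

/-- `B ⊗_ℚ ℚ_ℓ` is isomorphic to the matrix algebra `M₂(ℚ_ℓ)`. -/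
def SplitAt (a b : ℚ) (ℓ : ℕ) [Fact ℓ.Prime] : Prop :=
  Nonempty ((ℚ_[ℓ] ⊗[ℚ] ℍ[ℚ,a,b]) ≃ₐ[ℚ_[ℓ]] Matrix (Fin 2) (Fin 2) ℚ_[ℓ])

/-- `D` is the product of the primes at which the algebra is ramified. -/
def HasDiscriminant (a b : ℚ) (D : ℕ) : Prop :=
  Squarefree D ∧ ∀ (ℓ : ℕ) [Fact ℓ.Prime], ℓ ∣ D ↔ ¬ SplitAt a b ℓ

/-- A `ℤ`-order: a subring which is a finitely generated `ℤ`-module spanning the algebra. -/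
def IsZOrder (R : Subring ℍ[ℚ,a,b]) : Prop :=
  R.toAddSubgroup.FG ∧ Submodule.span ℚ (R : Set ℍ[ℚ,a,b]) = ⊤

/-- An Eichler order of level `m`: the intersection of two maximal orders, of index `m` in
them. -/
def IsEichlerOrder (R : Subring ℍ[ℚ,a,b]) (m : ℕ) : Prop :=
  ∃ O₁ O₂ : Subring ℍ[ℚ,a,b], Maximal IsZOrder O₁ ∧ Maximal IsZOrder O₂ ∧ R = O₁ ⊓ O₂ ∧
    R.toAddSubgroup.relIndex O₁.toAddSubgroup = m ∧
    R.toAddSubgroup.relIndex O₂.toAddSubgroup = m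

/-- The matrices in `M₂(ℤ_ℓ)` whose lower left entry is `0` modulo `ℓ^n`. -/
def eichlerLocal (ℓ : ℕ) [Fact ℓ.Prime] (n : ℕ) : Subring (Matrix (Fin 2) (Fin 2) ℚ_[ℓ]) where
  carrier := {x | (∀ i j, ‖x i j‖ ≤ 1) ∧ ‖x 1 0‖ ≤ (ℓ : ℝ) ^ (-n : ℤ)}
  one_mem' := by
    refine ⟨fun i j => ?_, by simp⟩
    by_cases h : i = j <;> simp [Matrix.one_apply, h]
  zero_mem' := ⟨fun i j => by simp, by simp⟩
  mul_mem' := by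
    rintro x y ⟨hx, hx'⟩ ⟨hy, hy'⟩
    have hpos : (0 : ℝ) ≤ (ℓ : ℝ) ^ (-n : ℤ) := by positivity
    refine ⟨fun i j => ?_, ?_⟩
    · rw [Matrix.mul_apply, Fin.sum_univ_two]
      refine (IsUltrametricDist.norm_add_le_max _ _).trans (max_le ?_ ?_) <;> rw [norm_mul] <;>
        exact mul_le_one₀ (hx _ _) (norm_nonneg _) (hy _ _)
    · rw [Matrix.mul_apply, Fin.sum_univ_two]
      refine (IsUltrametricDist.norm_add_le_max _ _).trans (max_le ?_ ?_) <;> rw [norm_mul]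
      · exact (mul_le_of_le_one_right (norm_nonneg _) (hy _ _)).trans hx'
      · exact (mul_le_of_le_one_left (norm_nonneg _) (hx _ _)).trans hy'
  add_mem' := by
    rintro x y ⟨hx, hx'⟩ ⟨hy, hy'⟩
    exact ⟨fun i j => (IsUltrametricDist.norm_add_le_max _ _).trans (max_le (hx i j) (hy i j)),
      (IsUltrametricDist.norm_add_le_max _ _).trans (max_le hx' hy')⟩
  neg_mem' := by
    rintro x ⟨hx, hx'⟩
    exact ⟨fun i j => by simpa using hx i j, by simpa using hx'⟩

/-- The group of units of reduced norm `1` of an order. -/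
def normOneUnits (R : Subring ℍ[ℚ,a,b]) : Subgroup ℍ[ℚ,a,b]ˣ :=
  R.toSubmonoid.units ⊓ (Units.map (nrd (a := a) (b := b))).ker

/-- `R ⊗ ℤ[1/p]`, inside the quaternion algebra. -/
def invertPrime (p : ℕ) (R : Subring ℍ[ℚ,a,b]) : Subring ℍ[ℚ,a,b] where
  carrier := {x | ∃ n : ℕ, (p : ℍ[ℚ,a,b]) ^ n * x ∈ R}
  one_mem' := ⟨0, by simp⟩
  zero_mem' := ⟨0, by simp⟩
  mul_mem' := by
    rintro x y ⟨m, hm⟩ ⟨n, hn⟩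
    refine ⟨m + n, ?_⟩
    have h : (p : ℍ[ℚ,a,b]) ^ (m + n) * (x * y)
        = ((p : ℍ[ℚ,a,b]) ^ m * x) * ((p : ℍ[ℚ,a,b]) ^ n * y) := by
      have hc : Commute ((p : ℍ[ℚ,a,b]) ^ n) x := (Nat.cast_commute p x).pow_left n
      rw [pow_add, mul_assoc, mul_assoc, ← mul_assoc _ x y, hc.eq, mul_assoc]
    rw [h]
    exact R.mul_mem hm hn
  add_mem' := by
    rintro x y ⟨m, hm⟩ ⟨n, hn⟩
    refine ⟨m + n, ?_⟩
    have hp : ∀ k : ℕ, (p : ℍ[ℚ,a,b]) ^ k ∈ R := fun k => R.pow_mem (natCast_mem R p) k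
    rw [mul_add]
    refine R.add_mem ?_ ?_
    · rw [add_comm, pow_add, mul_assoc]
      exact R.mul_mem (hp n) hm
    · rw [pow_add, mul_assoc]
      exact R.mul_mem (hp m) hn
  neg_mem' := by
    rintro x ⟨m, hm⟩
    exact ⟨m, by rw [mul_neg]; exact R.neg_mem hm⟩

end Quaternion

/-! ### The arithmetic set-up -/

/-- The quaternion algebra `B = (a, b / ℚ)` of discriminant `D`, the local splittings `ι_ℓ` for
`ℓ ∣ pM`, and the Eichler order `R₀(M)` of level `M`, with its prescribed local form. -/
structure Setup (p D M : ℕ) [Fact p.Prime] where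
  one_lt_D : 1 < D
  even_D : Even D.primeFactors.card
  M_pos : 0 < M
  coprime_D_M : D.Coprime M
  p_not_dvd_D : ¬ p ∣ D
  p_not_dvd_M : ¬ p ∣ M
  a : ℚ
  b : ℚ
  a_ne_zero : a ≠ 0
  b_ne_zero : b ≠ 0
  disc : HasDiscriminant a b D
  ι : ∀ (ℓ : ℕ) [Fact ℓ.Prime], ℓ ∣ p * M →
    ((ℚ_[ℓ] ⊗[ℚ] ℍ[ℚ,a,b]) ≃ₐ[ℚ_[ℓ]] Matrix (Fin 2) (Fin 2) ℚ_[ℓ])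
  R0 : Subring ℍ[ℚ,a,b]
  eichler_R0 : IsEichlerOrder R0 M
  /-- `ι_ℓ (R₀(M) ⊗ ℤ_ℓ)` consists of the matrices in `M₂(ℤ_ℓ)` which are upper triangular modulo
  the exact power of `ℓ` dividing `M`; at `ℓ = p` it is `M₂(ℤ_p)`. -/
  local_R0 : ∀ (ℓ : ℕ) [Fact ℓ.Prime] (h : ℓ ∣ p * M),
    (Submodule.span ℤ_[ℓ] ((fun x : ℍ[ℚ,a,b] => ι ℓ h (1 ⊗ₜ[ℚ] x)) '' R0) :
      Set (Matrix (Fin 2) (Fin 2) ℚ_[ℓ])) = eichlerLocal ℓ (padicValNat ℓ M)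

namespace Setup

variable {p D M : ℕ} [Fact p.Prime] (S : Setup p D M)

/-- The quaternion algebra. -/
abbrev B : Type := ℍ[ℚ,S.a,S.b]

/-- The embedding `ι_p : B → M₂(ℚ_p)`. -/
def loc : S.B →+* Matrix (Fin 2) (Fin 2) ℚ_[p] :=
  ((S.ι p (dvd_mul_right p M) : _ →+* Matrix (Fin 2) (Fin 2) ℚ_[p])).comp
    (Algebra.TensorProduct.includeRight : S.B →ₐ[ℚ] ℚ_[p] ⊗[ℚ] S.B).toRingHom

/-- `ι_p` on invertible elements, `Bˣ → GL₂(ℚ_p)`. -/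
def locGL : S.Bˣ →* GLp p := Units.map (S.loc : S.B →* Matrix (Fin 2) (Fin 2) ℚ_[p])

/-- The Eichler order `R₀(pM) ⊆ R₀(M)`: the elements of `R₀(M)` that are upper triangular modulo
`p` under `ι_p`. -/
def R0p : Subring S.B := S.R0 ⊓ (eichlerLocal p 1).comap S.loc

/-- `Γ₀ᴰ(M)`. -/
def Gam0M : Subgroup S.Bˣ := normOneUnits S.R0

/-- `Γ₀ᴰ(pM)`. -/
def Gam0pM : Subgroup S.Bˣ := normOneUnits S.R0p

/-- `Γ`, the units of reduced norm `1` of `R = R₀(M) ⊗ ℤ[1/p]`. -/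
def Gam : Subgroup S.Bˣ := normOneUnits (invertPrime p S.R0)

theorem Gam0pM_le_Gam : S.Gam0pM ≤ S.Gam := by
  have h : S.R0p ≤ invertPrime p S.R0 := fun x hx => ⟨0, by simpa using hx.1⟩
  exact inf_le_inf_right _ fun u hu => ⟨h hu.1, h hu.2⟩

/-- `p` as an element of `Bˣ`. -/
def pUnit : S.Bˣ :=
  Units.map (algebraMap ℚ S.B : ℚ →* S.B)
    (Units.mk0 (p : ℚ) (Nat.cast_ne_zero.mpr (Fact.out : p.Prime).ne_zero))

end Setup

/-- The group `Γ₀^loc(p)` of matrices in `SL₂(ℤ_p)` that are upper triangular modulo `p`. -/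
def gamLoc (p : ℕ) [Fact p.Prime] : Set (Matrix (Fin 2) (Fin 2) ℚ_[p]) :=
  {u | u ∈ eichlerLocal p 1 ∧ u.det = 1}

/-- The choice of the representatives `γ₀, …, γ_p` of `Γ₀ᴰ(pM) \ Γ₀ᴰ(M)` and of the element
`ω_p`. -/
structure Choices {p D M : ℕ} [Fact p.Prime] (S : Setup p D M) where
  γ : Fin (p + 1) → S.Bˣ
  γ_mem : ∀ i, γ i ∈ S.Gam0M
  γ_reps : ∀ g ∈ S.Gam0M, ∃! i, g * (γ i)⁻¹ ∈ S.Gam0pM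
  γ_zero : γ 0 = 1
  γ_local : ∀ i, i ≠ 0 → ∃ u ∈ gamLoc p,
    S.loc (γ i) = u * !![0, -1; 1, ((i : ℕ) : ℚ_[p])]
  ω : S.Bˣ
  ω_mem : (ω : S.B) ∈ S.R0p
  ω_normalizes : ∀ x, x ∈ S.Gam0pM ↔ ω * x * ω⁻¹ ∈ S.Gam0pM
  ω_local : ∃ u ∈ gamLoc p, S.loc ω = u * !![0, -1; (p : ℚ_[p]), 0]

namespace Choices

variable {p D M : ℕ} [Fact p.Prime] {S : Setup p D M} (C : Choices S)

/-- `γ̃₀ = 1` and `γ̃ᵢ = p⁻¹ ω_p γᵢ ω_p` for `i = 1, …, p`. -/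
def γt (i : Fin (p + 1)) : S.Bˣ :=
  if i = 0 then 1 else S.pUnit⁻¹ * C.ω * C.γ i * C.ω

/-- `Γ̂₀ᴰ(M) = ω_p⁻¹ Γ₀ᴰ(M) ω_p`. -/
def GamHat : Subgroup S.Bˣ := S.Gam0M.map (MulAut.conj C.ω⁻¹).toMonoidHom

/-- `s_k = γ_k⁻¹ ω_p⁻¹` for `k = 1, …, p`; the index `k : Fin p` stands for `k + 1`. -/
def s (k : Fin p) : S.Bˣ := (C.γ k.succ)⁻¹ * C.ω⁻¹

/-- `t_k(g)` is the element of `Γ₀ᴰ(pM)` with `g⁻¹ s_k = s_j t_k(g)⁻¹` for some index `j`. -/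
def t (k : Fin p) (g : S.Gam0pM) : S.Gam0pM :=
  Classical.epsilon fun t : S.Gam0pM => ∃ j, (g : S.Bˣ)⁻¹ * C.s k = C.s j * (t : S.Bˣ)⁻¹

/-- The operator `U_p` on `1`-cochains of `Γ₀ᴰ(pM)` with values in the trivial module `ℤ`. -/
def Up (φ : S.Gam0pM → ℤ) (g : S.Gam0pM) : ℤ := ∑ k, φ (C.t k g)

/-- For coset representatives `r₀, …, r_p` of `Γ₀ᴰ(pM)` in a larger group and `g` in that group,
the element `h` of `Γ₀ᴰ(pM)` with `rᵢ g = h r_j` for some `j`. -/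
def shift (r : Fin (p + 1) → S.Bˣ) (i : Fin (p + 1)) (g : S.Bˣ) : S.Gam0pM :=
  Classical.epsilon fun h : S.Gam0pM => ∃ j, r i * g = (h : S.Bˣ) * r j

/-- Corestriction of a `1`-cocycle of `Γ₀ᴰ(pM)` with values in the trivial module `ℤ`, computed
with the coset representatives `r₀, …, r_p`. -/
def cores (r : Fin (p + 1) → S.Bˣ) (φ : S.Gam0pM → ℤ) (g : S.Bˣ) : ℤ := ∑ i, φ (shift r i g)

/-- `φ` is `p`-new: its corestrictions to `Γ₀ᴰ(M)` and to `Γ̂₀ᴰ(M)` vanish. -/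
def IsPNew (φ : S.Gam0pM → ℤ) : Prop :=
  (∀ g ∈ S.Gam0M, cores C.γ φ g = 0) ∧ (∀ g ∈ C.GamHat, cores C.γt φ g = 0)

/-- The radial system `{γ_e}`, `{γ_v}`. Only the values of `γE` at even edges matter. -/
structure IsRadialSystem (γE : Edge p → S.Bˣ) (γV : Vertex p → S.Bˣ) : Prop where
  edge_rep : ∀ e : Edge p, e.IsEven → γE e ∈ S.Gam ∧ S.locGL (γE e) • e = eStar p
  even_rep : ∀ v : Vertex p, v.IsEven → γV v ∈ S.Gam ∧ S.locGL (γV v) • v = vStar p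
  odd_rep : ∀ v : Vertex p, ¬ v.IsEven → γV v ∈ S.Gam ∧ S.locGL (γV v) • v = vHat p
  base : γV (vStar p) = 1 ∧ γV (vHat p) = 1
  source : ∀ v : Vertex p, v.IsEven →
    γE '' {e | e.s = v} = Set.range fun i => C.γ i * γV v
  target : ∀ v : Vertex p, ¬ v.IsEven →
    γE '' {e | e.t = v} = Set.range fun i => C.γt i * γV v
  inward : ∀ e : Edge p, e.IsEven → depth e.t < depth e.s → γV e.s = γE e
  outward : ∀ e : Edge p, e.IsEven → depth e.s < depth e.t → γV e.t = γE e

/-- `h(g, e)` is the element of `Γ₀ᴰ(pM)` with `γ_e g = h(g, e) γ_{g⁻¹ e}`. -/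
def h (_C : Choices S) (γE : Edge p → S.Bˣ) (g : S.Gam) (e : Edge p) : S.Gam0pM :=
  Classical.epsilon fun h : S.Gam0pM =>
    γE e * (g : S.Bˣ) = (h : S.Bˣ) * γE ((S.locGL (g : S.Bˣ))⁻¹ • e)

/-- The family of measures `μ_g`, `g ∈ Γ`, is the one determined by `μ_g(U_e) = φ_{h(g, e)}` for
even edges `e`. Here `e ↦ U_e` is the `GL₂(ℚ_p)`-equivariant map with `U_{e_*} = ℤ_p`, so that
`U_e = A ℤ_p` whenever `e = A e_*`. -/
def IsMeasureFamily (γE : Edge p → S.Bˣ) (φ : S.Gam0pM → ℤ) (μ : S.Gam → Meas0 p) : Prop :=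
  ∀ (g : S.Gam) (e : Edge p), e.IsEven → ∀ A : GLp p, A • eStar p = e →
    μ g (A • Zp p) = φ (C.h γE g e)

end Choices

end QuatMeasure

end

open scoped Quaternion TensorProduct Pointwise Matrix
open TopologicalSpace

noncomputable section

namespace QuatMeasure

/-! ### Lattices as translates of `ℤ_p²` and the stabilizer of `v_*`. -/

section LocalTree

variable {p : ℕ} [Fact p.Prime]

/-! A directed edge is some `A e_*`; its ball is `A ℤ_p`, and the reversed edge has the
complementary ball. A measure of total mass zero is therefore the same as a function on directed
edges that changes sign under reversal and is additive over the `p` balls into which a ball splits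
(`IsHarmonic`). Such a function is integrated by cutting `ℙ¹` into `ℤ_p` and its complement, and
each half into small balls (`IsHarmonic.meas_smul_Zp`). For `e ↦ φ(h(g, e))`, additivity says that
the sum over the `p + 1` even edges at each vertex `v` vanishes. That sum is the corestriction of
`φ` at `γ_v g γ_{g⁻¹v}⁻¹` (`IsRadialSystem.sum_eq_cores`), an element of `Γ₀ᴰ(M)` for `v` even and
of `Γ̂₀ᴰ(M)` for `v` odd, so `p`-newness kills it. Even edges alone give arbitrarily fine balls in
both halves, whence uniqueness.

The Hecke relation combines two facts. Conjugation by `ω_p` multiplies `φ` by `-a_p`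
(`IsRadialSystem.φ_conjω`), because the corestriction to `Γ̂₀ᴰ(M)`, evaluated on `Γ₀ᴰ(pM)`, is the
identity term plus a conjugated `U_p`. Secondly, `s_k` pushes the half of the tree over `ℤ_p` one
step away from `v_*`, exchanging parities, and the radial system follows it by an explicit rule
(`IsRadialSystem.γV_s_smul`) because `γ̃ᵢ = p⁻¹ ω_p γᵢ ω_p`.

It follows that `h(t_k(g), e) = ω_p h(g, s_k ē) ω_p⁻¹`, where `ē` is the reversed edge
(`IsRadialSystem.h_t`). Applying `φ` gives `μ_{t_k(g)}(U_e) = -a_p μ_g(s_k U_ē) = a_p μ_g(s_k U_e)`: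
the sign from `ω_p` cancels the one from reversal. Agreement on fine balls gives agreement on every
compact-open subset of `ℤ_p`. -/

theorem one_lt_p_real : (1 : ℝ) < p := by exact_mod_cast (Fact.out : p.Prime).one_lt

/-- The value group is `p^ℤ`, so a strict inequality gains a factor `p`. -/
theorem norm_lt_iff_mul_le {x y : ℚ_[p]} (hy : y ≠ 0) : ‖x‖ < ‖y‖ ↔ ‖x‖ * p ≤ ‖y‖ := by
  have hp := one_lt_p_real (p := p)
  have h := Padic.norm_lt_pow_iff_norm_le_pow_sub_one x (-y.valuation)
  rw [← Padic.norm_eq_zpow_neg_valuation hy, zpow_sub_one₀ (by positivity),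
    ← Padic.norm_eq_zpow_neg_valuation hy] at h
  rw [h, ← div_eq_mul_inv, le_div_iff₀ (by positivity)]

theorem norm_sub_le_max' (x y : ℚ_[p]) : ‖x - y‖ ≤ max ‖x‖ ‖y‖ := by
  rw [sub_eq_add_neg, ← norm_neg y]
  exact IsUltrametricDist.norm_add_le_max _ _

theorem det_eq (g : GLp p) : (g : Matrix (Fin 2) (Fin 2) ℚ_[p]).det
    = g 0 0 * g 1 1 - g 0 1 * g 1 0 := Matrix.det_fin_two _

/-- Norm of the determinant. -/
def ndet : GLp p →* ℝ where
  toFun g := ‖(g : Matrix (Fin 2) (Fin 2) ℚ_[p]).det‖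
  map_one' := by simp
  map_mul' g h := by simp

theorem ndet_eq (g : GLp p) : ndet g = ‖(g : Matrix (Fin 2) (Fin 2) ℚ_[p]).det‖ := rfl

theorem ndet_pos (g : GLp p) : 0 < ndet g := norm_pos_iff.mpr g.det_ne_zero

theorem coe_inv_eq (g : GLp p) : ((g⁻¹ : GLp p) : Matrix (Fin 2) (Fin 2) ℚ_[p]) =
    (g : Matrix (Fin 2) (Fin 2) ℚ_[p]).det⁻¹ • !![g 1 1, -g 0 1; -g 1 0, g 0 0] := by
  rw [Matrix.coe_units_inv, Matrix.inv_def, Ring.inverse_eq_inv', Matrix.adjugate_fin_two]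

theorem mul_apply_two (g h : GLp p) (i j : Fin 2) :
    (g * h) i j = g i 0 * h 0 j + g i 1 * h 1 j := by
  rw [Units.val_mul, Matrix.mul_apply, Fin.sum_univ_two]

/-- The entries of `g` are `p`-adic integers. -/
def IsInt (g : GLp p) : Prop := ∀ i j, ‖g i j‖ ≤ 1

theorem mem_stdLat (x : Fin 2 → ℚ_[p]) : x ∈ (stdLat p).1 ↔ ∀ i, ‖x i‖ ≤ 1 := by
  rw [stdLat, Submodule.mem_span_pair]
  constructor
  · rintro ⟨a, b, rfl⟩ i
    fin_cases i <;> simp [Algebra.smul_def, PadicInt.norm_le_one]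
  · intro h
    obtain ⟨a, ha⟩ : ∃ a : ℤ_[p], (a : ℚ_[p]) = x 0 := ⟨⟨x 0, h 0⟩, rfl⟩
    obtain ⟨b, hb⟩ : ∃ b : ℤ_[p], (b : ℚ_[p]) = x 1 := ⟨⟨x 1, h 1⟩, rfl⟩
    refine ⟨a, b, ?_⟩
    ext i
    fin_cases i <;> simp [Algebra.smul_def, ha, hb]

/-- The lattice `g ℤ_p²`. -/
def gLat (g : GLp p) : Submodule ℤ_[p] (Fin 2 → ℚ_[p]) := (stdLat p).1.map (glMap g)

theorem gLat_mul (g h : GLp p) : gLat (g * h) = (gLat h).map (glMap g) := by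
  rw [gLat, glMap_mul, Submodule.map_comp]; rfl

theorem gLat_one : gLat (1 : GLp p) = (stdLat p).1 := by
  rw [gLat, glMap_one, Submodule.map_id]

theorem gLat_le_one_iff (g : GLp p) : gLat g ≤ gLat 1 ↔ IsInt g := by
  rw [gLat_one, gLat, Submodule.map_le_iff_le_comap]
  constructor
  · intro h i j
    have h1 : (Pi.single j 1 : Fin 2 → ℚ_[p]) ∈ (stdLat p).1 := by
      rw [mem_stdLat]
      intro k
      by_cases hk : k = j
      · subst hk; simp
      · simp [hk]
    have h2 := (mem_stdLat _).mp (h h1) i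
    simpa [glMap] using h2
  · intro h x hx
    rw [mem_stdLat] at hx
    rw [Submodule.mem_comap, mem_stdLat]
    intro i
    have : glMap g x i = g i 0 * x 0 + g i 1 * x 1 := by
      simp [glMap, Matrix.mulVec, dotProduct, Fin.sum_univ_two]
    rw [this]
    refine (IsUltrametricDist.norm_add_le_max _ _).trans (max_le ?_ ?_) <;> rw [norm_mul] <;>
      exact mul_le_one₀ (h _ _) (norm_nonneg _) (hx _)

theorem gLat_le_iff (g h : GLp p) : gLat g ≤ gLat h ↔ IsInt (h⁻¹ * g) := by
  rw [← gLat_le_one_iff]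
  constructor
  · intro H
    have := Submodule.map_mono (f := glMap h⁻¹) H
    rwa [← gLat_mul, ← gLat_mul, inv_mul_cancel] at this
  · intro H
    have := Submodule.map_mono (f := glMap h) H
    rwa [← gLat_mul, ← gLat_mul, mul_inv_cancel_left, mul_one] at this

/-- Scalar matrices. -/
def sc (c : ℚ_[p]ˣ) : GLp p := Matrix.GeneralLinearGroup.scalar (Fin 2) c

theorem sc_apply (c : ℚ_[p]ˣ) (i j : Fin 2) : sc c i j = if i = j then (c : ℚ_[p]) else 0 := by
  simp [sc, Matrix.scalar_apply, Matrix.diagonal_apply]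

theorem sc_comm (c : ℚ_[p]ˣ) (g : GLp p) : sc c * g = g * sc c := by
  ext i j
  rw [mul_apply_two, mul_apply_two]
  fin_cases i <;> fin_cases j <;> simp [sc_apply, mul_comm]

theorem sc_mul_apply (c : ℚ_[p]ˣ) (g : GLp p) (i j : Fin 2) : (sc c * g) i j = c * g i j := by
  rw [mul_apply_two]
  fin_cases i <;> simp [sc_apply]

theorem ndet_sc (c : ℚ_[p]ˣ) : ndet (sc c) = ‖(c : ℚ_[p])‖ ^ 2 := by
  rw [ndet_eq, det_eq]
  simp [sc_apply, sq]

theorem sc_inv (c : ℚ_[p]ˣ) : (sc c)⁻¹ = sc c⁻¹ := (map_inv _ _).symm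

theorem smul_gLat (c : ℚ_[p]ˣ) (g : GLp p) : c • gLat g = gLat (sc c * g) := by
  rw [gLat_mul]
  ext x
  have : ∀ y, glMap (sc c) y = c • y := by
    intro y
    ext i
    simp only [glMap, LinearMap.coe_restrictScalars, Matrix.mulVecLin_apply, Matrix.mulVec,
      dotProduct, Fin.sum_univ_two, sc_apply]
    fin_cases i <;> simp [Units.smul_def]
  simp only [Submodule.mem_map, this]
  rfl

theorem smul_vStar_eq_iff' (g h : GLp p) :
    g • vStar p = h • vStar p ↔ ∃ c : ℚ_[p]ˣ, gLat h = gLat (sc c * g) := by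
  simp only [vStar, cls, ← smul_gLat]
  exact Quotient.eq

/-- The inverse is the adjugate divided by the determinant, and in size two the adjugate has the
same entries up to sign. -/
theorem isInt_inv_iff (g : GLp p) : IsInt g⁻¹ ↔ ∀ i j, ‖g i j‖ ≤ ndet g := by
  have h := ndet_pos g
  have e : ∀ x : ℚ_[p], ‖(g : Matrix (Fin 2) (Fin 2) ℚ_[p]).det⁻¹ * x‖ ≤ 1 ↔ ‖x‖ ≤ ndet g := by
    intro x
    rw [norm_mul, norm_inv, ← ndet_eq, inv_mul_le_iff₀ h, mul_one]
  simp only [IsInt, coe_inv_eq, Fin.forall_fin_two, Matrix.smul_apply, smul_eq_mul, e,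
    Matrix.of_apply, Matrix.cons_val', Matrix.cons_val_zero, Matrix.cons_val_one,
    Matrix.cons_val_fin_one, norm_neg]
  tauto

theorem IsInt.ndet_le {g : GLp p} (h : IsInt g) : ndet g ≤ 1 := by
  rw [ndet_eq, det_eq]
  refine (norm_sub_le_max' _ _).trans (max_le ?_ ?_) <;> rw [norm_mul] <;>
    exact mul_le_one₀ (h _ _) (norm_nonneg _) (h _ _)

theorem gLat_eq_one_iff (g : GLp p) : gLat g = gLat 1 ↔ IsInt g ∧ ndet g = 1 := by
  rw [le_antisymm_iff, gLat_le_one_iff, gLat_le_iff, mul_one]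
  refine and_congr_right fun h => ⟨fun h' => ?_, fun h' => ?_⟩
  · refine le_antisymm h.ndet_le ?_
    have := h'.ndet_le
    have h2 : ndet g⁻¹ * ndet g = 1 := by rw [← map_mul, inv_mul_cancel, map_one]
    nlinarith [ndet_pos g]
  · rw [isInt_inv_iff, h']
    exact h

theorem gLat_eq_iff (g h : GLp p) : gLat g = gLat h ↔ gLat (h⁻¹ * g) = gLat 1 := by
  rw [le_antisymm_iff, le_antisymm_iff, gLat_le_iff, gLat_le_iff, gLat_le_iff, gLat_le_iff]
  simp

/-- The stabilizer of `v_*`. -/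
theorem smul_vStar_eq_iff (g : GLp p) : g • vStar p = vStar p ↔ ∀ i j, ‖g i j‖ ^ 2 ≤ ndet g := by
  have := smul_vStar_eq_iff' 1 g
  rw [one_smul, eq_comm] at this
  rw [this]
  simp only [mul_one]
  have key : ∀ c : ℚ_[p]ˣ, gLat g = gLat (sc c) ↔
      (∀ i j, ‖g i j‖ ≤ ‖(c : ℚ_[p])‖) ∧ ndet g = ‖(c : ℚ_[p])‖ ^ 2 := by
    intro c
    have hc : 0 < ‖(c : ℚ_[p])‖ := norm_pos_iff.mpr c.ne_zero
    rw [gLat_eq_iff, gLat_eq_one_iff, sc_inv, map_mul, ndet_sc]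
    simp only [IsInt, sc_mul_apply, norm_mul, Units.val_inv_eq_inv_val, norm_inv, inv_pow]
    simp only [inv_mul_le_iff₀ hc, mul_one]
    rw [inv_mul_eq_one₀ (by positivity), eq_comm]
  simp only [key]
  constructor
  · rintro ⟨c, h1, h2⟩ i j
    rw [h2]
    gcongr
    exact h1 i j
  · intro h
    -- The homothety factor is an entry of maximal norm: the ultrametric inequality bounds the
    -- determinant by its square, and the hypothesis gives the reverse bound.
    obtain ⟨⟨i, j⟩, -, hij⟩ := Finset.exists_max_image (Finset.univ : Finset (Fin 2 × Fin 2))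
      (fun q => ‖g q.1 q.2‖) Finset.univ_nonempty
    have hmax : ∀ i' j', ‖g i' j'‖ ≤ ‖g i j‖ := fun i' j' => hij (i', j') (Finset.mem_univ _)
    have hdet : ndet g ≤ ‖g i j‖ ^ 2 := by
      rw [ndet_eq, det_eq, sq]
      refine (norm_sub_le_max' _ _).trans (max_le ?_ ?_) <;> rw [norm_mul] <;>
        exact mul_le_mul (hmax _ _) (hmax _ _) (norm_nonneg _) (norm_nonneg _)
    have h0 : g i j ≠ 0 := by
      intro h0
      rw [h0] at hdet
      simp at hdet
      linarith [ndet_pos g]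
    exact ⟨Units.mk0 _ h0, hmax, le_antisymm hdet (h i j)⟩

theorem sc_smul_vertex (c : ℚ_[p]ˣ) (v : Vertex p) : sc c • v = v := by
  induction v using Quotient.inductionOn with | _ L =>
  refine Quotient.sound ⟨c⁻¹, ?_⟩
  change L.1 = c⁻¹ • L.1.map (glMap (sc c))
  rw [eq_inv_smul_iff]
  ext x
  have : ∀ y, glMap (sc c) y = c • y := by
    intro y
    ext i
    simp only [glMap, LinearMap.coe_restrictScalars, Matrix.mulVecLin_apply, Matrix.mulVec,
      dotProduct, Fin.sum_univ_two, sc_apply]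
    fin_cases i <;> simp [Units.smul_def]
  simp only [Submodule.mem_map, this]
  rfl

/-- A lattice is free of rank 2 over `ℤ_p`; a basis, written as columns, is an invertible matrix. -/
theorem exists_gLat_eq (L : Lat p) : ∃ g : GLp p, L.1 = gLat g := by
  have := L.2
  have hr := Submodule.IsLattice.finrank_of_pi ℚ_[p] L.1
  let b : Module.Basis (Fin 2) ℤ_[p] L.1 := Module.finBasisOfFinrankEq ℤ_[p] L.1 (by simpa using hr)
  have hb := (b.extendOfIsLattice ℚ_[p]).linearIndependent
  let A : Matrix (Fin 2) (Fin 2) ℚ_[p] := Matrix.of fun i j => (b j).1 i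
  have hA : IsUnit A := by
    rw [← Matrix.linearIndependent_cols_iff_isUnit]
    have h : A.col = b.extendOfIsLattice ℚ_[p] := by
      ext j i
      simp [A]
    rw [h]
    exact hb
  refine ⟨hA.unit, ?_⟩
  have hspan : L.1 = Submodule.span ℤ_[p] (Set.range fun i => (b i).1) := by
    have h := congrArg (Submodule.map L.1.subtype) b.span_eq
    rw [Submodule.map_span, Submodule.map_top, Submodule.range_subtype, ← Set.range_comp] at h
    exact h.symm
  rw [gLat, stdLat, Submodule.map_span, hspan]
  congr 1
  ext x
  simp only [Set.mem_range, Fin.exists_fin_two, Set.image_insert_eq, Set.image_singleton,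
    Set.mem_insert_iff, Set.mem_singleton_iff]
  have e0 : glMap hA.unit ![1, 0] = (b 0).1 := by
    ext i; simp [glMap, A, Matrix.mulVec, dotProduct]
  have e1 : glMap hA.unit ![0, 1] = (b 1).1 := by
    ext i; simp [glMap, A, Matrix.mulVec, dotProduct]
  rw [e0, e1, @eq_comm _ x, @eq_comm _ x]

end LocalTree

/-! ### Edges as cosets: the stabilizer of `e_*` and normal forms `(p^n, a; 0, 1)`. -/

section LocalStab

variable {p : ℕ} [Fact p.Prime]

theorem norm_sub_eq_left {x y : ℚ_[p]} (h : ‖y‖ < ‖x‖) : ‖x - y‖ = ‖x‖ := by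
  rw [sub_eq_add_neg, Padic.add_eq_max_of_ne (by rw [norm_neg]; exact h.ne'), norm_neg,
    max_eq_left h.le]

theorem exists_smul_vStar (v : Vertex p) : ∃ g : GLp p, v = g • vStar p := by
  induction v using Quotient.inductionOn with | _ L =>
  obtain ⟨g, hg⟩ := exists_gLat_eq L
  exact ⟨g, congrArg (Quotient.mk _) (Subtype.ext hg)⟩

/-- The matrix `(p^n, a; 0, 1)`. -/
def tm (n : ℤ) (a : ℚ_[p]) : GLp p :=
  Matrix.GeneralLinearGroup.mkOfDetNeZero !![(p : ℚ_[p]) ^ n, a; 0, 1] (by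
    simp [Matrix.det_fin_two, zpow_ne_zero n (p_ne_zero p)])

variable (p) in
/-- The matrix `(0, 1; p, 0)`, which reverses the edge `e_*`. -/
def wm : GLp p :=
  Matrix.GeneralLinearGroup.mkOfDetNeZero !![0, 1; (p : ℚ_[p]), 0] (by
    simp [Matrix.det_fin_two, p_ne_zero p])

theorem coe_tm (n : ℤ) (a : ℚ_[p]) :
    (tm n a : Matrix (Fin 2) (Fin 2) ℚ_[p]) = !![(p : ℚ_[p]) ^ n, a; 0, 1] := rfl

theorem coe_wm : (wm p : Matrix (Fin 2) (Fin 2) ℚ_[p]) = !![0, 1; (p : ℚ_[p]), 0] := rfl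

theorem GLp.ext_iff_two {g h : GLp p} :
    g = h ↔ g 0 0 = h 0 0 ∧ g 0 1 = h 0 1 ∧ g 1 0 = h 1 0 ∧ g 1 1 = h 1 1 := by
  constructor
  · rintro rfl; simp
  · rintro ⟨h1, h2, h3, h4⟩
    ext i j
    fin_cases i <;> fin_cases j <;> assumption

theorem tm_mul_tm (m n : ℤ) (a b : ℚ_[p]) : tm m a * tm n b = tm (m + n) (a + (p : ℚ_[p]) ^ m * b) := by
  rw [GLp.ext_iff_two]
  simp [mul_apply_two, coe_tm, zpow_add₀ (p_ne_zero p), add_comm]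

theorem tm_zero_zero : tm 0 0 = (1 : GLp p) := by
  rw [GLp.ext_iff_two]
  simp [coe_tm]

theorem vHat_eq_wm : vHat p = wm p • vStar p := by
  rw [vStar, smul_cls]
  refine congrArg (Quotient.mk _) (Subtype.ext ?_)
  change (hatLat p).1 = (stdLat p).1.map _
  have e0 : glMap (wm p) ![1, 0] = ![0, (p : ℚ_[p])] := by
    ext i; fin_cases i <;> simp [glMap, coe_wm]
  have e1 : glMap (wm p) ![0, 1] = ![1, 0] := by
    ext i; fin_cases i <;> simp [glMap, coe_wm]
  have e2 : (hatLat p).1 = Submodule.span ℤ_[p] {![1, 0], ![0, (p : ℚ_[p])]} := rfl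
  rw [e2, stdLat, Submodule.map_span, Set.image_pair, e0, e1, Set.pair_comm]

theorem conj_wm (g : GLp p) : ((wm p)⁻¹ * g * wm p) 0 0 = g 1 1 ∧
    ((wm p)⁻¹ * g * wm p) 0 1 = g 1 0 / p ∧ ((wm p)⁻¹ * g * wm p) 1 0 = p * g 0 1 ∧
    ((wm p)⁻¹ * g * wm p) 1 1 = g 0 0 := by
  have hp := p_ne_zero p
  simp only [mul_apply_two, coe_inv_eq, coe_wm, Matrix.det_fin_two]
  simp
  field_simp
  simp

theorem ndet_eq_zpow (g : GLp p) :
    ndet g = (p : ℝ) ^ (-(g : Matrix (Fin 2) (Fin 2) ℚ_[p]).det.valuation) :=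
  Padic.norm_eq_zpow_neg_valuation g.det_ne_zero

/-- Valuation of the determinant. -/
def vdet (g : GLp p) : ℤ := (g : Matrix (Fin 2) (Fin 2) ℚ_[p]).det.valuation

theorem ndet_eq_zpow_vdet (g : GLp p) : ndet g = (p : ℝ) ^ (-vdet g) := ndet_eq_zpow g

theorem vdet_mul (g h : GLp p) : vdet (g * h) = vdet g + vdet h := by
  rw [vdet, Units.val_mul, Matrix.det_mul, Padic.valuation_mul g.det_ne_zero h.det_ne_zero]; rfl

theorem vdet_one : vdet (1 : GLp p) = 0 := by simp [vdet]

theorem vdet_inv (g : GLp p) : vdet g⁻¹ = -vdet g := by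
  have := vdet_mul g⁻¹ g
  rw [inv_mul_cancel, vdet_one] at this
  omega

theorem vdet_sc (c : ℚ_[p]ˣ) : vdet (sc c) = 2 * (c : ℚ_[p]).valuation := by
  have : (sc c : Matrix (Fin 2) (Fin 2) ℚ_[p]).det = c * c := by
    rw [det_eq]; simp [sc_apply]
  rw [vdet, this, Padic.valuation_mul c.ne_zero c.ne_zero]
  ring

theorem vdet_tm (n : ℤ) (a : ℚ_[p]) : vdet (tm n a) = n := by
  simp [vdet, coe_tm, Matrix.det_fin_two]

theorem vdet_wm : vdet (wm p) = 1 := by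
  have : Padic.valuation (-1 : ℚ_[p]) = 0 := by
    have := Padic.valuation_intCast (p := p) (-1)
    rw [padicValInt, Int.natAbs_neg] at this
    simpa using this
  have h : (-(p : ℚ_[p])) = (-1) * p := by ring
  simp only [vdet, coe_wm, Matrix.det_fin_two]
  simp only [Matrix.of_apply, Matrix.cons_val', Matrix.cons_val_zero, Matrix.cons_val_one,
    Matrix.cons_val_fin_one, zero_mul, one_mul, zero_sub]
  rw [h, Padic.valuation_mul (by simp) (p_ne_zero p), this, Padic.valuation_p, zero_add]

theorem vdet_eq_zero_iff (g : GLp p) : vdet g = 0 ↔ ndet g = 1 := by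
  rw [ndet_eq_zpow_vdet, zpow_eq_one_iff_right₀ (by positivity) one_lt_p_real.ne']
  omega

/-- The stabilizer of `e_*`. -/
theorem smul_eStar_eq_iff (g : GLp p) : g • eStar p = eStar p ↔
    ‖g 1 0‖ < ‖g 1 1‖ ∧ ‖g 0 0‖ = ‖g 1 1‖ ∧ ‖g 0 1‖ ≤ ‖g 1 1‖ := by
  -- Since `v̂_* = wm v_*`, its stabilizer is the conjugate by `wm` of that of `v_*`.
  have h1 : g • eStar p = eStar p ↔
      g • vStar p = vStar p ∧ ((wm p)⁻¹ * g * wm p) • vStar p = vStar p := by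
    rw [mul_smul, mul_smul, inv_smul_eq_iff, ← vHat_eq_wm, Edge.ext_iff]
    rfl
  have hp := one_lt_p_real (p := p)
  have hn : ndet ((wm p)⁻¹ * g * wm p) = ndet g := by
    rw [map_mul, map_mul, mul_right_comm, ← map_mul, inv_mul_cancel, map_one, one_mul]
  obtain ⟨c1, c2, c3, c4⟩ := conj_wm g
  rw [h1, smul_vStar_eq_iff, smul_vStar_eq_iff, hn]
  simp only [Fin.forall_fin_two, c1, c2, c3, c4, norm_div, norm_mul, Padic.norm_p, div_inv_eq_mul]
  have hdet : ndet g = ‖g 0 0 * g 1 1 - g 0 1 * g 1 0‖ := by rw [ndet_eq, det_eq]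
  have hpos := ndet_pos g
  constructor
  · rintro ⟨⟨⟨h00, h01⟩, h10, h11⟩, ⟨-, h10'⟩, -, -⟩
    -- Fixing `v̂_*` makes the lower left entry smaller by a factor `p`, so the diagonal product
    -- alone carries the norm of the determinant.
    have hlt : ‖g 0 1 * g 1 0‖ < ndet g := by
      rw [norm_mul]
      refine lt_of_pow_lt_pow_left₀ 2 hpos.le ?_
      have h2 : ‖g 1 0‖ ^ 2 < ndet g := by
        by_cases h0 : ‖g 1 0‖ = 0
        · rw [h0]; simpa using hpos
        · refine lt_of_lt_of_le ?_ h10'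
          have : 0 < ‖g 1 0‖ := lt_of_le_of_ne (norm_nonneg _) (Ne.symm h0)
          rw [mul_pow]
          exact lt_mul_of_one_lt_right (pow_pos this 2) (one_lt_pow₀ hp two_ne_zero)
      calc (‖g 0 1‖ * ‖g 1 0‖) ^ 2 = ‖g 0 1‖ ^ 2 * ‖g 1 0‖ ^ 2 := mul_pow _ _ _
        _ ≤ ndet g * ‖g 1 0‖ ^ 2 := by gcongr
        _ < ndet g * ndet g := by gcongr
        _ = ndet g ^ 2 := (sq _).symm
    have heq : ‖g 0 0‖ * ‖g 1 1‖ = ndet g := by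
      rw [← norm_mul, hdet]
      rw [hdet] at hlt
      have := norm_sub_eq_left (x := g 0 0 * g 1 1 - g 0 1 * g 1 0) (y := -(g 0 1 * g 1 0))
        (by rwa [norm_neg])
      rwa [sub_neg_eq_add, sub_add_cancel] at this
    -- The product of the two norms is the norm of the determinant and neither square exceeds it, so
    -- they are equal.
    have hle : ‖g 0 0‖ ≤ ‖g 1 1‖ := by
      by_contra! hlt'
      nlinarith [norm_nonneg (g 1 1), norm_nonneg (g 0 0)]
    have hge : ‖g 1 1‖ ≤ ‖g 0 0‖ := by
      by_contra! hlt'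
      nlinarith [norm_nonneg (g 1 1), norm_nonneg (g 0 0)]
    have heq' : ‖g 0 0‖ = ‖g 1 1‖ := le_antisymm hle hge
    rw [heq', ← sq] at heq
    rw [← heq] at h01 h10'
    have h3 := (pow_le_pow_iff_left₀ (by positivity) (norm_nonneg _) two_ne_zero).mp h10'
    have h4 := (pow_le_pow_iff_left₀ (by positivity) (norm_nonneg _) two_ne_zero).mp h01
    refine ⟨?_, heq', h4⟩
    rw [norm_lt_iff_mul_le]
    · exact h3
    · rintro h0
      rw [h0] at heq
      simp at heq
      linarith
  · rintro ⟨h1, h2, h3⟩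
    have h11 : 0 < ‖g 1 1‖ := (norm_nonneg _).trans_lt h1
    have h10 := (norm_lt_iff_mul_le (norm_pos_iff.mp h11)).mp h1
    have hlt : ‖g 0 1 * g 1 0‖ < ‖g 0 0 * g 1 1‖ := by
      rw [norm_mul, norm_mul, h2]
      calc ‖g 0 1‖ * ‖g 1 0‖ ≤ ‖g 1 1‖ * ‖g 1 0‖ := by gcongr
        _ < ‖g 1 1‖ * ‖g 1 1‖ := by gcongr
    have heq : ndet g = ‖g 1 1‖ ^ 2 := by
      rw [hdet, norm_sub_eq_left hlt, norm_mul, h2, sq]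
    rw [heq, h2]
    have hpi : (p : ℝ)⁻¹ ≤ 1 := inv_le_one_of_one_le₀ hp.le
    refine ⟨⟨⟨le_rfl, by gcongr⟩, by gcongr, le_rfl⟩, ⟨le_rfl, by gcongr⟩, ?_, le_rfl⟩
    gcongr
    exact (mul_le_of_le_one_left (norm_nonneg _) hpi).trans h3

/-- The hypothesis puts the pole of `A` outside `ℤ_p`, so `A ℤ_p` is a ball of `ℚ_p` with centre
`A(0) = A 0 1 / A 1 1`. Its level is forced by the determinant, as elements of the stabilizer have
determinant of norm the square of their lower right entry. -/
theorem eq_tm_mul {A : GLp p} (h : ‖A 1 0‖ < ‖A 1 1‖) :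
    ∃ i : GLp p, i • eStar p = eStar p ∧
      A = tm (vdet A - 2 * (A 1 1).valuation) (A 0 1 / A 1 1) * i := by
  have h11 : A 1 1 ≠ 0 := norm_pos_iff.mp ((norm_nonneg _).trans_lt h)
  set n := vdet A - 2 * (A 1 1).valuation with hn
  have hp : (p : ℚ_[p]) ^ n ≠ 0 := zpow_ne_zero _ (p_ne_zero p)
  refine ⟨(tm n (A 0 1 / A 1 1))⁻¹ * A, ?_, by rw [mul_inv_cancel_left]⟩
  have e : ∀ j, ((tm n (A 0 1 / A 1 1))⁻¹ * A) 0 j =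
      ((p : ℚ_[p]) ^ n)⁻¹ * (A 0 j - A 0 1 / A 1 1 * A 1 j) ∧
      ((tm n (A 0 1 / A 1 1))⁻¹ * A) 1 j = A 1 j := by
    intro j
    simp only [mul_apply_two, coe_inv_eq, coe_tm, Matrix.det_fin_two]
    simp
    field_simp
    simp [sub_eq_add_neg]
  rw [smul_eStar_eq_iff, (e 0).2, (e 1).2, (e 0).1, (e 1).1]
  refine ⟨h, ?_, ?_⟩
  · have : A 0 0 - A 0 1 / A 1 1 * A 1 0 = (A : Matrix (Fin 2) (Fin 2) ℚ_[p]).det / A 1 1 := by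
      rw [det_eq]; field_simp
    rw [this, norm_mul, norm_inv, norm_div, ← ndet_eq, ndet_eq_zpow_vdet, Padic.norm_p_zpow,
      Padic.norm_eq_zpow_neg_valuation h11, ← zpow_neg, ← zpow_sub₀, ← zpow_add₀]
    · congr 1; omega
    all_goals exact Nat.cast_ne_zero.mpr (Fact.out : p.Prime).ne_zero
  · rw [div_mul_cancel₀ _ h11]; simp

/-- One of the two complementary balls `A ℤ_p` and `A wm ℤ_p` avoids `∞`. -/
theorem eq_tm_mul_or (A : GLp p) : ∃ (n : ℤ) (a : ℚ_[p]) (i : GLp p), i • eStar p = eStar p ∧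
    (A = tm n a * i ∨ A * wm p = tm n a * i) := by
  have hp := one_lt_p_real (p := p)
  by_cases h : ‖A 1 0‖ < ‖A 1 1‖
  · obtain ⟨i, hi, e⟩ := eq_tm_mul h
    exact ⟨_, _, i, hi, Or.inl e⟩
  · have h00 : A 1 0 ≠ 0 := by
      intro h0
      have h1 : A 1 1 = 0 := by
        rw [h0] at h; simpa using h
      apply A.det_ne_zero
      rw [det_eq, h0, h1]; simp
    have h' : ‖(A * wm p) 1 0‖ < ‖(A * wm p) 1 1‖ := by
      simp only [mul_apply_two, coe_wm]
      simp
      calc ‖A 1 1‖ * (p : ℝ)⁻¹ ≤ ‖A 1 0‖ * (p : ℝ)⁻¹ := by gcongr; exact not_lt.mp h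
        _ < ‖A 1 0‖ := mul_lt_of_lt_one_right (norm_pos_iff.mpr h00) (inv_lt_one_of_one_lt₀ hp)
    obtain ⟨i, hi, e⟩ := eq_tm_mul h'
    exact ⟨_, _, i, hi, Or.inr e⟩

theorem wm_smul_vHat : wm p • vHat p = vStar p := by
  have h : wm p * wm p = sc (Units.mk0 (p : ℚ_[p]) (p_ne_zero p)) := by
    rw [GLp.ext_iff_two]
    simp [mul_apply_two, coe_wm, sc_apply]
  rw [vHat_eq_wm, ← mul_smul, h, sc_smul_vertex]

/-- `ℤ_p ⊕ p ℤ_p` is homothetic to `p⁻¹ ℤ_p ⊕ ℤ_p`. -/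
theorem vHat_eq_tm : vHat p = tm (-1) (0 : ℚ_[p]) • vStar p := by
  rw [vHat_eq_wm, ← inv_smul_eq_iff, ← mul_smul, smul_vStar_eq_iff]
  have hp := p_ne_zero p
  simp only [map_mul, ndet_eq_zpow_vdet, vdet_inv, vdet_wm, vdet_tm, mul_apply_two, coe_inv_eq,
    coe_wm, coe_tm, Matrix.det_fin_two, Fin.forall_fin_two]
  simp
  refine ⟨⟨by positivity, ?_⟩, ?_, by positivity⟩ <;> rw [sq, mul_inv]

end LocalStab

/-! ### Parity and distance to `v_*`. -/

section Depth

variable {p : ℕ} [Fact p.Prime]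

variable (p) in
/-- `p` as a unit of `ℚ_p`. -/
def pu : ℚ_[p]ˣ := Units.mk0 (p : ℚ_[p]) (p_ne_zero p)

theorem natCast_smul_eq (L : Submodule ℤ_[p] (Fin 2 → ℚ_[p])) :
    (p : ℤ_[p]) • L = pu p • L := by
  ext x
  constructor
  · rintro ⟨y, hy, rfl⟩
    exact ⟨y, hy, by ext i; simp [pu, Algebra.smul_def]⟩
  · rintro ⟨y, hy, rfl⟩
    exact ⟨y, hy, by ext i; simp [pu, Algebra.smul_def]⟩

/-- From `p Λ₁ ⊊ Λ₂ ⊊ Λ₁` one gets `p Λ₂ ⊊ p Λ₁ ⊊ Λ₂`, and `p Λ₁` is homothetic to `Λ₁`. -/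
theorem Nbr.symm {v w : Vertex p} (h : Nbr v w) : Nbr w v := by
  obtain ⟨L₁, L₂, rfl, rfl, h₁, h₂⟩ := h
  have hle : ∀ {L L' : Submodule ℤ_[p] (Fin 2 → ℚ_[p])}, L < L' → pu p • L < pu p • L' := by
    intro L L' hl
    rw [← natCast_smul_eq, ← natCast_smul_eq]
    refine Submodule.map_strictMono_of_injective ?_ hl
    intro x y hxy
    have : (p : ℤ_[p]) • x = (p : ℤ_[p]) • y := hxy
    exact smul_right_injective _ (NeZero.ne (p : ℤ_[p])) this
  have := L₁.2
  refine ⟨L₂, ⟨pu p • L₁.1, inferInstance⟩, rfl, ?_, ?_, ?_⟩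
  · exact Quotient.sound ⟨pu p, rfl⟩
  · rw [natCast_smul_eq]; exact hle h₂
  · change pu p • L₁.1 < L₂.1
    rw [← natCast_smul_eq]; exact h₁

/-- Let `m` be the change of basis from `Λ₁` to `Λ₂`. Both `m` and `p m⁻¹` are integral, neither is
unimodular, and their determinants multiply to `p²`, so each has valuation 1. -/
theorem Nbr.exists_matrix {g h : GLp p} (H : Nbr (g • vStar p) (h • vStar p)) :
    ∃ (c : ℚ_[p]ˣ) (m : GLp p), h = sc c * g * m ∧ IsInt m ∧ vdet m = 1 := by
  obtain ⟨L₁, L₂, h₁, h₂, l₁, l₂⟩ := H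
  obtain ⟨c₁, e₁⟩ := Quotient.exact h₁
  obtain ⟨c₂, e₂⟩ := Quotient.exact h₂
  change L₁.1 = c₁ • gLat g at e₁
  change L₂.1 = c₂ • gLat h at e₂
  rw [e₁, e₂, natCast_smul_eq, smul_gLat, smul_gLat, smul_gLat] at l₁
  rw [e₁, e₂, smul_gLat, smul_gLat] at l₂
  set m := (sc c₁ * g)⁻¹ * (sc c₂ * h) with hm
  have hint : IsInt m := (gLat_le_iff _ _).mp l₂.le
  have hint' : IsInt (m⁻¹ * sc (pu p)) := by
    have := (gLat_le_iff _ _).mp l₁.le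
    rwa [sc_comm (pu p), ← mul_assoc, ← inv_inv (sc c₁ * g), ← mul_inv_rev] at this
  have hp := one_lt_p_real (p := p)
  have hv : ∀ x : GLp p, IsInt x → 0 ≤ vdet x ∧ (vdet x = 0 → IsInt x⁻¹) := by
    intro x hx
    constructor
    · have := hx.ndet_le
      rw [ndet_eq_zpow_vdet, zpow_le_one_iff_right₀ hp] at this
      omega
    · intro h0
      rw [vdet_eq_zero_iff] at h0
      rw [isInt_inv_iff, h0]
      exact hx
  have h1 : vdet m ≠ 0 := by
    intro h0
    apply l₂.not_ge
    rw [gLat_le_iff]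
    have := (hv m hint).2 h0
    rwa [hm, mul_inv_rev, inv_inv] at this
  have h2 : vdet (m⁻¹ * sc (pu p)) ≠ 0 := by
    intro h0
    apply l₁.not_ge
    rw [gLat_le_iff, sc_comm (pu p)]
    have := (hv _ hint').2 h0
    rwa [mul_inv_rev, inv_inv, hm, ← mul_assoc, ← mul_inv_rev] at this
  have h3 := (hv _ hint).1
  have h4 := (hv _ hint').1
  rw [vdet_mul, vdet_inv, vdet_sc] at h2 h4
  simp only [pu, Units.val_mk0, Padic.valuation_p] at h2 h4
  refine ⟨c₂⁻¹ * c₁, m, ?_, hint, by omega⟩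
  rw [hm, sc, map_mul, mul_assoc _ _ g, mul_assoc]
  change _ = _ * ((sc c₁ * g) * _)
  rw [mul_inv_cancel_left, ← sc, ← sc_inv, inv_mul_cancel_left]

theorem Adj.nbr {v w : Vertex p} (h : (tree p).Adj v w) : Nbr v w :=
  h.2.elim id Nbr.symm

theorem vdet_parity_of_eq {g h : GLp p} (H : g • vStar p = h • vStar p) :
    Even (vdet g) ↔ Even (vdet h) := by
  rw [smul_vStar_eq_iff'] at H
  obtain ⟨c, hc⟩ := H
  rw [gLat_eq_iff, gLat_eq_one_iff, ← vdet_eq_zero_iff, vdet_mul, vdet_inv, vdet_mul, vdet_sc] at hc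
  have h2 : vdet h = vdet g + 2 * (c : ℚ_[p]).valuation := by omega
  rw [h2]
  simp [Int.even_add]

theorem Nbr.parity {g h : GLp p} (H : Nbr (g • vStar p) (h • vStar p)) :
    Even (vdet h) ↔ ¬ Even (vdet g) := by
  obtain ⟨c, m, rfl, -, hm⟩ := H.exists_matrix
  have h2 := even_two_mul (c : ℚ_[p]).valuation
  rw [vdet_mul, vdet_mul, vdet_sc, hm, Int.even_add, Int.even_add]
  simp only [h2, Int.not_even_one]
  tauto

theorem Nbr.ne {v w : Vertex p} (h : Nbr v w) : v ≠ w := by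
  rintro rfl
  obtain ⟨g, rfl⟩ := exists_smul_vStar v
  have := h.parity
  tauto

theorem Nbr.adj {v w : Vertex p} (h : Nbr v w) : (tree p).Adj v w := ⟨h.ne, Or.inl h⟩

/-- The parity of `vdet` is unchanged by homotheties and flips along each edge, so it colours the
graph with two colours; acyclicity plays no role. -/
theorem walk_parity {v : Vertex p} (W : (tree p).Walk v (vStar p)) (g : GLp p)
    (hg : v = g • vStar p) : Even (vdet g) ↔ Even W.length := by
  suffices ∀ {v w : Vertex p} (W : (tree p).Walk v w) (g h : GLp p), v = g • vStar p →
      w = h • vStar p → ((Even (vdet g) ↔ Even (vdet h)) ↔ Even W.length) by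
    have := this W g 1 hg (one_smul _ _).symm
    simpa [vdet_one] using this
  intro v w W
  induction W with
  | nil =>
    intro g h hg hh
    simp [vdet_parity_of_eq (hg.symm.trans hh)]
  | @cons v u w hadj W ih =>
    intro g h hg hh
    obtain ⟨k, hk⟩ := exists_smul_vStar u
    have h1 := ih k h hk hh
    subst hg hk
    have h2 := (Adj.nbr hadj).parity
    rw [SimpleGraph.Walk.length_cons, Nat.even_add_one]
    tauto

/-- The quantity `max ‖g i j‖² / ndet g` depends only on the vertex, is 1 at `v_*`, and grows by at
most a factor `p` along an edge. This bounds distances from below. -/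
theorem norm_sq_le_of_walk {v : Vertex p} (W : (tree p).Walk v (vStar p)) (g : GLp p)
    (hg : v = g • vStar p) (i j : Fin 2) : ‖g i j‖ ^ 2 ≤ (p : ℝ) ^ W.length * ndet g := by
  generalize hw : vStar p = w at W
  induction W generalizing g i j with
  | nil =>
    subst hw
    simpa using (smul_vStar_eq_iff g).mp hg.symm i j
  | @cons v u w hadj W ih =>
    subst hw
    obtain ⟨k, rfl⟩ := exists_smul_vStar u
    have h1 := fun i j => ih k rfl i j rfl
    subst hg
    obtain ⟨c, m, rfl, hm, hm1⟩ := (Adj.nbr hadj).symm.exists_matrix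
    rw [map_mul, map_mul, ndet_sc, ndet_eq_zpow_vdet m, hm1, SimpleGraph.Walk.length_cons]
    have hp : (p : ℝ) ≠ 0 := Nat.cast_ne_zero.mpr (Fact.out : p.Prime).ne_zero
    have h2 : ‖(sc c * k * m) i j‖ ^ 2 ≤
        ‖(c : ℚ_[p])‖ ^ 2 * ((p : ℝ) ^ W.length * ndet k) := by
      rw [mul_assoc, sc_mul_apply, norm_mul, mul_pow, mul_apply_two]
      gcongr
      have h3 : ∀ l, ‖k i l * m l j‖ ≤ ‖k i l‖ := fun l => by
        rw [norm_mul]; exact mul_le_of_le_one_right (norm_nonneg _) (hm _ _)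
      rcases le_max_iff.mp (IsUltrametricDist.norm_add_le_max (k i 0 * m 0 j) (k i 1 * m 1 j))
        with h | h
      · exact (pow_le_pow_left₀ (norm_nonneg _) (h.trans (h3 0)) 2).trans (h1 i 0)
      · exact (pow_le_pow_left₀ (norm_nonneg _) (h.trans (h3 1)) 2).trans (h1 i 1)
    refine h2.trans (le_of_eq ?_)
    rw [pow_succ, zpow_neg_one]
    field_simp
    try ring

theorem tm_smul_eq {n : ℤ} {a b : ℚ_[p]} (h : ‖a - b‖ ≤ (p : ℝ) ^ (-n)) :
    ∃ i : GLp p, i • eStar p = eStar p ∧ tm n a = tm n b * i := by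
  refine ⟨(tm n b)⁻¹ * tm n a, ?_, by rw [mul_inv_cancel_left]⟩
  have hp : (p : ℚ_[p]) ^ n ≠ 0 := zpow_ne_zero _ (p_ne_zero p)
  have e : (tm n b)⁻¹ * tm n a = tm 0 ((p : ℚ_[p]) ^ (-n) * (a - b)) := by
    rw [inv_mul_eq_iff_eq_mul, tm_mul_tm, ← mul_assoc, ← zpow_add₀ (p_ne_zero p)]
    simp
  rw [e, smul_eStar_eq_iff]
  simp only [coe_tm]
  simp only [zpow_zero, Matrix.of_apply, Matrix.cons_val', Matrix.cons_val_zero,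
    Matrix.cons_val_one, Matrix.cons_val_fin_one, norm_zero, norm_one, zero_lt_one, true_and,
    norm_mul, Padic.norm_p_zpow, neg_neg]
  have hp' := one_lt_p_real (p := p)
  calc (p : ℝ) ^ n * ‖a - b‖ ≤ (p : ℝ) ^ n * (p : ℝ) ^ (-n) := by gcongr
    _ = 1 := by rw [← zpow_add₀ (by positivity)]; simp

theorem smul_vStar_of_smul_eStar {i : GLp p} (h : i • eStar p = eStar p) :
    i • vStar p = vStar p := congrArg Edge.s h

theorem smul_vHat_of_smul_eStar {i : GLp p} (h : i • eStar p = eStar p) :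
    i • vHat p = vHat p := congrArg Edge.t h

theorem tm_smul_vHat (n : ℤ) (a : ℚ_[p]) : tm n a • vHat p = tm (n - 1) a • vStar p := by
  rw [vHat_eq_tm, ← mul_smul, tm_mul_tm, mul_zero, add_zero, sub_eq_add_neg]

theorem nbr_smul (g : GLp p) : Nbr (g • vStar p) (g • vHat p) := (eStar p).nbr.smul g

theorem nbr_tm (n : ℤ) (a : ℚ_[p]) : Nbr (tm n a • vStar p) (tm (n - 1) a • vStar p) := by
  rw [← tm_smul_vHat]; exact nbr_smul _

/-- Vertices correspond to the balls `a + p^n ℤ_p` of `ℚ_p`. The second case uses that `wm`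
exchanges the ends of `e_*`. -/
theorem exists_tm_smul_vStar (v : Vertex p) :
    ∃ (n : ℤ) (a : ℚ_[p]), v = tm n a • vStar p := by
  obtain ⟨g, rfl⟩ := exists_smul_vStar v
  obtain ⟨n, a, i, hi, e | e⟩ := eq_tm_mul_or g
  · rw [e, mul_smul, smul_vStar_of_smul_eStar hi]
    exact ⟨_, _, rfl⟩
  · have e2 : g • vStar p = (g * wm p) • vHat p := by rw [mul_smul, wm_smul_vHat]
    rw [e2, e, mul_smul, smul_vHat_of_smul_eStar hi, tm_smul_vHat]
    exact ⟨_, _, rfl⟩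

/-- Passing from a ball to the ball one level larger is an edge. Enlarging `a + p^n ℤ_p` until it
contains `0` and `ℤ_p` meets the same process started from `ℤ_p`. -/
theorem tree_reachable (v : Vertex p) : (tree p).Reachable v (vStar p) := by
  obtain ⟨n, a, rfl⟩ := exists_tm_smul_vStar v
  have hstep : ∀ (k : ℕ) (n : ℤ) (a : ℚ_[p]),
      (tree p).Reachable (tm n a • vStar p) (tm (n - k) a • vStar p) := by
    intro k n a
    induction k with
    | zero => simp
    | succ k ih =>
      refine ih.trans ?_
      have := (nbr_tm (n - k) a).adj.reachable
      rwa [show n - (k : ℤ) - 1 = n - (k + 1 : ℕ) by push_cast; ring] at this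
  obtain ⟨k, hk⟩ := pow_unbounded_of_one_lt ‖a‖ (one_lt_p_real (p := p))
  obtain ⟨i, hi, e⟩ := tm_smul_eq (p := p) (n := -(k + n.natAbs : ℕ)) (a := a) (b := 0) (by
    rw [sub_zero, neg_neg, zpow_natCast]
    exact hk.le.trans (pow_le_pow_right₀ one_lt_p_real.le (by omega)))
  have h1 := hstep (n + k + n.natAbs).toNat n a
  have h2 := hstep (k + n.natAbs) 0 (0 : ℚ_[p])
  rw [show n - ((n + k + n.natAbs).toNat : ℤ) = -(k + n.natAbs : ℕ) by omega, e, mul_smul,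
    smul_vStar_of_smul_eStar hi] at h1
  rw [zero_sub, tm_zero_zero, one_smul] at h2
  exact h1.trans h2.symm

theorem isEven_smul_vStar (g : GLp p) : (g • vStar p).IsEven ↔ Even (vdet g) := by
  obtain ⟨W, hW⟩ := (tree_reachable (g • vStar p)).exists_walk_length_eq_dist
  rw [walk_parity W g rfl, hW]; rfl

/-- Enlarging the ball `n` times reaches `ℤ_p`. Conversely the lower right entry 1, against a
determinant of norm `p^(-n)`, excludes shorter walks by `norm_sq_le_of_walk`. -/
theorem depth_tm (n : ℕ) {a : ℚ_[p]} (ha : ‖a‖ ≤ 1) : depth (tm n a • vStar p) = n := by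
  have hp := one_lt_p_real (p := p)
  apply le_antisymm
  · suffices ∃ W : (tree p).Walk (tm n a • vStar p) (vStar p), W.length = n by
      obtain ⟨W, hW⟩ := this
      exact (SimpleGraph.dist_le W).trans hW.le
    induction n with
    | zero =>
      obtain ⟨i, hi, e⟩ := tm_smul_eq (n := 0) (a := a) (b := 0) (by simpa using ha)
      rw [Nat.cast_zero, e, tm_zero_zero, one_mul, smul_vStar_of_smul_eStar hi]
      exact ⟨.nil, rfl⟩
    | succ n ih =>
      obtain ⟨W, hW⟩ := ih
      have h := (nbr_tm (n + 1 : ℕ) a).adj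
      rw [Nat.cast_succ, add_sub_cancel_right] at h
      exact ⟨.cons h W, by simp [hW]⟩
  · obtain ⟨W, hW⟩ := (tree_reachable (tm n a • vStar p)).exists_walk_length_eq_dist
    have h := norm_sq_le_of_walk W _ rfl 1 1
    rw [hW, ndet_eq_zpow_vdet, vdet_tm, coe_tm] at h
    simp only [Matrix.of_apply, Matrix.cons_val', Matrix.cons_val_one, Matrix.cons_val_fin_one,
      norm_one, one_pow] at h
    rw [← zpow_natCast (p : ℝ), ← zpow_add₀ (by positivity)] at h
    rw [one_le_zpow_iff_right₀ hp] at h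
    change n ≤ (tree p).dist _ _
    omega

end Depth

/-! ### Balls in the projective line. -/

section Projective

variable {p : ℕ} [Fact p.Prime]

open Classical in
theorem mobius_coe (g : GLp p) (x : ℚ_[p]) : mobius g (x : P1 p) =
    if g 1 0 * x + g 1 1 = 0 then OnePoint.infty
    else (((g 0 0 * x + g 0 1) / (g 1 0 * x + g 1 1) : ℚ_[p]) : P1 p) := by
  simp only [mobius]
  convert OnePoint.smul_some_eq_ite using 2

open Classical in
theorem mobius_infty (g : GLp p) : mobius g (OnePoint.infty : P1 p) =
    if g 1 0 = 0 then OnePoint.infty else ((g 0 0 / g 1 0 : ℚ_[p]) : P1 p) := by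
  simp only [mobius]
  convert OnePoint.smul_infty_eq_ite g using 2

theorem coe_mem_Zp (x : ℚ_[p]) : (x : P1 p) ∈ Zp p ↔ ‖x‖ ≤ 1 := by
  constructor
  · rintro ⟨y, hy, h⟩
    rwa [← OnePoint.coe_injective h]
  · intro h
    exact ⟨x, h, rfl⟩

theorem infty_notMem_Zp : (OnePoint.infty : P1 p) ∉ Zp p := by
  rintro ⟨y, hy, h⟩
  exact OnePoint.coe_ne_infty _ h

theorem mul_smul_clopens (g h : GLp p) (U : Clopens (P1 p)) : (g * h) • U = g • h • U := by
  ext x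
  change mobius (g * h)⁻¹ x ∈ U ↔ mobius h⁻¹ (mobius g⁻¹ x) ∈ U
  rw [mul_inv_rev, mobius_mul]

theorem one_smul_clopens (U : Clopens (P1 p)) : (1 : GLp p) • U = U := by
  ext x
  change mobius (1 : GLp p)⁻¹ x ∈ U ↔ x ∈ U
  rw [inv_one, mobius_one]

theorem mobius_mem_smul (g : GLp p) (x : P1 p) (U : Clopens (P1 p)) :
    mobius g x ∈ g • U ↔ x ∈ U := by
  rw [mem_smul_clopens, ← mobius_mul, inv_mul_cancel, mobius_one]

theorem smul_clopens_compl (g : GLp p) (U : Clopens (P1 p)) : g • Uᶜ = (g • U)ᶜ := rfl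

theorem smul_clopens_mono (g : GLp p) {U V : Clopens (P1 p)} (h : U ≤ V) : g • U ≤ g • V :=
  fun _ hx => h hx

/-- This makes `e ↦ U_e` well defined. On `ℤ_p` the denominator of `i` has constant norm `‖i 1 1‖`,
which dominates the numerator. -/
theorem smul_Zp_eq {i : GLp p} (hi : i • eStar p = eStar p) : i • Zp p = Zp p := by
  have key : ∀ i : GLp p, i • eStar p = eStar p → i • Zp p ≤ Zp p := by
    intro i hi x hx
    obtain ⟨y, hy, rfl⟩ := (coe_smul_clopens i (Zp p)).subset hx
    obtain ⟨y, hy, rfl⟩ := hy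
    obtain ⟨h1, h2, h3⟩ := (smul_eStar_eq_iff i).mp hi
    have hy : ‖y‖ ≤ 1 := hy
    have h4 : ‖i 1 0 * y + i 1 1‖ = ‖i 1 1‖ := by
      have : ‖-(i 1 0 * y)‖ < ‖i 1 1‖ := by
        rw [norm_neg, norm_mul]
        exact (mul_le_of_le_one_right (norm_nonneg _) hy).trans_lt h1
      have := norm_sub_eq_left this
      rwa [sub_neg_eq_add, add_comm] at this
    have h5 : 0 < ‖i 1 1‖ := (norm_nonneg _).trans_lt h1
    have h6 : i 1 0 * y + i 1 1 ≠ 0 := by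
      rw [← norm_pos_iff, h4]; exact h5
    have h7 : ‖i 0 0 * y + i 0 1‖ ≤ ‖i 1 1‖ := by
      refine (IsUltrametricDist.norm_add_le_max _ _).trans (max_le ?_ h3)
      rw [norm_mul, h2]
      exact mul_le_of_le_one_right (norm_nonneg _) hy
    change mobius i y ∈ Zp p
    rw [mobius_coe, if_neg h6, coe_mem_Zp, norm_div, h4]
    exact div_le_one_of_le₀ h7 h5.le
  refine le_antisymm (key i hi) ?_
  have h := smul_clopens_mono i (key i⁻¹ (by rw [inv_smul_eq_iff, hi]))
  rwa [← mul_smul_clopens, mul_inv_cancel, one_smul_clopens] at h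

theorem wm_inv : (wm p)⁻¹ = sc (pu p)⁻¹ * wm p := by
  rw [inv_eq_iff_mul_eq_one, ← mul_assoc, ← sc_comm, mul_assoc, ← sc_inv, inv_mul_eq_one]
  rw [GLp.ext_iff_two]
  simp [mul_apply_two, coe_wm, sc_apply, pu]

/-- `wm` acts as `x ↦ 1 / (p x)`, and `‖x‖ ≤ 1` turns into norm at least `p`, with `0` sent to `∞`.
-/
theorem wm_smul_Zp : wm p • Zp p = (Zp p)ᶜ := by
  have hp := one_lt_p_real (p := p)
  ext x
  change mobius (wm p)⁻¹ x ∈ Zp p ↔ x ∉ Zp p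
  induction x using OnePoint.rec with
  | infty =>
    rw [mobius_infty]
    simp [wm_inv, sc_mul_apply, coe_wm, coe_mem_Zp, infty_notMem_Zp, pu]
  | coe x =>
    have h1 : (wm p)⁻¹ 1 0 * x + (wm p)⁻¹ 1 1 = x := by
      simp [wm_inv, sc_mul_apply, coe_wm, pu]
    have h2 : (wm p)⁻¹ 0 0 * x + (wm p)⁻¹ 0 1 = (p : ℚ_[p])⁻¹ := by
      simp [wm_inv, sc_mul_apply, coe_wm, pu]
    rw [mobius_coe, coe_mem_Zp, h1, h2]
    by_cases hx : x = 0
    · simp [hx, infty_notMem_Zp]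
    · rw [if_neg hx, coe_mem_Zp, norm_div, norm_inv, Padic.norm_p, inv_inv,
        div_le_one (norm_pos_iff.mpr hx)]
      have := norm_lt_iff_mul_le (x := 1) hx
      rw [norm_one, one_mul] at this
      rw [not_le, this]

theorem tm_inv (n : ℤ) (a : ℚ_[p]) : (tm n a)⁻¹ = tm (-n) (-((p : ℚ_[p]) ^ (-n) * a)) := by
  rw [inv_eq_iff_mul_eq_one, tm_mul_tm, ← tm_zero_zero]
  have := zpow_ne_zero n (p_ne_zero p)
  congr 1
  · ring
  · rw [zpow_neg]; field_simp; ring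

theorem mobius_tm (n : ℤ) (a x : ℚ_[p]) :
    mobius (tm n a) (x : P1 p) = (((p : ℚ_[p]) ^ n * x + a : ℚ_[p]) : P1 p) := by
  rw [mobius_coe]
  simp [coe_tm]

theorem coe_mem_tm_smul_Zp (n : ℤ) (a x : ℚ_[p]) :
    (x : P1 p) ∈ tm n a • Zp p ↔ ‖x - a‖ ≤ (p : ℝ) ^ (-n) := by
  have hp := one_lt_p_real (p := p)
  rw [mem_smul_clopens, tm_inv, mobius_tm, coe_mem_Zp, ← sub_eq_add_neg, ← mul_sub, norm_mul,
    Padic.norm_p_zpow, neg_neg, zpow_neg]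
  rw [← one_div, le_div_iff₀ (by positivity), mul_comm]

theorem infty_notMem_tm_smul_Zp (n : ℤ) (a : ℚ_[p]) :
    (OnePoint.infty : P1 p) ∉ tm n a • Zp p := by
  rw [mem_smul_clopens, tm_inv, mobius_infty]
  simp [coe_tm, infty_notMem_Zp]

/-- Membership of `A x` in `U`, for `x ∈ ℤ_p`, depends only on `x` modulo `p ^ n`. -/
def IsPeriod (A : GLp p) (U : Clopens (P1 p)) (n : ℕ) : Prop :=
  ∀ x y : ℚ_[p], ‖x‖ ≤ 1 → ‖y‖ ≤ 1 → ‖x - y‖ ≤ (p : ℝ) ^ (-n : ℤ) →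
    (mobius A x ∈ U ↔ mobius A y ∈ U)

theorem IsPeriod.mono {A : GLp p} {U : Clopens (P1 p)} {m n : ℕ} (h : IsPeriod A U m)
    (hmn : m ≤ n) : IsPeriod A U n := fun x y hx hy hxy =>
  h x y hx hy (hxy.trans (zpow_le_zpow_right₀ one_lt_p_real.le (by omega)))

/-- The indicator function of a clopen subset of the compact ring `ℤ_p` is uniformly continuous. -/
theorem exists_isPeriod (A : GLp p) (U : Clopens (P1 p)) : ∃ n, IsPeriod A U n := by
  classical
  have hp := one_lt_p_real (p := p)
  let S : Set ℤ_[p] := (fun x : ℤ_[p] => mobius A ((x : ℚ_[p]) : P1 p)) ⁻¹' U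
  have hS : IsClopen S := U.isClopen.preimage
    ((continuous_mobius A).comp (OnePoint.continuous_coe.comp continuous_subtype_val))
  have hf : Continuous (S.indicator (fun _ => (1 : ℝ))) :=
    continuous_const.indicator (by simp [hS.frontier_eq])
  have hu := Metric.uniformContinuous_iff.mp (CompactSpace.uniformContinuous_of_continuous hf)
  obtain ⟨δ, hδ, H⟩ := hu 1 one_pos
  obtain ⟨n, hn⟩ := exists_pow_lt_of_lt_one hδ (inv_lt_one_of_one_lt₀ hp)
  refine ⟨n, fun x y hx hy hxy => ?_⟩
  obtain ⟨X, rfl⟩ : ∃ X : ℤ_[p], (X : ℚ_[p]) = x := ⟨⟨x, hx⟩, rfl⟩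
  obtain ⟨Y, rfl⟩ : ∃ Y : ℤ_[p], (Y : ℚ_[p]) = y := ⟨⟨y, hy⟩, rfl⟩
  have h1 := @H X Y (by
    rw [dist_eq_norm]
    refine lt_of_le_of_lt ?_ hn
    rw [inv_pow, ← zpow_natCast, ← zpow_neg]
    exact hxy)
  change X ∈ S ↔ Y ∈ S
  by_cases h2 : X ∈ S <;> by_cases h3 : Y ∈ S <;> simp [h2, h3] at h1 ⊢

end Projective

/-! ### Measures attached to harmonic functions. -/

section Measures

variable {p : ℕ} [Fact p.Prime]

theorem Meas0.map_bot (m : Meas0 p) : m ⊥ = 0 := by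
  have := m.map_sup' ⊥ ⊥ disjoint_bot_left
  rw [sup_idem] at this
  change m ⊥ = m ⊥ + m ⊥ at this
  omega

theorem Meas0.map_compl (m : Meas0 p) (U : Clopens (P1 p)) : m Uᶜ = -m U := by
  have h := m.map_sup' U Uᶜ disjoint_compl_right
  rw [sup_compl_eq_top, m.map_top'] at h
  change 0 = m U + m Uᶜ at h
  omega

theorem Meas0.map_finset_sup {ι : Type*} (m : Meas0 p) (s : Finset ι) (f : ι → Clopens (P1 p))
    (hf : (s : Set ι).PairwiseDisjoint f) : m (s.sup f) = ∑ i ∈ s, m (f i) := by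
  classical
  induction s using Finset.induction_on with
  | empty => simpa using m.map_bot
  | insert a s ha ih =>
    rw [Finset.sup_insert, Finset.sum_insert ha, ← ih (hf.subset (by simp))]
    refine m.map_sup' _ _ ?_
    rw [Finset.disjoint_sup_right]
    intro i hi
    exact hf (by simp) (by simp [hi]) (by rintro rfl; exact ha hi)

theorem norm_natCast_le_one (a : ℕ) : ‖(a : ℚ_[p])‖ ≤ 1 := by
  exact_mod_cast Padic.norm_int_le_one (p := p) a

theorem exists_natCast_near (n : ℕ) {x : ℚ_[p]} (hx : ‖x‖ ≤ 1) :
    ∃ a ∈ Finset.range (p ^ n), ‖x - (a : ℚ_[p])‖ ≤ (p : ℝ) ^ (-n : ℤ) := by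
  obtain ⟨X, rfl⟩ : ∃ X : ℤ_[p], (X : ℚ_[p]) = x := ⟨⟨x, hx⟩, rfl⟩
  refine ⟨X.appr n, Finset.mem_range.mpr (X.appr_lt n), ?_⟩
  have := (PadicInt.norm_le_pow_iff_mem_span_pow _ n).mpr (X.appr_spec n)
  exact_mod_cast this

theorem natCast_near_inj {n a b : ℕ} (ha : a < p ^ n) (hb : b < p ^ n)
    (h : ‖(a : ℚ_[p]) - b‖ ≤ (p : ℝ) ^ (-n : ℤ)) : a = b := by
  have h1 := (Padic.norm_int_le_pow_iff_dvd (p := p) ((a : ℤ) - b) n).mp (by exact_mod_cast h)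
  have h2 : (b : ℤ) ≡ a [ZMOD (p ^ n : ℕ)] := Int.modEq_iff_dvd.mpr (by exact_mod_cast h1)
  have h3 : b ≡ a [MOD p ^ n] := (Int.natCast_modEq_iff).mp h2
  exact (Nat.ModEq.eq_of_lt_of_lt h3 hb ha).symm

theorem near_trans {n : ℤ} {x y z : ℚ_[p]} (h : ‖x - y‖ ≤ (p : ℝ) ^ n)
    (h' : ‖x - z‖ ≤ (p : ℝ) ^ n) : ‖y - z‖ ≤ (p : ℝ) ^ n := by
  have : y - z = (x - z) - (x - y) := by ring
  rw [this]
  exact (norm_sub_le_max' _ _).trans (max_le h' h)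

theorem mobius_mem_mul_tm (A : GLp p) (n : ℤ) (a x : ℚ_[p]) :
    mobius A (x : P1 p) ∈ (A * tm n a) • Zp p ↔ ‖x - a‖ ≤ (p : ℝ) ^ (-n) := by
  rw [mul_smul_clopens, mobius_mem_smul, coe_mem_tm_smul_Zp]

theorem tm_smul_Zp_le (n : ℕ) {a : ℚ_[p]} (ha : ‖a‖ ≤ 1) : tm n a • Zp p ≤ Zp p := by
  intro x hx
  change x ∈ tm n a • Zp p at hx
  induction x using OnePoint.rec with
  | infty => exact absurd hx (infty_notMem_tm_smul_Zp _ _)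
  | coe x =>
    rw [coe_mem_tm_smul_Zp] at hx
    rw [coe_mem_Zp]
    have h1 : ‖x - a‖ ≤ 1 := hx.trans (zpow_le_one_of_nonpos₀ one_lt_p_real.le (by simp))
    have : x = (x - a) - (-a) := by ring
    rw [this]
    exact (norm_sub_le_max' _ _).trans (max_le h1 (by rwa [norm_neg]))

open Classical in
-- The set `U` is the disjoint union of the balls `A (a + p^n ℤ_p)` over the residues `a` modulo
-- `p^n` with `A a ∈ U`.
theorem Meas0.eq_sum (m : Meas0 p) (A : GLp p) {U : Clopens (P1 p)} (hU : U ≤ A • Zp p) {n : ℕ}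
    (hn : IsPeriod A U n) : m U = ∑ a ∈ Finset.range (p ^ n),
      if mobius A ((a : ℚ_[p]) : P1 p) ∈ U then m ((A * tm n (a : ℚ_[p])) • Zp p) else 0 := by
  rw [← Finset.sum_filter, ← m.map_finset_sup]
  · congr 1
    ext x
    rw [Clopens.coe_finset_sup]
    simp only [Set.mem_iUnion, Finset.mem_filter, SetLike.mem_coe, exists_prop]
    constructor
    · intro hx
      obtain ⟨_, ⟨y, hy, rfl⟩, rfl⟩ := (coe_smul_clopens A (Zp p)).subset (hU hx)
      have hy : ‖y‖ ≤ 1 := hy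
      obtain ⟨a, ha, h⟩ := exists_natCast_near n hy
      refine ⟨a, ⟨ha, ?_⟩, ?_⟩
      · exact (hn y a hy (norm_natCast_le_one a) h).mp hx
      · exact (mobius_mem_mul_tm _ _ _ _).mpr h
    · rintro ⟨a, ⟨-, ha⟩, hx⟩
      have h1 : x ∈ A • Zp p := by
        rw [mul_smul_clopens] at hx
        exact smul_clopens_mono A (tm_smul_Zp_le n (norm_natCast_le_one a)) hx
      obtain ⟨_, ⟨y, hy, rfl⟩, rfl⟩ := (coe_smul_clopens A (Zp p)).subset h1
      have hy : ‖y‖ ≤ 1 := hy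
      exact (hn y a hy (norm_natCast_le_one a) ((mobius_mem_mul_tm _ _ _ _).mp hx)).mpr ha
  · intro a ha b hb hab
    rw [Finset.coe_filter] at ha hb
    rw [Function.onFun, ← Clopens.coe_disjoint, Set.disjoint_left]
    intro x hx hx'
    have h1 : x ∈ A • Zp p := by
      change x ∈ _ • Zp p at hx
      rw [mul_smul_clopens] at hx
      exact smul_clopens_mono A (tm_smul_Zp_le n (norm_natCast_le_one a)) hx
    obtain ⟨_, ⟨y, hy, rfl⟩, rfl⟩ := (coe_smul_clopens A (Zp p)).subset h1
    exact hab (natCast_near_inj (Finset.mem_range.mp ha.1) (Finset.mem_range.mp hb.1)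
      (near_trans ((mobius_mem_mul_tm _ _ _ _).mp hx) ((mobius_mem_mul_tm _ _ _ _).mp hx')))

/-- Only arbitrarily large levels are required, because values of `μ_g` are prescribed at one parity
only. -/
theorem Meas0.eq_of_le (m m' : Meas0 p) (A : GLp p)
    (h : ∀ N : ℕ, ∃ n ≥ N, ∀ a : ℚ_[p], ‖a‖ ≤ 1 →
      m ((A * tm n a) • Zp p) = m' ((A * tm n a) • Zp p))
    {U : Clopens (P1 p)} (hU : U ≤ A • Zp p) : m U = m' U := by
  obtain ⟨N, hN⟩ := exists_isPeriod A U
  obtain ⟨n, hn, H⟩ := h N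
  rw [m.eq_sum A hU (hN.mono hn), m'.eq_sum A hU (hN.mono hn)]
  refine Finset.sum_congr rfl fun a _ => ?_
  rw [H a (norm_natCast_le_one a)]

/-- Values on the balls `A ℤ_p` of a harmonic function on the directed edges `A e_*`. -/
structure IsHarmonic (c : GLp p → ℤ) : Prop where
  congr : ∀ A i : GLp p, i • eStar p = eStar p → c (A * i) = c A
  flip : ∀ A, c (A * wm p) = -c A
  sum : ∀ A, ∑ b ∈ Finset.range p, c (A * tm 1 (b : ℚ_[p])) = c A

open Classical in
/-- The mass of `U ∩ A ℤ_p`, computed with the balls of radius `p ^ (-n)` in `ℤ_p`. -/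
def levelSum (c : GLp p → ℤ) (A : GLp p) (U : Clopens (P1 p)) (n : ℕ) : ℤ :=
  ∑ a ∈ Finset.range (p ^ n),
    if mobius A ((a : ℚ_[p]) : P1 p) ∈ U then c (A * tm n (a : ℚ_[p])) else 0

theorem sum_range_mul' (f : ℕ → ℤ) (m k : ℕ) : ∑ a ∈ Finset.range (m * k), f a =
    ∑ a ∈ Finset.range m, ∑ b ∈ Finset.range k, f (a + m * b) := by
  rw [Finset.sum_comm]
  induction k with
  | zero => simp
  | succ k ih =>
    rw [Nat.mul_succ, Finset.sum_range_add, ih, Finset.sum_range_succ]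
    congr 1
    exact Finset.sum_congr rfl fun a _ => by rw [add_comm]

variable {c : GLp p → ℤ}

/-- The ball of `a` modulo `p^n` splits into those of `a + p^n b` with `b < p`, and harmonicity is
additivity over this splitting. -/
theorem levelSum_succ (hc : IsHarmonic c) {A : GLp p} {U : Clopens (P1 p)} {n : ℕ}
    (hn : IsPeriod A U n) : levelSum c A U (n + 1) = levelSum c A U n := by
  rw [levelSum, levelSum, pow_succ, sum_range_mul']
  refine Finset.sum_congr rfl fun a _ => ?_
  have h1 : ∀ b : ℕ, (mobius A (((a + p ^ n * b : ℕ) : ℚ_[p]) : P1 p) ∈ U ↔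
      mobius A ((a : ℚ_[p]) : P1 p) ∈ U) := by
    intro b
    refine hn _ _ (norm_natCast_le_one _) (norm_natCast_le_one _) ?_
    push_cast
    rw [add_sub_cancel_left, norm_mul, Padic.norm_p_pow]
    exact mul_le_of_le_one_right (by positivity) (norm_natCast_le_one _)
  by_cases h : mobius A ((a : ℚ_[p]) : P1 p) ∈ U
  · rw [if_pos h, ← hc.sum]
    refine Finset.sum_congr rfl fun b _ => ?_
    rw [if_pos ((h1 b).mpr h), mul_assoc, tm_mul_tm]
    push_cast
    rw [zpow_natCast]
  · rw [if_neg h]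
    exact Finset.sum_eq_zero fun b _ => if_neg fun hb => h ((h1 b).mp hb)

theorem levelSum_eq (hc : IsHarmonic c) {A : GLp p} {U : Clopens (P1 p)} {m n : ℕ}
    (hm : IsPeriod A U m) (hn : IsPeriod A U n) : levelSum c A U m = levelSum c A U n := by
  wlog h : m ≤ n generalizing m n
  · exact (this hn hm (by omega)).symm
  induction n, h using Nat.le_induction with
  | base => rfl
  | succ n hmn ih => rw [ih (hm.mono hmn), levelSum_succ hc (hm.mono hmn)]

/-- The mass of `U ∩ A ℤ_p`. -/
def partMass (c : GLp p → ℤ) (A : GLp p) (U : Clopens (P1 p)) : ℤ :=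
  levelSum c A U (exists_isPeriod A U).choose

theorem partMass_eq (hc : IsHarmonic c) {A : GLp p} {U : Clopens (P1 p)} {n : ℕ}
    (hn : IsPeriod A U n) : partMass c A U = levelSum c A U n :=
  levelSum_eq hc (exists_isPeriod A U).choose_spec hn

theorem partMass_sup (hc : IsHarmonic c) (A : GLp p) {U V : Clopens (P1 p)} (h : Disjoint U V) :
    partMass c A (U ⊔ V) = partMass c A U + partMass c A V := by
  obtain ⟨n₁, h₁⟩ := exists_isPeriod A U
  obtain ⟨n₂, h₂⟩ := exists_isPeriod A V
  have h₁' := h₁.mono (le_max_left n₁ n₂)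
  have h₂' := h₂.mono (le_max_right n₁ n₂)
  have h₃ : IsPeriod A (U ⊔ V) (max n₁ n₂) := fun x y hx hy hxy =>
    or_congr (h₁' x y hx hy hxy) (h₂' x y hx hy hxy)
  rw [partMass_eq hc h₁', partMass_eq hc h₂', partMass_eq hc h₃, levelSum, levelSum, levelSum,
    ← Finset.sum_add_distrib]
  refine Finset.sum_congr rfl fun a _ => ?_
  rw [← Clopens.coe_disjoint, Set.disjoint_left] at h
  have hsup : mobius A ((a : ℚ_[p]) : P1 p) ∈ U ⊔ V ↔
    mobius A ((a : ℚ_[p]) : P1 p) ∈ U ∨ mobius A ((a : ℚ_[p]) : P1 p) ∈ V := Iff.rfl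
  have h' := @h (mobius A ((a : ℚ_[p]) : P1 p))
  simp only [SetLike.mem_coe] at h'
  by_cases hu : mobius A ((a : ℚ_[p]) : P1 p) ∈ U <;>
    by_cases hv : mobius A ((a : ℚ_[p]) : P1 p) ∈ V <;> simp_all

theorem isPeriod_of_forall {A : GLp p} {U : Clopens (P1 p)} {q : Prop}
    (h : ∀ x : ℚ_[p], ‖x‖ ≤ 1 → (mobius A x ∈ U ↔ q)) (n : ℕ) : IsPeriod A U n :=
  fun x y hx hy _ => (h x hx).trans (h y hy).symm

theorem partMass_of_le (hc : IsHarmonic c) {A : GLp p} {U : Clopens (P1 p)} (h : A • Zp p ≤ U) :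
    partMass c A U = c A := by
  have h1 : ∀ x : ℚ_[p], ‖x‖ ≤ 1 → (mobius A x ∈ U ↔ True) := fun x hx =>
    iff_true_intro (h ((mobius_mem_smul _ _ _).mpr ((coe_mem_Zp x).mpr hx)))
  rw [partMass_eq hc (isPeriod_of_forall h1 0), levelSum, pow_zero, Finset.sum_range_one,
    if_pos ((h1 _ (norm_natCast_le_one 0)).mpr trivial)]
  simp [tm_zero_zero]

theorem partMass_of_disjoint (hc : IsHarmonic c) {A : GLp p} {U : Clopens (P1 p)}
    (h : U ≤ (A • Zp p)ᶜ) : partMass c A U = 0 := by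
  have h1 : ∀ x : ℚ_[p], ‖x‖ ≤ 1 → (mobius A x ∈ U ↔ False) := fun x hx =>
    iff_false_intro fun hU => h hU ((mobius_mem_smul _ _ _).mpr ((coe_mem_Zp x).mpr hx))
  rw [partMass_eq hc (isPeriod_of_forall h1 0), levelSum, pow_zero, Finset.sum_range_one,
    if_neg (h1 _ (norm_natCast_le_one 0)).mp]

theorem partMass_ball (hc : IsHarmonic c) (A : GLp p) (n : ℕ) {a : ℚ_[p]} (ha : ‖a‖ ≤ 1) :
    partMass c A ((A * tm n a) • Zp p) = c (A * tm n a) := by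
  have h1 : IsPeriod A ((A * tm n a) • Zp p) n := by
    intro x y hx hy hxy
    rw [mobius_mem_mul_tm, mobius_mem_mul_tm]
    constructor
    · intro h
      exact near_trans hxy h
    · intro h
      rw [norm_sub_rev] at hxy
      exact near_trans hxy h
  obtain ⟨b, hb, hab⟩ := exists_natCast_near n ha
  -- At level `n` the ball contains exactly one representative, the residue `b` of its centre.
  rw [partMass_eq hc h1, levelSum, Finset.sum_eq_single b]
  · rw [norm_sub_rev] at hab
    rw [if_pos ((mobius_mem_mul_tm _ _ _ _).mpr hab)]
    obtain ⟨i, hi, e⟩ := tm_smul_eq hab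
    rw [e, ← mul_assoc, hc.congr _ _ hi]
  · intro b' hb' hne
    rw [if_neg]
    intro hm
    have h2 := (mobius_mem_mul_tm _ _ _ _).mp hm
    rw [norm_sub_rev] at h2
    exact hne (natCast_near_inj (Finset.mem_range.mp hb') (Finset.mem_range.mp hb)
      (near_trans h2 hab))
  · intro h; exact absurd hb h

/-- The measure attached to a harmonic function. -/
def IsHarmonic.meas (hc : IsHarmonic c) : Meas0 p where
  toFun U := partMass c 1 U + partMass c (wm p) U
  map_sup' U V h := by
    rw [partMass_sup hc _ h, partMass_sup hc _ h]
    ring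
  map_top' := by
    have := hc.flip 1
    rw [one_mul] at this
    rw [partMass_of_le hc le_top, partMass_of_le hc le_top, this, add_neg_cancel]

theorem IsHarmonic.meas_apply (hc : IsHarmonic c) (U : Clopens (P1 p)) :
    hc.meas U = partMass c 1 U + partMass c (wm p) U := rfl

theorem IsHarmonic.meas_ball_one (hc : IsHarmonic c) (n : ℕ) {a : ℚ_[p]} (ha : ‖a‖ ≤ 1) :
    hc.meas (tm n a • Zp p) = c (tm n a) := by
  have h1 := partMass_ball hc 1 n ha
  rw [one_mul] at h1
  rw [hc.meas_apply, h1, partMass_of_disjoint hc, add_zero]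
  rw [wm_smul_Zp, compl_compl]
  exact tm_smul_Zp_le n ha

theorem IsHarmonic.meas_ball_wm (hc : IsHarmonic c) (n : ℕ) {a : ℚ_[p]} (ha : ‖a‖ ≤ 1) :
    hc.meas ((wm p * tm n a) • Zp p) = c (wm p * tm n a) := by
  have h1 := partMass_ball hc (wm p) n ha
  rw [hc.meas_apply, h1, partMass_of_disjoint hc, zero_add]
  rw [mul_smul_clopens, one_smul_clopens, ← wm_smul_Zp]
  exact smul_clopens_mono _ (tm_smul_Zp_le n ha)

theorem IsHarmonic.meas_mul (hc : IsHarmonic c) {A i : GLp p} (hi : i • eStar p = eStar p) :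
    hc.meas ((A * i) • Zp p) = c (A * i) ↔ hc.meas (A • Zp p) = c A := by
  rw [mul_smul_clopens, smul_Zp_eq hi, hc.congr _ _ hi]

theorem IsHarmonic.meas_mul_wm (hc : IsHarmonic c) {A : GLp p} :
    hc.meas ((A * wm p) • Zp p) = c (A * wm p) ↔ hc.meas (A • Zp p) = c A := by
  rw [mul_smul_clopens, wm_smul_Zp, smul_clopens_compl, Meas0.map_compl, hc.flip, neg_inj]

/-- If `‖a‖ > 1` the ball lies in the complement `wm ℤ_p`, and `wm⁻¹` carries it to a ball inside
`ℤ_p` with centre `p⁻¹ / a` and level `n - 1 - 2 v(a) ≥ 0`, where `meas_ball_wm` applies. -/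
theorem IsHarmonic.meas_tm_nonneg (hc : IsHarmonic c) (n : ℕ) (a : ℚ_[p]) :
    hc.meas (tm n a • Zp p) = c (tm n a) := by
  have hp := one_lt_p_real (p := p)
  by_cases ha : ‖a‖ ≤ 1
  · exact hc.meas_ball_one n ha
  rw [not_le] at ha
  have ha0 : a ≠ 0 := by rintro rfl; simp at ha; linarith
  set B := (wm p)⁻¹ * tm n a with hB
  have e10 : B 1 0 = (p : ℚ_[p]) ^ n := by
    rw [hB, wm_inv, mul_assoc, sc_mul_apply, mul_apply_two]
    simp [coe_wm, coe_tm, pu, inv_mul_cancel_left₀ (p_ne_zero p)]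
  have e11 : B 1 1 = a := by
    rw [hB, wm_inv, mul_assoc, sc_mul_apply, mul_apply_two]
    simp [coe_wm, coe_tm, pu, inv_mul_cancel_left₀ (p_ne_zero p)]
  have e01 : B 0 1 = (p : ℚ_[p])⁻¹ := by
    rw [hB, wm_inv, mul_assoc, sc_mul_apply, mul_apply_two]
    simp [coe_wm, coe_tm, pu]
  obtain ⟨i, hi, e⟩ := eq_tm_mul (A := B) (by
    rw [e10, e11, Padic.norm_p_pow]
    exact lt_of_le_of_lt (zpow_le_one_of_nonpos₀ hp.le (by simp)) ha)
  have hv : vdet B = n - 1 := by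
    rw [hB, vdet_mul, vdet_inv, vdet_wm, vdet_tm]; ring
  have hval : a.valuation ≤ -1 := by
    by_contra! h
    exact ha.not_ge ((Padic.norm_le_one_iff_val_nonneg a).mpr (by omega))
  rw [e01, e11, hv] at e
  obtain ⟨m, hm⟩ : ∃ m : ℕ, (n : ℤ) - 1 - 2 * a.valuation = m := ⟨_, (Int.toNat_of_nonneg (by omega)).symm⟩
  rw [hm] at e
  have e' : tm n a = wm p * tm m ((p : ℚ_[p])⁻¹ / a) * i := by
    rw [mul_assoc, ← e, hB, mul_inv_cancel_left]
  rw [e', hc.meas_mul hi]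
  refine hc.meas_ball_wm m ?_
  rw [norm_div, norm_inv, Padic.norm_p, inv_inv, div_le_one (by linarith)]
  have := (norm_lt_iff_mul_le (x := 1) ha0).mp (by simpa using ha)
  simpa using this

theorem sup_balls (A : GLp p) (m : Meas0 p) :
    m (A • Zp p) = ∑ b ∈ Finset.range p, m ((A * tm 1 (b : ℚ_[p])) • Zp p) := by
  classical
  have h1 : ∀ x : ℚ_[p], ‖x‖ ≤ 1 → (mobius A x ∈ A • Zp p ↔ True) := fun x hx =>
    iff_true_intro ((mobius_mem_smul _ _ _).mpr ((coe_mem_Zp x).mpr hx))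
  rw [m.eq_sum A le_rfl (isPeriod_of_forall h1 1), pow_one]
  refine Finset.sum_congr rfl fun b _ => ?_
  rw [if_pos ((h1 _ (norm_natCast_le_one b)).mpr trivial), Nat.cast_one]

/-- A ball of negative level is the union of `p` balls one level higher, and both sides are
additive. -/
theorem IsHarmonic.meas_tm (hc : IsHarmonic c) (n : ℤ) (a : ℚ_[p]) :
    hc.meas (tm n a • Zp p) = c (tm n a) := by
  suffices ∀ (k : ℕ) (n : ℤ), 0 ≤ n + k → ∀ a : ℚ_[p], hc.meas (tm n a • Zp p) = c (tm n a) from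
    this n.natAbs n (by omega) a
  intro k
  induction k with
  | zero =>
    intro n hn a
    lift n to ℕ using by simpa using hn
    exact hc.meas_tm_nonneg n a
  | succ k ih =>
    intro n hn a
    rw [sup_balls, ← hc.sum]
    refine Finset.sum_congr rfl fun b _ => ?_
    rw [tm_mul_tm]
    exact ih _ (by push_cast at hn; omega) _

theorem IsHarmonic.meas_smul_Zp (hc : IsHarmonic c) (A : GLp p) : hc.meas (A • Zp p) = c A := by
  obtain ⟨n, a, i, hi, h | h⟩ := eq_tm_mul_or A
  · rw [h, hc.meas_mul hi, hc.meas_tm]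
  · rw [← hc.meas_mul_wm, h, hc.meas_mul hi, hc.meas_tm]

end Measures

/-! ### The quaternionic groups as stabilizers in the tree. -/

section Arithmetic

open Module

variable {p D M : ℕ} [Fact p.Prime] (S : Setup p D M)

theorem linearIndependent_one_tmul {K L V ι : Type*} [Field K] [Field L] [Algebra K L]
    [AddCommGroup V] [Module K V] {v : ι → V} (hv : LinearIndependent K v) :
    LinearIndependent L (fun i => (1 : L) ⊗ₜ[K] v i) := by
  have h1 : LinearIndepOn K id (Set.range v) := hv.linearIndepOn_id
  have hsub : ∀ i, v i ∈ h1.extend (Set.subset_univ _) := fun i =>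
    h1.subset_extend _ ⟨i, rfl⟩
  have h := (Algebra.TensorProduct.basis L (Basis.extend h1)).linearIndependent.comp
    (fun i => ⟨v i, hsub i⟩) fun i j hij => hv.injective (congrArg Subtype.val hij)
  convert h using 2 with i
  simp

namespace Setup

theorem loc_apply (x : S.B) : S.loc x = S.ι p (dvd_mul_right p M) (1 ⊗ₜ[ℚ] x) := rfl

theorem loc_injective : Function.Injective S.loc := by
  intro x y h
  rw [loc_apply, loc_apply] at h
  exact Algebra.TensorProduct.includeRight_injective (RingHom.injective _)
    ((S.ι p (dvd_mul_right p M)).injective h)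

theorem loc_algebraMap (q : ℚ) : S.loc (algebraMap ℚ S.B q) = (q : ℚ_[p]) • 1 := by
  have h : S.loc.comp (algebraMap ℚ S.B) = (algebraMap ℚ_[p] _).comp (algebraMap ℚ ℚ_[p]) :=
    Subsingleton.elim _ _
  have h1 := RingHom.congr_fun h q
  rw [RingHom.comp_apply, RingHom.comp_apply, Algebra.algebraMap_eq_smul_one (A := Matrix _ _ _)] at h1
  exact h1

theorem eq_algebraMap_of_commute {x : S.B} (h : ∀ y, x * y = y * x) :
    x = algebraMap ℚ S.B x.re := by
  have h1 := h ⟨0, 1, 0, 0⟩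
  have h2 := h ⟨0, 0, 1, 0⟩
  have ha := S.a_ne_zero
  have hb := S.b_ne_zero
  rw [QuaternionAlgebra.ext_iff] at h1 h2
  simp at h1 h2
  have hK : S.b * x.imK = 0 := by linarith
  ext
  · simp
  · simp; linarith
  · simp; linarith
  · simpa [hb] using hK

/-- With `X = loc x`, conjugation gives `X (t - X) = n`, where `t` and `n` are the reduced trace and
norm. Once the trace of `X` is known to be `t`, comparing entries gives `det X = n`. -/
theorem det_loc (x : S.B) : (S.loc x).det = (nrd x : ℚ) := by
  have h1 : S.loc x * S.loc (star x) = ((nrd x : ℚ) : ℚ_[p]) • 1 := by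
    rw [← map_mul, ← S.loc_algebraMap]
    exact congrArg _ (QuaternionAlgebra.mul_star_eq_coe x)
  have h2 : S.loc x + S.loc (star x) = ((2 * x.re : ℚ) : ℚ_[p]) • 1 := by
    rw [← map_add, ← S.loc_algebraMap]
    refine congrArg _ ?_
    rw [QuaternionAlgebra.self_add_star']
    simp
  have h3 : S.loc (star x) = ((2 * x.re : ℚ) : ℚ_[p]) • 1 - S.loc x := eq_sub_of_add_eq' h2
  rw [h3] at h1
  generalize ht : ((2 * x.re : ℚ) : ℚ_[p]) = t at h1
  generalize ((nrd x : ℚ) : ℚ_[p]) = n at *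
  -- If the trace were not `t`, the quadratic relation would force `X` to be scalar. Then `x` would
  -- be central, hence rational, and its trace would be `t` after all.
  have key : S.loc x 0 0 + S.loc x 1 1 = t := by
    by_contra hne
    have e00 := congrFun (congrFun h1 0) 0
    have e01 := congrFun (congrFun h1 0) 1
    have e10 := congrFun (congrFun h1 1) 0
    have e11 := congrFun (congrFun h1 1) 1
    simp [Matrix.mul_apply, Fin.sum_univ_two] at e00 e01 e10 e11
    have hne' : t - S.loc x 0 0 - S.loc x 1 1 ≠ 0 := fun h => hne (by linear_combination -h)
    have b0 : S.loc x 0 1 = 0 := by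
      refine (mul_eq_zero.mp ?_).resolve_right hne'
      linear_combination e01
    have c0 : S.loc x 1 0 = 0 := by
      refine (mul_eq_zero.mp ?_).resolve_right hne'
      linear_combination e10
    have ad : S.loc x 0 0 - S.loc x 1 1 = 0 := by
      refine (mul_eq_zero.mp ?_).resolve_right hne'
      linear_combination e00 - e11
    have hsc : S.loc x = S.loc x 0 0 • 1 := by
      ext i j
      fin_cases i <;> fin_cases j <;> simp [b0, c0]
      linear_combination -ad
    have hx : x = algebraMap ℚ S.B x.re := by
      refine S.eq_algebraMap_of_commute fun y => S.loc_injective ?_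
      rw [map_mul, map_mul, hsc, smul_mul_assoc, mul_smul_comm, one_mul, mul_one]
    have h4 : S.loc x 0 0 = (x.re : ℚ_[p]) := by
      have := congrArg S.loc hx
      rw [S.loc_algebraMap] at this
      rw [this]; simp
    apply hne
    rw [← ht, show S.loc x 1 1 = S.loc x 0 0 by linear_combination -ad, h4]
    push_cast
    ring
  rw [Matrix.det_fin_two]
  have := congrFun (congrFun h1 0) 0
  simp [Matrix.mul_apply, Fin.sum_univ_two] at this
  linear_combination this + S.loc x 0 0 * key

theorem mem_Gam0M {x : S.Bˣ} : x ∈ S.Gam0M ↔ (x : S.B) ∈ S.R0 ∧ ((x⁻¹ : S.Bˣ) : S.B) ∈ S.R0 ∧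
    nrd (x : S.B) = 1 := by
  rw [Gam0M, normOneUnits, Subgroup.mem_inf, Submonoid.mem_units_iff, MonoidHom.mem_ker, and_assoc,
    ← Units.val_inj]
  rfl

theorem mem_Gam0pM {x : S.Bˣ} : x ∈ S.Gam0pM ↔ (x : S.B) ∈ S.R0p ∧
    ((x⁻¹ : S.Bˣ) : S.B) ∈ S.R0p ∧ nrd (x : S.B) = 1 := by
  rw [Gam0pM, normOneUnits, Subgroup.mem_inf, Submonoid.mem_units_iff, MonoidHom.mem_ker, and_assoc,
    ← Units.val_inj]
  rfl

theorem mem_Gam {x : S.Bˣ} : x ∈ S.Gam ↔ (x : S.B) ∈ invertPrime p S.R0 ∧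
    ((x⁻¹ : S.Bˣ) : S.B) ∈ invertPrime p S.R0 ∧ nrd (x : S.B) = 1 := by
  rw [Gam, normOneUnits, Subgroup.mem_inf, Submonoid.mem_units_iff, MonoidHom.mem_ker, and_assoc,
    ← Units.val_inj]
  rfl

theorem locGL_apply (x : S.Bˣ) (i j : Fin 2) : S.locGL x i j = S.loc x i j := rfl

theorem ndet_locGL (x : S.Bˣ) : ndet (S.locGL x) = ‖((nrd (x : S.B) : ℚ) : ℚ_[p])‖ := by
  rw [ndet_eq, ← S.det_loc]; rfl

theorem ndet_locGL_eq_one {x : S.Bˣ} (hx : x ∈ S.Gam) : ndet (S.locGL x) = 1 := by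
  rw [ndet_locGL, ((S.mem_Gam).mp hx).2.2]; simp

theorem locGL_pUnit : S.locGL S.pUnit = sc (pu p) := by
  ext i j
  have : S.loc (S.pUnit : S.B) = ((p : ℚ) : ℚ_[p]) • 1 := S.loc_algebraMap p
  rw [locGL_apply, this]
  simp [sc_apply, pu, Matrix.one_apply]

theorem loc_mem_of_mem_R0 {x : S.B} (hx : x ∈ S.R0) (i j : Fin 2) : ‖S.loc x i j‖ ≤ 1 := by
  have h := (S.local_R0 p (dvd_mul_right p M)).subset
    (Submodule.subset_span (Set.mem_image_of_mem _ hx))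
  exact h.1 i j

/-- A subgroup of the finitely generated abelian group underlying a maximal order is finitely
generated. -/
theorem R0_fg : (AddSubgroup.toIntSubmodule S.R0.toAddSubgroup).FG := by
  obtain ⟨O₁, O₂, h₁, -, h, -⟩ := S.eichler_R0
  have hfg : (AddSubgroup.toIntSubmodule O₁.toAddSubgroup).FG := by
    rw [Submodule.fg_iff_addSubgroup_fg]
    exact h₁.1.1
  refine Submodule.FG.of_le hfg ?_
  intro x hx
  have hx : x ∈ S.R0 := hx
  rw [h] at hx
  exact hx.1

/-- Local-global principle at `p`. A `ℤ`-basis of `R₀(M)` stays independent over `ℚ_p` and generates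
`M₂(ℤ_p)` over `ℤ_p`. Hence the integer coordinates of `p^n x` are `p^n` times `p`-adic integers,
thus divisible by `p^n`. -/
theorem mem_R0_of_loc {x : S.B} (hx : x ∈ invertPrime p S.R0) (hl : ∀ i j, ‖S.loc x i j‖ ≤ 1) :
    x ∈ S.R0 := by
  obtain ⟨n, hn⟩ := hx
  set N := AddSubgroup.toIntSubmodule S.R0.toAddSubgroup with hN
  have hfin : Module.Finite ℤ N := Module.Finite.iff_fg.mpr S.R0_fg
  have : IsAddTorsionFree S.B := .of_module_rat _
  have hfree : Module.Free ℤ N := inferInstance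
  let b := Module.Free.chooseBasis ℤ N
  have hli : LinearIndependent ℤ (fun i => (b i : S.B)) :=
    b.linearIndependent.map' N.subtype (by simp)
  rw [LinearIndependent.iff_fractionRing ℤ ℚ] at hli
  have hli' : LinearIndependent ℚ_[p] (fun i => S.loc (b i)) := by
    have := (linearIndependent_one_tmul (L := ℚ_[p]) hli).map'
      (S.ι p (dvd_mul_right p M)).toLinearMap (LinearMap.ker_eq_bot.mpr
        (S.ι p (dvd_mul_right p M)).injective)
    exact this
  have hrepr : ∀ r (hr : r ∈ S.R0), r = ∑ i, b.repr ⟨r, hr⟩ i • (b i : S.B) := by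
    intro r hr
    have := congrArg N.subtype (b.sum_repr ⟨r, hr⟩)
    rw [map_sum] at this
    exact this.symm
  have hx1 : S.loc x ∈ Submodule.span ℤ_[p] (Set.range fun i => S.loc (b i)) := by
    have h1 : S.loc x ∈ Submodule.span ℤ_[p] ((fun x : S.B => S.loc x) '' S.R0) := by
      have h2 : S.loc x ∈ (eichlerLocal p (padicValNat p M) : Set _) := ⟨hl, by
        rw [padicValNat.eq_zero_of_not_dvd S.p_not_dvd_M]; simpa using hl 1 0⟩
      rwa [← S.local_R0 p (dvd_mul_right p M)] at h2
    refine Submodule.span_le.mpr ?_ h1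
    rintro _ ⟨r, hr, rfl⟩
    change S.loc r ∈ _
    rw [hrepr r hr, map_sum]
    refine Submodule.sum_mem _ fun i _ => ?_
    rw [map_zsmul]
    exact zsmul_mem (Submodule.subset_span (Set.mem_range_self i)) _
  obtain ⟨c, hc⟩ := (Submodule.mem_span_range_iff_exists_fun _).mp hx1
  set r := (p : S.B) ^ n * x with hr
  have hloc : S.loc r = (p : ℚ_[p]) ^ n • S.loc x := by
    rw [hr, map_mul, map_pow, map_natCast, ← Nat.cast_pow, ← nsmul_eq_mul, ← Nat.cast_pow,
      Nat.cast_smul_eq_nsmul]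
  have hcoef : ∀ i, ((b.repr ⟨r, hn⟩ i : ℤ) : ℚ_[p]) = (p : ℚ_[p]) ^ n * c i := by
    have h1 : ∑ i, (((b.repr ⟨r, hn⟩ i : ℤ) : ℚ_[p]) - (p : ℚ_[p]) ^ n * c i) • S.loc (b i) = 0 := by
      simp_rw [sub_smul, Finset.sum_sub_distrib, mul_smul, ← Finset.smul_sum]
      have e1 : ∑ i, (c i : ℚ_[p]) • S.loc (b i) = S.loc x := hc
      rw [e1, ← hloc]
      conv_rhs => rw [← sub_self (S.loc r)]
      congr 1
      conv_rhs => rw [hrepr r hn, map_sum]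
      refine Finset.sum_congr rfl fun i _ => ?_
      rw [map_zsmul, Int.cast_smul_eq_zsmul]
    intro i
    exact sub_eq_zero.mp (Fintype.linearIndependent_iff.mp hli' _ h1 i)
  have hdvd : ∀ i, ∃ k : ℤ, b.repr ⟨r, hn⟩ i = p ^ n * k := by
    intro i
    have h1 : ‖((b.repr ⟨r, hn⟩ i : ℤ) : ℚ_[p])‖ ≤ (p : ℝ) ^ (-n : ℤ) := by
      rw [hcoef, norm_mul, Padic.norm_p_pow]
      exact mul_le_of_le_one_right (by positivity) (PadicInt.norm_le_one (c i))
    exact_mod_cast (Padic.norm_int_le_pow_iff_dvd _ n).mp h1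
  choose k hk using hdvd
  have hrx : x = ∑ i, k i • (b i : S.B) := by
    have h1 : (p : S.B) ^ n * x = (p : S.B) ^ n * ∑ i, k i • (b i : S.B) := by
      rw [← hr]
      conv_lhs => rw [hrepr r hn]
      rw [Finset.mul_sum]
      refine Finset.sum_congr rfl fun i _ => ?_
      rw [hk, mul_smul, ← Nat.cast_pow, ← Nat.cast_pow, ← nsmul_eq_mul, natCast_zsmul]
    rw [← Nat.cast_pow, ← nsmul_eq_mul, ← nsmul_eq_mul] at h1
    exact nsmul_right_injective (pow_ne_zero n (Fact.out : p.Prime).ne_zero) h1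
  rw [hrx]
  exact S.R0.sum_mem fun i _ => zsmul_mem (b i).2 _

theorem Gam0M_le_Gam : S.Gam0M ≤ S.Gam := by
  have h : S.R0 ≤ invertPrime p S.R0 := fun x hx => ⟨0, by simpa using hx⟩
  exact inf_le_inf_right _ fun u hu => ⟨h hu.1, h hu.2⟩

theorem mem_R0_of_smul_vStar {x : S.Bˣ} (hx : x ∈ S.Gam) (h : S.locGL x • vStar p = vStar p) :
    (x : S.B) ∈ S.R0 := by
  refine S.mem_R0_of_loc (S.mem_Gam.mp hx).1 fun i j => ?_
  have := (smul_vStar_eq_iff _).mp h i j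
  rw [S.ndet_locGL_eq_one hx] at this
  exact (sq_le_one_iff₀ (norm_nonneg _)).mp this

/-- With the converse `smul_vStar_of_mem_Gam0M`, this makes `Γ₀ᴰ(M)` the stabilizer of `v_*` in `Γ`.
-/
theorem mem_Gam0M_of_smul_vStar {x : S.Bˣ} (hx : x ∈ S.Gam)
    (h : S.locGL x • vStar p = vStar p) : x ∈ S.Gam0M :=
  S.mem_Gam0M.mpr ⟨S.mem_R0_of_smul_vStar hx h,
    S.mem_R0_of_smul_vStar (inv_mem hx) (by rw [map_inv, inv_smul_eq_iff, h]),
    (S.mem_Gam.mp hx).2.2⟩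

theorem smul_vStar_of_mem_Gam0M {x : S.Bˣ} (hx : x ∈ S.Gam0M) :
    S.locGL x • vStar p = vStar p := by
  rw [smul_vStar_eq_iff, S.ndet_locGL_eq_one (S.Gam0M_le_Gam hx)]
  intro i j
  exact pow_le_one₀ (norm_nonneg _) (S.loc_mem_of_mem_R0 (S.mem_Gam0M.mp hx).1 i j)

theorem mem_R0p_of_smul_eStar {x : S.Bˣ} (hx : x ∈ S.Gam) (h : S.locGL x • eStar p = eStar p) :
    (x : S.B) ∈ S.R0p := by
  have h0 := S.mem_R0_of_smul_vStar hx (smul_vStar_of_smul_eStar h)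
  have hl := S.loc_mem_of_mem_R0 h0
  refine ⟨h0, hl, ?_⟩
  obtain ⟨h1, -, -⟩ := (smul_eStar_eq_iff _).mp h
  have h2 := h1.trans_le (hl 1 1)
  rw [← norm_one (α := ℚ_[p]), norm_lt_iff_mul_le one_ne_zero, norm_one] at h2
  have hp := one_lt_p_real (p := p)
  rw [Nat.cast_one, zpow_neg_one, ← one_div, le_div_iff₀ (by positivity)]
  exact h2

/-- `Γ₀ᴰ(pM)` is the stabilizer of `e_*` in `Γ`; the converse is `smul_eStar_of_mem_Gam0pM`.
Membership in this group is always checked on the tree. -/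
theorem mem_Gam0pM_of_smul_eStar {x : S.Bˣ} (hx : x ∈ S.Gam)
    (h : S.locGL x • eStar p = eStar p) : x ∈ S.Gam0pM :=
  S.mem_Gam0pM.mpr ⟨S.mem_R0p_of_smul_eStar hx h,
    S.mem_R0p_of_smul_eStar (inv_mem hx) (by rw [map_inv, inv_smul_eq_iff, h]),
    (S.mem_Gam.mp hx).2.2⟩

end Setup

theorem smul_eStar_of_mem_eichlerLocal {g : GLp p}
    (h : (g : Matrix (Fin 2) (Fin 2) ℚ_[p]) ∈ eichlerLocal p 1) (hd : ndet g = 1) :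
    g • eStar p = eStar p := by
  obtain ⟨h1, h2⟩ := h
  have hp := one_lt_p_real (p := p)
  have h10 : ‖g 1 0‖ < 1 := by
    refine lt_of_le_of_lt h2 ?_
    rw [Nat.cast_one, zpow_neg_one]
    exact inv_lt_one_of_one_lt₀ hp
  have hlt : ‖-(g 0 1 * g 1 0)‖ < ‖(g : Matrix (Fin 2) (Fin 2) ℚ_[p]).det‖ := by
    rw [← ndet_eq, hd, norm_neg, norm_mul]
    exact (mul_le_of_le_one_left (norm_nonneg _) (h1 _ _)).trans_lt h10
  have heq := norm_sub_eq_left hlt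
  rw [← ndet_eq, hd, det_eq, sub_neg_eq_add, sub_add_cancel, norm_mul] at heq
  have h00 := h1 0 0
  have h11 := h1 1 1
  have e00 : ‖g 0 0‖ = 1 := by nlinarith [norm_nonneg (g 0 0), norm_nonneg (g 1 1)]
  have e11 : ‖g 1 1‖ = 1 := by nlinarith [norm_nonneg (g 0 0), norm_nonneg (g 1 1)]
  rw [smul_eStar_eq_iff, e00, e11]
  exact ⟨h10, rfl, h1 0 1⟩

namespace Setup

theorem smul_eStar_of_mem_Gam0pM {x : S.Bˣ} (hx : x ∈ S.Gam0pM) :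
    S.locGL x • eStar p = eStar p :=
  smul_eStar_of_mem_eichlerLocal (S.mem_Gam0pM.mp hx).1.2
    (S.ndet_locGL_eq_one (S.Gam0pM_le_Gam hx))

theorem isEven_smul_iff {x : S.Bˣ} (hx : x ∈ S.Gam) (v : Vertex p) :
    (S.locGL x • v).IsEven ↔ v.IsEven := by
  obtain ⟨g, rfl⟩ := exists_smul_vStar v
  rw [← mul_smul, isEven_smul_vStar, isEven_smul_vStar, vdet_mul,
    (vdet_eq_zero_iff _).mpr (S.ndet_locGL_eq_one hx), zero_add]

theorem isEven_inv_smul_iff {x : S.Bˣ} (hx : x ∈ S.Gam) (v : Vertex p) :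
    ((S.locGL x)⁻¹ • v).IsEven ↔ v.IsEven := by
  rw [← map_inv]; exact S.isEven_smul_iff (inv_mem hx) v

theorem pUnit_comm (x : S.Bˣ) : S.pUnit * x = x * S.pUnit := by
  ext1
  exact Algebra.commutes (p : ℚ) (x : S.B)

theorem locGL_pUnit_smul (v : Vertex p) : S.locGL S.pUnit • v = v := by
  rw [locGL_pUnit, sc_smul_vertex]

end Setup

theorem Nbr.isEven_iff {v w : Vertex p} (h : Nbr v w) : w.IsEven ↔ ¬ v.IsEven := by
  obtain ⟨g, rfl⟩ := exists_smul_vStar v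
  obtain ⟨k, rfl⟩ := exists_smul_vStar w
  rw [isEven_smul_vStar, isEven_smul_vStar]
  exact h.parity

theorem isEven_vStar : (vStar p).IsEven := by
  have := isEven_smul_vStar (1 : GLp p)
  rw [one_smul, vdet_one] at this
  exact this.mpr Even.zero

theorem not_isEven_vHat : ¬ (vHat p).IsEven := fun h => (eStar p).nbr.isEven_iff.mp h isEven_vStar

theorem tm_smul_vStar_eq {n m : ℤ} {a b : ℚ_[p]} (h : tm n a • vStar p = tm m b • vStar p) :
    n = m ∧ ‖a - b‖ ≤ (p : ℝ) ^ (-n) := by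
  have hp := one_lt_p_real (p := p)
  rw [eq_comm, ← inv_smul_eq_iff, ← mul_smul, smul_vStar_eq_iff] at h
  have e : (tm n a)⁻¹ * tm m b = tm (m - n) (-((p : ℚ_[p]) ^ (-n) * (a - b))) := by
    rw [tm_inv, tm_mul_tm]
    congr 1
    · ring
    · ring
  rw [e, ndet_eq_zpow_vdet, vdet_tm] at h
  have h11 := h 1 1
  have h00 := h 0 0
  have h01 := h 0 1
  simp only [coe_tm, Matrix.of_apply, Matrix.cons_val', Matrix.cons_val_zero,
    Matrix.cons_val_one, Matrix.cons_val_fin_one, norm_one, one_pow, norm_neg, norm_mul,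
    Padic.norm_p_zpow, neg_neg] at h11 h00 h01
  rw [one_le_zpow_iff_right₀ hp] at h11
  rw [← zpow_natCast, ← zpow_mul, zpow_le_zpow_iff_right₀ hp] at h00
  have hnm : n = m := by push_cast at h00; omega
  refine ⟨hnm, ?_⟩
  subst hnm
  simp only [sub_self, neg_zero, zpow_zero] at h01
  have h2 := (sq_le_one_iff₀ (by positivity)).mp h01
  rw [zpow_neg, ← one_div, le_div_iff₀ (by positivity), mul_comm]
  exact h2

end Arithmetic

/-! ### The radial system and corestriction. -/

section Radial

variable {p D M : ℕ} [Fact p.Prime] {S : Setup p D M}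

/-- The conditions on a radial system only equate sets; this turns them into equalities of sums over
`p + 1` indices. -/
theorem sum_eq_sum_of_injective {α : Type*} {n : ℕ} {e f : Fin n → α} (hf : Function.Injective f)
    (h : ∀ j, ∃ i, e i = f j) (F : α → ℤ) : ∑ i, F (e i) = ∑ i, F (f i) := by
  choose σ hσ using h
  have hinj : Function.Injective σ := fun i j hij => hf (by rw [← hσ, ← hσ, hij])
  have hbij : Function.Bijective σ := Finite.injective_iff_bijective.mp hinj
  rw [← hbij.sum_comp]
  simp_rw [hσ]

namespace Choices

variable {C : Choices S} {γE : Edge p → S.Bˣ} {γV : Vertex p → S.Bˣ}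

theorem nrd_pUnit : nrd (S.pUnit : S.B) = (p : ℚ) * p := by
  change ((algebraMap ℚ S.B (p : ℚ)) * star (algebraMap ℚ S.B (p : ℚ))).re = _
  simp

variable (C) in
theorem det_loc_ω : (S.loc C.ω).det = p := by
  obtain ⟨u, hu, h⟩ := C.ω_local
  rw [h, Matrix.det_mul, hu.2]
  simp [Matrix.det_fin_two]

variable (C) in
theorem nrd_ω : nrd (C.ω : S.B) = p := by
  have h := C.det_loc_ω
  rw [S.det_loc] at h
  exact_mod_cast h

variable (C) in
-- The local form of `ω_p` differs from `wm` by a sign matrix, which fixes `e_*`. So `ω_p` reverses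
-- `e_*`.
theorem locGL_ω : ∃ i : GLp p, i • eStar p = eStar p ∧ S.locGL C.ω = i * wm p := by
  refine ⟨S.locGL C.ω * (wm p)⁻¹, ?_, by rw [inv_mul_cancel_right]⟩
  obtain ⟨u, ⟨hu, hdet⟩, h⟩ := C.ω_local
  have e : ((S.locGL C.ω * (wm p)⁻¹ : GLp p) : Matrix (Fin 2) (Fin 2) ℚ_[p])
      = u * !![-1, 0; 0, 1] := by
    have h1 : ((S.locGL C.ω : GLp p) : Matrix (Fin 2) (Fin 2) ℚ_[p]) =
        u * !![-1, 0; 0, 1] * (wm p : Matrix (Fin 2) (Fin 2) ℚ_[p]) := by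
      refine Eq.trans h ?_
      rw [mul_assoc, coe_wm]
      simp
    rw [Units.val_mul, h1, mul_assoc, ← Units.val_mul, mul_inv_cancel, Units.val_one, mul_one]
  apply smul_eStar_of_mem_eichlerLocal
  · rw [e]
    refine mul_mem hu ⟨?_, ?_⟩
    · simp [Fin.forall_fin_two]
    · simp
  · rw [ndet_eq, e, Matrix.det_mul, hdet]
    simp [Matrix.det_fin_two]

theorem wm_smul_vStar : wm p • vStar p = vHat p := vHat_eq_wm.symm

variable (C) in
theorem ω_smul_vStar : S.locGL C.ω • vStar p = vHat p := by
  obtain ⟨i, hi, h⟩ := C.locGL_ω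
  rw [h, mul_smul, wm_smul_vStar, smul_vHat_of_smul_eStar hi]

variable (C) in
theorem ω_smul_vHat : S.locGL C.ω • vHat p = vStar p := by
  obtain ⟨i, hi, h⟩ := C.locGL_ω
  rw [h, mul_smul, wm_smul_vHat, smul_vStar_of_smul_eStar hi]

theorem one_lt_succ_exists : ∃ i : Fin (p + 1), i ≠ 0 :=
  ⟨Fin.last p, by
    rw [Ne, Fin.ext_iff]
    exact (Fact.out : p.Prime).ne_zero⟩

theorem IsRadialSystem.edge_eq (hrad : C.IsRadialSystem γE γV) {e : Edge p} (he : e.IsEven) :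
    e = (S.locGL (γE e))⁻¹ • eStar p := by
  rw [eq_inv_smul_iff, (hrad.edge_rep e he).2]

theorem IsRadialSystem.edge_unique (hrad : C.IsRadialSystem γE γV) {e e' : Edge p}
    (he : e.IsEven) (he' : e'.IsEven) {k : S.Bˣ} (hk : k ∈ S.Gam0pM) (h : γE e = k * γE e') :
    e = e' := by
  rw [hrad.edge_eq he, hrad.edge_eq he', h, map_mul, mul_inv_rev, mul_smul]
  congr 1
  rw [inv_smul_eq_iff, S.smul_eStar_of_mem_Gam0pM hk]

/-- As `γ_{v̂_*} = 1`, each `γ̃ᵢ` is itself the representative `γ_e` of an edge with target `v̂_*`.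
-/
theorem IsRadialSystem.γt_mem (hrad : C.IsRadialSystem γE γV) (i : Fin (p + 1)) :
    C.γt i ∈ S.Gam := by
  have h := hrad.target (vHat p) not_isEven_vHat
  have h1 : C.γt i ∈ Set.range fun i => C.γt i * γV (vHat p) := ⟨i, by
    rw [hrad.base.2]; exact mul_one _⟩
  rw [← h] at h1
  obtain ⟨e, he, h2⟩ := h1
  have hev : e.IsEven := by
    have := e.nbr.isEven_iff
    rw [show e.t = vHat p from he] at this
    by_contra hne
    exact not_isEven_vHat (this.mpr hne)
  rw [← h2]
  exact (hrad.edge_rep e hev).1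

theorem pUnit_inv_mem : ((S.pUnit⁻¹ : S.Bˣ) : S.B) ∈ invertPrime p S.R0 := by
  refine ⟨1, ?_⟩
  have : (p : S.B) = (S.pUnit : S.B) := (map_natCast (algebraMap ℚ S.B) p).symm
  rw [pow_one, this, ← Units.val_mul, mul_inv_cancel]
  exact S.R0.one_mem

theorem mem_invertPrime_of_mem_R0 {x : S.B} (hx : x ∈ S.R0) : x ∈ invertPrime p S.R0 :=
  ⟨0, by simpa using hx⟩

variable (C) in
theorem ω_mem_invertPrime : (C.ω : S.B) ∈ invertPrime p S.R0 := mem_invertPrime_of_mem_R0 C.ω_mem.1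

/-- Solve `γ̃ᵢ = p⁻¹ ω_p γᵢ ω_p`, for some `i ≠ 0`, for `ω_p⁻¹`; the inverse of `γ̃ᵢ` is known to
lie in `R₀(M)[1/p]`. -/
theorem IsRadialSystem.ω_inv_mem (hrad : C.IsRadialSystem γE γV) :
    ((C.ω⁻¹ : S.Bˣ) : S.B) ∈ invertPrime p S.R0 := by
  obtain ⟨i, hi⟩ := one_lt_succ_exists (p := p)
  have h : C.ω⁻¹ = (C.γt i)⁻¹ * S.pUnit⁻¹ * C.ω * C.γ i := by
    rw [γt, if_neg hi]
    group
  rw [h]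
  simp only [Units.val_mul]
  exact mul_mem (mul_mem (mul_mem (S.mem_Gam.mp (hrad.γt_mem i)).2.1 pUnit_inv_mem) C.ω_mem_invertPrime)
    (mem_invertPrime_of_mem_R0 (S.mem_Gam0M.mp (C.γ_mem i)).1)

theorem nrd_inv (x : S.Bˣ) : nrd ((x⁻¹ : S.Bˣ) : S.B) = (nrd (x : S.B))⁻¹ := by
  rw [eq_comm, inv_eq_of_mul_eq_one_right]
  rw [← map_mul, ← Units.val_mul, mul_inv_cancel, Units.val_one, map_one]

theorem nrd_ne_zero (x : S.Bˣ) : nrd (x : S.B) ≠ 0 :=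
  (x.isUnit.map (nrd (a := S.a) (b := S.b))).ne_zero

theorem IsRadialSystem.conj_mem (hrad : C.IsRadialSystem γE γV) {x : S.Bˣ} (hx : x ∈ S.Gam) :
    C.ω * x * C.ω⁻¹ ∈ S.Gam := by
  obtain ⟨h1, h2, h3⟩ := S.mem_Gam.mp hx
  refine S.mem_Gam.mpr ⟨?_, ?_, ?_⟩
  · simp only [Units.val_mul]
    exact mul_mem (mul_mem C.ω_mem_invertPrime h1) hrad.ω_inv_mem
  · simp only [mul_inv_rev, inv_inv, Units.val_mul]
    exact mul_mem C.ω_mem_invertPrime (mul_mem h2 hrad.ω_inv_mem)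
  · simp only [Units.val_mul, map_mul, h3, nrd_inv, mul_one]
    exact mul_inv_cancel₀ (nrd_ne_zero _)

variable (C) in
/-- `z = p⁻¹ ω_p²`. -/
def z : S.Bˣ := S.pUnit⁻¹ * C.ω * C.ω

/-- Its norm is `p⁻² p² = 1`, and it fixes `e_*` because `ω_p` exchanges the two ends while scalars
act trivially. -/
theorem IsRadialSystem.z_mem (hrad : C.IsRadialSystem γE γV) : C.z ∈ S.Gam0pM := by
  have hΓ : C.z ∈ S.Gam := by
    refine S.mem_Gam.mpr ⟨?_, ?_, ?_⟩
    · simp only [z, Units.val_mul]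
      exact mul_mem (mul_mem pUnit_inv_mem C.ω_mem_invertPrime) C.ω_mem_invertPrime
    · have hp : (S.pUnit : S.B) ∈ invertPrime p S.R0 := by
        have : (p : S.B) = (S.pUnit : S.B) := (map_natCast (algebraMap ℚ S.B) p).symm
        rw [← this]
        exact natCast_mem _ _
      simp only [z, mul_inv_rev, inv_inv, Units.val_mul]
      exact mul_mem hrad.ω_inv_mem (mul_mem hrad.ω_inv_mem hp)
    · simp only [z, Units.val_mul, map_mul, nrd_inv, nrd_pUnit, C.nrd_ω]
      have : (p : ℚ) ≠ 0 := Nat.cast_ne_zero.mpr (Fact.out : p.Prime).ne_zero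
      field_simp
  refine S.mem_Gam0pM_of_smul_eStar hΓ ?_
  have hv : ∀ v : Vertex p, (S.locGL S.pUnit)⁻¹ • v = v := fun v => by
    rw [inv_smul_eq_iff, S.locGL_pUnit_smul]
  refine Edge.ext ?_ ?_
  · change S.locGL C.z • vStar p = vStar p
    rw [z, map_mul, map_mul, map_inv, mul_smul, mul_smul, C.ω_smul_vStar, C.ω_smul_vHat, hv]
  · change S.locGL C.z • vHat p = vHat p
    rw [z, map_mul, map_mul, map_inv, mul_smul, mul_smul, C.ω_smul_vHat, C.ω_smul_vStar, hv]

theorem IsRadialSystem.mem_GamHat (hrad : C.IsRadialSystem γE γV) {x : S.Bˣ} (hx : x ∈ S.Gam)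
    (h : S.locGL x • vHat p = vHat p) : x ∈ C.GamHat := by
  refine ⟨C.ω * x * C.ω⁻¹, ?_, ?_⟩
  · refine S.mem_Gam0M_of_smul_vStar (hrad.conj_mem hx) ?_
    have h1 : (S.locGL C.ω)⁻¹ • vStar p = vHat p := by
      rw [inv_smul_eq_iff, C.ω_smul_vHat]
    rw [map_mul, map_mul, map_inv, mul_smul, mul_smul, h1, h, C.ω_smul_vHat]
  · change C.ω⁻¹ * (C.ω * x * C.ω⁻¹) * (C.ω⁻¹)⁻¹ = x
    group

theorem h_eq {g : S.Gam} {e : Edge p} {k : S.Bˣ} (hk : k ∈ S.Gam0pM)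
    (h : γE e * (g : S.Bˣ) = k * γE ((S.locGL (g : S.Bˣ))⁻¹ • e)) : C.h γE g e = ⟨k, hk⟩ := by
  have h1 : γE e * (g : S.Bˣ) = (C.h γE g e : S.Bˣ) * γE ((S.locGL (g : S.Bˣ))⁻¹ • e) :=
    Classical.epsilon_spec (p := fun h : S.Gam0pM =>
      γE e * (g : S.Bˣ) = (h : S.Bˣ) * γE ((S.locGL (g : S.Bˣ))⁻¹ • e)) ⟨⟨k, hk⟩, h⟩
  exact Subtype.ext (mul_right_cancel (h1.symm.trans h))

theorem isEven_inv_smul_edge {g : S.Gam} {e : Edge p} (he : e.IsEven) :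
    ((S.locGL (g : S.Bˣ))⁻¹ • e).IsEven := (S.isEven_inv_smul_iff g.2 e.s).mpr he

theorem IsRadialSystem.h_spec (hrad : C.IsRadialSystem γE γV) (g : S.Gam) {e : Edge p}
    (he : e.IsEven) :
    γE e * (g : S.Bˣ) = (C.h γE g e : S.Bˣ) * γE ((S.locGL (g : S.Bˣ))⁻¹ • e) := by
  have he' := isEven_inv_smul_edge (g := g) he
  have hk : γE e * (g : S.Bˣ) * (γE ((S.locGL (g : S.Bˣ))⁻¹ • e))⁻¹ ∈ S.Gam0pM := by
    refine S.mem_Gam0pM_of_smul_eStar (mul_mem (mul_mem (hrad.edge_rep e he).1 g.2)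
      (inv_mem (hrad.edge_rep _ he').1)) ?_
    rw [map_mul, map_mul, map_inv, mul_smul, mul_smul, ← hrad.edge_eq he', smul_inv_smul,
      (hrad.edge_rep e he).2]
  have h1 : γE e * (g : S.Bˣ) = (γE e * (g : S.Bˣ) * (γE ((S.locGL (g : S.Bˣ))⁻¹ • e))⁻¹) *
    γE ((S.locGL (g : S.Bˣ))⁻¹ • e) := by rw [inv_mul_cancel_right]
  rw [h_eq hk h1]
  exact h1

/-- The sum of `φ(h(g, e))` over the even edges `e` at a vertex is a value of a corestriction. -/
theorem IsRadialSystem.sum_eq_cores (hrad : C.IsRadialSystem γE γV) (r : Fin (p + 1) → S.Bˣ)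
    (E : Vertex p → Set (Edge p)) (φ : S.Gam0pM → ℤ) (g : S.Gam) (v : Vertex p)
    (hE : ∀ w, (w = v ∨ w = (S.locGL (g : S.Bˣ))⁻¹ • v) → (∀ e ∈ E w, e.IsEven) ∧
      γE '' E w = Set.range fun i => r i * γV w)
    (hg : ∀ e ∈ E v, (S.locGL (g : S.Bˣ))⁻¹ • e ∈ E ((S.locGL (g : S.Bˣ))⁻¹ • v))
    (f : Fin (p + 1) → Edge p) (hf : Function.Injective f) (hfE : ∀ i, f i ∈ E v) :
    ∑ i, φ (C.h γE g (f i)) =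
      cores r φ (γV v * (g : S.Bˣ) * (γV ((S.locGL (g : S.Bˣ))⁻¹ • v))⁻¹) := by
  set v' := (S.locGL (g : S.Bˣ))⁻¹ • v with hv'
  obtain ⟨hev, hr⟩ := hE v (Or.inl rfl)
  obtain ⟨hev', hr'⟩ := hE v' (Or.inr rfl)
  have hex : ∀ i, ∃ e ∈ E v, γE e = r i * γV v := fun i => by
    have : r i * γV v ∈ Set.range fun i => r i * γV v := ⟨i, rfl⟩
    rwa [← hr] at this
  choose e heE he using hex
  rw [← sum_eq_sum_of_injective (e := e) hf ?_ (fun e => φ (C.h γE g e)), cores]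
  · refine Finset.sum_congr rfl fun i _ => congrArg φ ?_
    -- The choice defining `shift` is meaningful only once a solution exists; `h(g, e)` provides
    -- one.
    have hshift : ∃ h : S.Gam0pM, ∃ j, r i * (γV v * (g : S.Bˣ) * (γV v')⁻¹) = (h : S.Bˣ) * r j := by
      have h1 : γE ((S.locGL (g : S.Bˣ))⁻¹ • e i) ∈ γE '' E v' := ⟨_, hg _ (heE i), rfl⟩
      rw [hr'] at h1
      obtain ⟨j, hj⟩ := h1
      refine ⟨C.h γE g (e i), j, ?_⟩
      have h2 := hrad.h_spec g (hev _ (heE i))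
      rw [← hj, he] at h2
      simp only [← mul_assoc] at h2 ⊢
      rw [h2, mul_inv_cancel_right]
    obtain ⟨j, hj⟩ := Classical.epsilon_spec hshift
    refine h_eq (Subtype.mem _) ?_
    have h1 : r j * γV v' ∈ γE '' E v' := by rw [hr']; exact ⟨j, rfl⟩
    obtain ⟨e', he'E, he'⟩ := h1
    have h2 : γE (e i) * (g : S.Bˣ) = (shift r i (γV v * (g : S.Bˣ) * (γV v')⁻¹) : S.Bˣ) * γE e' := by
      rw [he, he']
      change r i * (γV v * (g : S.Bˣ) * (γV v')⁻¹) =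
        (shift r i (γV v * (g : S.Bˣ) * (γV v')⁻¹) : S.Bˣ) * r j at hj
      rw [← mul_assoc, ← hj]
      group
    have h3 := hrad.h_spec g (hev _ (heE i))
    -- The representatives of these two edges differ by an element of `Γ₀ᴰ(pM)`, so the edges
    -- coincide. The shift then satisfies the defining equation of `h(g, e)`.
    have h4 : (S.locGL (g : S.Bˣ))⁻¹ • e i = e' := by
      refine hrad.edge_unique (isEven_inv_smul_edge (hev _ (heE i))) (hev' _ he'E)
        (k := (C.h γE g (e i) : S.Bˣ)⁻¹ * shift r i (γV v * (g : S.Bˣ) * (γV v')⁻¹))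
        (mul_mem (inv_mem (Subtype.mem _)) (Subtype.mem _)) ?_
      rw [mul_assoc, ← h2, h3, inv_mul_cancel_left]
    rw [h4]
    exact h2
  · intro j
    have h1 : γE (f j) ∈ γE '' E v := ⟨_, hfE j, rfl⟩
    rw [hr] at h1
    obtain ⟨i, hi⟩ := h1
    refine ⟨i, hrad.edge_unique (hev _ (heE i)) (hev _ (hfE j)) (one_mem _) ?_⟩
    rw [he, one_mul]
    exact hi

end Choices

end Radial

/-! ### Harmonicity from `p`-newness, and uniqueness. -/

section Cocycle

variable {p D M : ℕ} [Fact p.Prime] {S : Setup p D M}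

namespace Choices

variable {C : Choices S} {γE : Edge p → S.Bˣ} {γV : Vertex p → S.Bˣ} {φ : S.Gam0pM → ℤ}

/-- `γ_v g γ_{g⁻¹v}⁻¹` fixes `v_*`, hence lies in `Γ₀ᴰ(M)`. -/
theorem IsRadialSystem.sum_source (hrad : C.IsRadialSystem γE γV) (hnew : C.IsPNew φ) (g : S.Gam)
    {v : Vertex p} (hv : v.IsEven) (f : Fin (p + 1) → Edge p) (hf : Function.Injective f)
    (hfE : ∀ i, (f i).s = v) : ∑ i, φ (C.h γE g (f i)) = 0 := by
  have hv' := (S.isEven_inv_smul_iff g.2 v).mpr hv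
  rw [hrad.sum_eq_cores C.γ (fun w => {e | e.s = w}) φ g v ?_ ?_ f hf hfE]
  · apply hnew.1
    apply S.mem_Gam0M_of_smul_vStar
    · exact mul_mem (mul_mem (hrad.even_rep v hv).1 g.2) (inv_mem (hrad.even_rep _ hv').1)
    · rw [map_mul, map_mul, map_inv, mul_smul, mul_smul, ← (hrad.even_rep _ hv').2, inv_smul_smul,
        smul_inv_smul, (hrad.even_rep v hv).2, (hrad.even_rep _ hv').2]
  · rintro w (rfl | rfl)
    · exact ⟨fun e he => by rw [Edge.IsEven, show e.s = w from he]; exact hv, hrad.source _ hv⟩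
    · exact ⟨fun e he => by rw [Edge.IsEven, show e.s = _ from he]; exact hv', hrad.source _ hv'⟩
  · rintro e he
    exact congrArg _ he

/-- Here `γ_v g γ_{g⁻¹v}⁻¹` fixes `v̂_*`, hence lies in `Γ̂₀ᴰ(M)`. -/
theorem IsRadialSystem.sum_target (hrad : C.IsRadialSystem γE γV) (hnew : C.IsPNew φ) (g : S.Gam)
    {v : Vertex p} (hv : ¬ v.IsEven) (f : Fin (p + 1) → Edge p) (hf : Function.Injective f)
    (hfE : ∀ i, (f i).t = v) : ∑ i, φ (C.h γE g (f i)) = 0 := by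
  have hv' := mt (S.isEven_inv_smul_iff g.2 v).mp hv
  have hev : ∀ {w : Vertex p}, ¬ w.IsEven → ∀ e : Edge p, e.t = w → e.IsEven := by
    rintro _ hw e rfl
    by_contra h
    exact hw (e.nbr.isEven_iff.mpr h)
  rw [hrad.sum_eq_cores C.γt (fun w => {e | e.t = w}) φ g v ?_ ?_ f hf hfE]
  · apply hnew.2
    apply hrad.mem_GamHat
    · exact mul_mem (mul_mem (hrad.odd_rep v hv).1 g.2) (inv_mem (hrad.odd_rep _ hv').1)
    · rw [map_mul, map_mul, map_inv, mul_smul, mul_smul, ← (hrad.odd_rep _ hv').2, inv_smul_smul,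
        smul_inv_smul, (hrad.odd_rep v hv).2, (hrad.odd_rep _ hv').2]
  · rintro w (rfl | rfl)
    · exact ⟨hev hv, hrad.target _ hv⟩
    · exact ⟨hev hv', hrad.target _ hv'⟩
  · rintro e he
    exact congrArg _ he

open Classical in
/-- The harmonic function `A ↦ φ(h(g, A e_*))` on even edges, extended by antisymmetry. -/
def cocycle (C : Choices S) (γE : Edge p → S.Bˣ) (φ : S.Gam0pM → ℤ) (g : S.Gam) (A : GLp p) : ℤ :=
  if Even (vdet A) then φ (C.h γE g (A • eStar p)) else -φ (C.h γE g ((A * wm p) • eStar p))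

theorem vdet_even_of_smul_eStar {i : GLp p} (hi : i • eStar p = eStar p) : Even (vdet i) := by
  have h : i • vStar p = (1 : GLp p) • vStar p := by
    rw [one_smul]; exact smul_vStar_of_smul_eStar hi
  rw [vdet_parity_of_eq h, vdet_one]
  exact Even.zero

theorem mul_wm_smul_eStar {i : GLp p} (hi : i • eStar p = eStar p) (A : GLp p) :
    (A * i * wm p) • eStar p = (A * wm p) • eStar p := by
  rw [mul_smul, mul_smul, mul_smul]
  congr 1
  refine Edge.ext ?_ ?_
  · change i • wm p • vStar p = wm p • vStar p
    rw [wm_smul_vStar, smul_vHat_of_smul_eStar hi]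
  · change i • wm p • vHat p = wm p • vHat p
    rw [wm_smul_vHat, smul_vStar_of_smul_eStar hi]

theorem mul_wm_wm_smul_eStar (A : GLp p) : (A * wm p * wm p) • eStar p = A • eStar p := by
  rw [mul_smul, mul_smul]
  congr 1
  refine Edge.ext ?_ ?_
  · change wm p • wm p • vStar p = vStar p
    rw [wm_smul_vStar, wm_smul_vHat]
  · change wm p • wm p • vHat p = vHat p
    rw [wm_smul_vHat, wm_smul_vStar]

theorem tm_smul_vStar_natCast_inj {A : GLp p} {i j : Fin p}
    (h : (A * tm 1 ((i : ℕ) : ℚ_[p])) • vStar p = (A * tm 1 ((j : ℕ) : ℚ_[p])) • vStar p) :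
    i = j := by
  rw [mul_smul, mul_smul] at h
  have h1 := (tm_smul_vStar_eq (smul_left_cancel _ h)).2
  exact Fin.ext (natCast_near_inj (p := p) (n := 1) (by rw [pow_one]; exact i.2)
    (by rw [pow_one]; exact j.2) (by simpa using h1))

theorem smul_vHat_ne {A : GLp p} (a : ℚ_[p]) : A • vHat p ≠ (A * tm 1 a) • vStar p := by
  intro h
  rw [vHat_eq_tm, mul_smul] at h
  have h1 := (tm_smul_vStar_eq (smul_left_cancel _ h)).1
  omega

theorem tm_one_smul_vHat {A : GLp p} {a : ℚ_[p]} (ha : ‖a‖ ≤ 1) :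
    (A * tm 1 a) • vHat p = A • vStar p := by
  obtain ⟨i, hi, e⟩ := tm_smul_eq (n := 0) (a := a) (b := 0) (by simpa using ha)
  rw [mul_smul, tm_smul_vHat, sub_self, e, tm_zero_zero, one_mul, smul_vStar_of_smul_eStar hi]

/-- For `A` even, the edges with source `A v_*` are `A e_*` and the reversals of the `A tm 1 b e_*`,
so `sum_source` is the additivity relation. For `A` odd, the edges with target `A v_*` are the
reversal of `A e_*` and the `A tm 1 b e_*`, and `sum_target` applies. -/
theorem IsRadialSystem.isHarmonic (hrad : C.IsRadialSystem γE γV) (hnew : C.IsPNew φ)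
    (g : S.Gam) : IsHarmonic (C.cocycle γE φ g) where
  congr A i hi := by
    have h1 : Even (vdet (A * i)) ↔ Even (vdet A) := by
      rw [vdet_mul, Int.even_add]
      simp [vdet_even_of_smul_eStar hi]
    rw [cocycle, cocycle, mul_wm_smul_eStar hi, mul_smul, hi]
    simp only [h1]
  flip A := by
    have h1 : Even (vdet (A * wm p)) ↔ ¬ Even (vdet A) := by
      rw [vdet_mul, vdet_wm, Int.even_add_one]
    rw [cocycle, cocycle, mul_wm_wm_smul_eStar]
    by_cases h : Even (vdet A)
    · rw [if_pos h, if_neg (by rw [h1, not_not]; exact h)]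
    · rw [if_neg h, if_pos (h1.mpr h), neg_neg]
  sum A := by
    have h1 : ∀ a : ℚ_[p], Even (vdet (A * tm 1 a)) ↔ ¬ Even (vdet A) := by
      intro a
      rw [vdet_mul, vdet_tm, Int.even_add_one]
    rw [Finset.sum_range]
    by_cases h : Even (vdet A)
    · have h2 := hrad.sum_source hnew g (v := A • vStar p) ((isEven_smul_vStar A).mpr h)
        (Fin.cons (A • eStar p)
          fun b : Fin p => (A * tm 1 ((b : ℕ) : ℚ_[p]) * wm p) • eStar p) ?_ ?_
      · rw [Fin.sum_univ_succ] at h2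
        simp only [Fin.cons_zero, Fin.cons_succ] at h2
        rw [cocycle, if_pos h]
        simp only [cocycle, h1, not_true_eq_false, if_false, h]
        rw [Finset.sum_neg_distrib]
        omega
      · have ht : ∀ b : Fin p, ((A * tm 1 ((b : ℕ) : ℚ_[p]) * wm p) • eStar p).t =
            (A * tm 1 ((b : ℕ) : ℚ_[p])) • vStar p := fun b => by
          rw [mul_smul _ (wm p), ← wm_smul_vHat]; rfl
        rw [Fin.cons_injective_iff]
        constructor
        · rintro ⟨b, hb⟩
          have := congrArg Edge.t hb
          rw [ht] at this
          exact smul_vHat_ne _ this.symm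
        · intro i j hij
          have := congrArg Edge.t hij
          simp only [ht] at this
          exact tm_smul_vStar_natCast_inj this
      · intro i
        refine Fin.cases rfl (fun b => ?_) i
        rw [Fin.cons_succ]
        change (A * tm 1 ((b : ℕ) : ℚ_[p]) * wm p) • vStar p = _
        rw [mul_smul _ (wm p), wm_smul_vStar, tm_one_smul_vHat (norm_natCast_le_one _)]
    · have h2 := hrad.sum_target hnew g (v := A • vStar p) (mt (isEven_smul_vStar A).mp h)
        (Fin.cons ((A * wm p) • eStar p)
          fun b : Fin p => (A * tm 1 ((b : ℕ) : ℚ_[p])) • eStar p) ?_ ?_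
      · rw [Fin.sum_univ_succ] at h2
        simp only [Fin.cons_zero, Fin.cons_succ] at h2
        rw [cocycle, if_neg h]
        simp only [cocycle, h1, not_false_eq_true, if_true, h]
        omega
      · have hs : ((A * wm p) • eStar p).s = A • vHat p := by
          rw [mul_smul, ← wm_smul_vStar]; rfl
        rw [Fin.cons_injective_iff]
        constructor
        · rintro ⟨b, hb⟩
          have := congrArg Edge.s hb
          rw [hs] at this
          exact smul_vHat_ne _ this.symm
        · intro i j hij
          exact tm_smul_vStar_natCast_inj (congrArg Edge.s hij)
      · intro i
        refine Fin.cases ?_ (fun b => ?_) i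
        · rw [Fin.cons_zero]
          change (A * wm p) • vHat p = _
          rw [mul_smul, wm_smul_vHat]
        · rw [Fin.cons_succ]
          exact tm_one_smul_vHat (norm_natCast_le_one _)

theorem isEven_smul_eStar (A : GLp p) : (A • eStar p).IsEven ↔ Even (vdet A) :=
  isEven_smul_vStar A

theorem IsRadialSystem.isMeasureFamily (hrad : C.IsRadialSystem γE γV) (hnew : C.IsPNew φ) :
    C.IsMeasureFamily γE φ fun g => (hrad.isHarmonic hnew g).meas := by
  rintro g _ he A rfl
  rw [IsHarmonic.meas_smul_Zp, cocycle, if_pos ((isEven_smul_eStar A).mp he)]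

theorem IsMeasureFamily.apply {μ : S.Gam → Meas0 p} (hμ : C.IsMeasureFamily γE φ μ) (g : S.Gam)
    {A : GLp p} (hA : Even (vdet A)) : μ g (A • Zp p) = φ (C.h γE g (A • eStar p)) :=
  hμ g _ ((isEven_smul_eStar A).mpr hA) A rfl

/-- Levels `2N` inside `ℤ_p`, and `2N + 1` after `wm`, belong to even edges and are arbitrarily
fine. -/
theorem IsMeasureFamily.unique {μ μ' : S.Gam → Meas0 p} (hμ : C.IsMeasureFamily γE φ μ)
    (hμ' : C.IsMeasureFamily γE φ μ') : μ' = μ := by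
  funext g
  have hev : ∀ A : GLp p, Even (vdet A) → μ' g (A • Zp p) = μ g (A • Zp p) := fun A hA => by
    rw [hμ.apply g hA, hμ'.apply g hA]
  have h1 : ∀ {U : Clopens (P1 p)}, U ≤ (1 : GLp p) • Zp p → μ' g U = μ g U := by
    refine fun hU => Meas0.eq_of_le _ _ 1 (fun N => ⟨2 * N, by omega, fun a _ => hev _ ?_⟩) hU
    rw [one_mul, vdet_tm]
    exact ⟨N, by push_cast; ring⟩
  have h2 : ∀ {U : Clopens (P1 p)}, U ≤ wm p • Zp p → μ' g U = μ g U := by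
    refine fun hU => Meas0.eq_of_le _ _ _ (fun N => ⟨2 * N + 1, by omega, fun a _ => hev _ ?_⟩) hU
    rw [vdet_mul, vdet_wm, vdet_tm]
    exact ⟨N + 1, by push_cast; ring⟩
  rw [one_smul_clopens] at h1
  rw [wm_smul_Zp] at h2
  refine Meas0.ext (funext fun U => ?_)
  have hU : U = (U ⊓ Zp p) ⊔ (U ⊓ (Zp p)ᶜ) := by
    rw [← inf_sup_left, sup_compl_eq_top, inf_top_eq]
  have hd : Disjoint (U ⊓ Zp p) (U ⊓ (Zp p)ᶜ) :=
    disjoint_compl_right.mono inf_le_right inf_le_right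
  rw [hU, (μ' g).map_sup' _ _ hd, (μ g).map_sup' _ _ hd]
  exact congrArg₂ _ (h1 inf_le_right) (h2 inf_le_right)

end Choices

end Cocycle

/-! ### The action of `ω_p` on `φ` and of `s_k` on the tree. -/

section HeckeRelation

variable {p D M : ℕ} [Fact p.Prime] {S : Setup p D M}

namespace Choices

variable {C : Choices S} {γE : Edge p → S.Bˣ} {γV : Vertex p → S.Bˣ} {φ : S.Gam0pM → ℤ}

theorem Gam0pM_le_Gam0M : S.Gam0pM ≤ S.Gam0M := fun x hx => by
  obtain ⟨h1, h2, h3⟩ := S.mem_Gam0pM.mp hx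
  exact S.mem_Gam0M.mpr ⟨h1.1, h2.1, h3⟩

variable (C) in
theorem γ_unique {i j : Fin (p + 1)} {k : S.Bˣ} (hk : k ∈ S.Gam0pM) (h : C.γ i = k * C.γ j) :
    i = j := by
  refine (C.γ_reps _ (C.γ_mem i)).unique ?_ ?_
  · rw [mul_inv_cancel]; exact one_mem _
  · rw [h, mul_inv_cancel_right]; exact hk

variable (C) in
/-- `g ↦ ω_p g ω_p⁻¹` on `Γ₀ᴰ(pM)`. -/
def conjω (g : S.Gam0pM) : S.Gam0pM := ⟨C.ω * g * C.ω⁻¹, (C.ω_normalizes g).mp g.2⟩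

variable (C) in
theorem exists_conjω_eq (g : S.Gam0pM) : ∃ g', C.conjω g' = g :=
  ⟨⟨C.ω⁻¹ * g * C.ω, (C.ω_normalizes _).mpr (by
    rw [show C.ω * (C.ω⁻¹ * (g : S.Bˣ) * C.ω) * C.ω⁻¹ = g by group]; exact g.2)⟩,
    Subtype.ext (by change C.ω * (C.ω⁻¹ * (g : S.Bˣ) * C.ω) * C.ω⁻¹ = g; group)⟩

/-- It suffices that representatives of the same coset be equal; their indices need not agree. -/
theorem shift_eq {r : Fin (p + 1) → S.Bˣ}
    (hr : ∀ (j j' : Fin (p + 1)) (k : S.Bˣ), k ∈ S.Gam0pM → r j = k * r j' → r j = r j')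
    {i j : Fin (p + 1)} {x : S.Bˣ} {h : S.Gam0pM} (hh : r i * x = h * r j) :
    shift r i x = h := by
  obtain ⟨j', hj'⟩ : ∃ j', r i * x = (shift r i x : S.Bˣ) * r j' :=
    Classical.epsilon_spec (p := fun h : S.Gam0pM => ∃ j, r i * x = (h : S.Bˣ) * r j) ⟨h, j, hh⟩
  have h1 : r j = r j' := by
    refine hr j j' ((h : S.Bˣ)⁻¹ * shift r i x) (mul_mem (inv_mem h.2) (Subtype.mem _)) ?_
    rw [mul_assoc, ← hj', hh, inv_mul_cancel_left]
  rw [hh, h1] at hj'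
  exact Subtype.ext (mul_right_cancel hj').symm

variable (C) in
theorem s_mul_conjω {k j : Fin p} {g h : S.Gam0pM}
    (e : C.γ k.succ * (g : S.Bˣ) = h * C.γ j.succ) :
    (g : S.Bˣ)⁻¹ * C.s k = C.s j * (C.conjω h : S.Bˣ)⁻¹ := by
  have e2 : (g : S.Bˣ)⁻¹ * (C.γ k.succ)⁻¹ = (C.γ j.succ)⁻¹ * (h : S.Bˣ)⁻¹ := by
    rw [← mul_inv_rev, e, mul_inv_rev]
  change (g : S.Bˣ)⁻¹ * ((C.γ k.succ)⁻¹ * C.ω⁻¹) =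
    (C.γ j.succ)⁻¹ * C.ω⁻¹ * (C.ω * h * C.ω⁻¹)⁻¹
  rw [← mul_assoc, e2]
  group

variable (C) in
-- `t_k` is the conjugate by `ω_p` of the cocycle of right translation on cosets. The coset of `γ₀ =
-- 1` cannot be reached, since `γ_k x ∈ Γ₀ᴰ(pM)` would put `γ_k` in the coset of `1`.
theorem t_spec (k : Fin p) (x : S.Gam0pM) : ∃ (j : Fin p) (h : S.Gam0pM),
    C.γ k.succ * (x : S.Bˣ) = h * C.γ j.succ ∧ C.t k x = C.conjω h := by
  obtain ⟨j, hj, -⟩ := C.γ_reps (C.γ k.succ * x) (mul_mem (C.γ_mem _) (Gam0pM_le_Gam0M x.2))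
  have hj0 : j ≠ 0 := by
    rintro rfl
    have h1 : C.γ k.succ = (C.γ k.succ * x * (C.γ 0)⁻¹ * (x : S.Bˣ)⁻¹) * C.γ 0 := by
      rw [C.γ_zero]; group
    exact Fin.succ_ne_zero k (C.γ_unique (mul_mem hj (inv_mem x.2)) h1)
  obtain ⟨j, rfl⟩ := Fin.exists_succ_eq.mpr hj0
  obtain ⟨h, e1⟩ : ∃ h : S.Gam0pM, C.γ k.succ * (x : S.Bˣ) = h * C.γ j.succ :=
    ⟨⟨_, hj⟩, by rw [inv_mul_cancel_right]⟩
  refine ⟨j, h, e1, ?_⟩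
  have hj' := C.s_mul_conjω e1
  obtain ⟨j₂, hj₂⟩ : ∃ j', (x : S.Bˣ)⁻¹ * C.s k = C.s j' * (C.t k x : S.Bˣ)⁻¹ :=
    Classical.epsilon_spec (p := fun t : S.Gam0pM => ∃ j, (x : S.Bˣ)⁻¹ * C.s k =
      C.s j * (t : S.Bˣ)⁻¹) ⟨C.conjω h, j, hj'⟩
  have h3 := hj'.symm.trans hj₂
  obtain ⟨y, hy⟩ := C.exists_conjω_eq (C.t k x)
  rw [← hy] at h3 ⊢
  have h4 : C.γ j.succ = ((h : S.Bˣ)⁻¹ * y) * C.γ j₂.succ := by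
    change (C.γ j.succ)⁻¹ * C.ω⁻¹ * (C.ω * h * C.ω⁻¹)⁻¹ =
      (C.γ j₂.succ)⁻¹ * C.ω⁻¹ * (C.ω * y * C.ω⁻¹)⁻¹ at h3
    have h5 : ((C.γ j.succ)⁻¹ * (h : S.Bˣ)⁻¹)⁻¹ = ((C.γ j₂.succ)⁻¹ * (y : S.Bˣ)⁻¹)⁻¹ := by
      rw [inv_inj]
      calc _ = (C.γ j.succ)⁻¹ * C.ω⁻¹ * (C.ω * h * C.ω⁻¹)⁻¹ * C.ω := by group
        _ = _ := by rw [h3]; group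
    simp only [mul_inv_rev, inv_inv] at h5
    rw [mul_assoc, ← h5, inv_mul_cancel_left]
  have h6 := C.γ_unique (mul_mem (inv_mem h.2) y.2) h4
  rw [h6] at h4
  have h7 : (h : S.Bˣ)⁻¹ * y = 1 := (mul_eq_right.mp h4.symm)
  rw [Subtype.ext (inv_mul_eq_one.mp h7)]

theorem IsRadialSystem.exists_edge_γt (hrad : C.IsRadialSystem γE γV) {v : Vertex p}
    (hv : ¬ v.IsEven) (i : Fin (p + 1)) :
    ∃ e : Edge p, e.t = v ∧ e.IsEven ∧ γE e = C.γt i * γV v := by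
  have h1 : C.γt i * γV v ∈ γE '' {e | e.t = v} := by
    rw [hrad.target v hv]; exact ⟨i, rfl⟩
  obtain ⟨e, rfl, h2⟩ := h1
  exact ⟨e, rfl, by_contra fun h => hv (e.nbr.isEven_iff.mpr h), h2⟩

theorem IsRadialSystem.exists_edge_γ (hrad : C.IsRadialSystem γE γV) {v : Vertex p}
    (hv : v.IsEven) (i : Fin (p + 1)) :
    ∃ e : Edge p, e.s = v ∧ e.IsEven ∧ γE e = C.γ i * γV v := by
  have h1 : C.γ i * γV v ∈ γE '' {e | e.s = v} := by
    rw [hrad.source v hv]; exact ⟨i, rfl⟩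
  obtain ⟨e, rfl, h2⟩ := h1
  exact ⟨e, rfl, hv, h2⟩

theorem IsRadialSystem.γt_unique (hrad : C.IsRadialSystem γE γV) (j j' : Fin (p + 1))
    (k : S.Bˣ) (hk : k ∈ S.Gam0pM) (h : C.γt j = k * C.γt j') : C.γt j = C.γt j' := by
  obtain ⟨e, -, he, h1⟩ := hrad.exists_edge_γt not_isEven_vHat j
  obtain ⟨e', -, he', h2⟩ := hrad.exists_edge_γt not_isEven_vHat j'
  rw [hrad.base.2, mul_one] at h1 h2
  rw [← h1, ← h2] at h ⊢
  rw [hrad.edge_unique he he' hk h]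

theorem pUnit_inv_comm (x : S.Bˣ) : x * S.pUnit⁻¹ = S.pUnit⁻¹ * x := by
  rw [mul_inv_eq_iff_eq_mul, mul_assoc, ← S.pUnit_comm, inv_mul_cancel_left]

/-- In the vanishing corestriction to `Γ̂₀ᴰ(M)` at `g`, the representative `γ̃₀ = 1` contributes
`φ(g)` and the others contribute `φ(t_k(ω_p g ω_p⁻¹))`, whose sum is `U_p φ` at `ω_p g ω_p⁻¹`. -/
theorem IsRadialSystem.φ_eq (hrad : C.IsRadialSystem γE γV) (hnew : C.IsPNew φ) {ap : ℤ}
    (hU : ∀ g, C.Up φ g = ap * φ g) (g : S.Gam0pM) : φ g = -(ap * φ (C.conjω g)) := by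
  have hg : (g : S.Bˣ) ∈ C.GamHat := hrad.mem_GamHat (S.Gam0pM_le_Gam g.2)
    (smul_vHat_of_smul_eStar (S.smul_eStar_of_mem_Gam0pM g.2))
  have h1 := hnew.2 g hg
  rw [cores, Fin.sum_univ_succ] at h1
  have h0 : shift C.γt 0 (g : S.Bˣ) = g := by
    refine shift_eq hrad.γt_unique (j := 0) ?_
    simp [γt]
  have hs : ∀ k : Fin p, shift C.γt k.succ (g : S.Bˣ) = C.t k (C.conjω g) := by
    intro k
    obtain ⟨j, h, e1, e2⟩ := C.t_spec k (C.conjω g)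
    rw [e2]
    refine shift_eq hrad.γt_unique (j := j.succ) ?_
    rw [γt, γt, if_neg (Fin.succ_ne_zero _), if_neg (Fin.succ_ne_zero _)]
    change C.γ k.succ * (C.ω * g * C.ω⁻¹) = _ at e1
    change _ = C.ω * h * C.ω⁻¹ * _
    have e3 : C.γ k.succ * C.ω * g = h * C.γ j.succ * C.ω := by
      rw [← e1]; group
    have hc := pUnit_inv_comm (S := S) (C.ω * h * C.ω⁻¹)
    calc S.pUnit⁻¹ * C.ω * C.γ k.succ * C.ω * g = S.pUnit⁻¹ * C.ω * (C.γ k.succ * C.ω * g) := by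
          simp only [mul_assoc]
      _ = S.pUnit⁻¹ * (C.ω * h * C.ω⁻¹) * C.ω * C.γ j.succ * C.ω := by rw [e3]; group
      _ = _ := by rw [← hc]; simp only [mul_assoc]
  rw [h0] at h1
  simp only [hs] at h1
  have h2 := hU (C.conjω g)
  rw [Up] at h2
  omega

/-- Conjugating twice by `ω_p` is conjugation by `z ∈ Γ₀ᴰ(pM)`, which a homomorphism to `ℤ` does not
see. -/
theorem IsRadialSystem.φ_conjω (hrad : C.IsRadialSystem γE γV) (hφ : ∀ g h, φ (g * h) = φ g + φ h)
    (hnew : C.IsPNew φ) {ap : ℤ} (hU : ∀ g, C.Up φ g = ap * φ g) (g : S.Gam0pM) :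
    φ (C.conjω g) = -(ap * φ g) := by
  rw [hrad.φ_eq hnew hU (C.conjω g)]
  have h1 : φ (C.conjω (C.conjω g)) + φ ⟨C.z, hrad.z_mem⟩ = φ ⟨C.z, hrad.z_mem⟩ + φ g := by
    rw [← hφ, ← hφ]
    congr 1
    refine Subtype.ext ?_
    change C.ω * (C.ω * g * C.ω⁻¹) * C.ω⁻¹ * C.z = C.z * g
    rw [z]
    rw [← mul_assoc, ← mul_assoc, pUnit_inv_comm]
    group
  rw [show φ (C.conjω (C.conjω g)) = φ g by omega]

/-- An element fixing `e_*` permutes the balls of given level inside `ℤ_p`. -/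
theorem mul_tm_eq {i : GLp p} (hi : i • eStar p = eStar p) (n : ℕ) {a : ℚ_[p]} (ha : ‖a‖ ≤ 1) :
    ∃ (a' : ℚ_[p]) (i' : GLp p), ‖a'‖ ≤ 1 ∧ i' • eStar p = eStar p ∧
      i * tm n a = tm n a' * i' := by
  have hp := one_lt_p_real (p := p)
  have hn : ∀ {i : GLp p}, i • eStar p = eStar p → ndet i = ‖i 1 1‖ ^ 2 := by
    intro i hi
    obtain ⟨h1, h2, h3⟩ := (smul_eStar_eq_iff i).mp hi
    have h11 : 0 < ‖i 1 1‖ := (norm_nonneg _).trans_lt h1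
    have hlt : ‖i 0 1 * i 1 0‖ < ‖i 0 0 * i 1 1‖ := by
      rw [norm_mul, norm_mul, h2]
      calc ‖i 0 1‖ * ‖i 1 0‖ ≤ ‖i 1 1‖ * ‖i 1 0‖ := by gcongr
        _ < ‖i 1 1‖ * ‖i 1 1‖ := by gcongr
    rw [ndet_eq, det_eq, norm_sub_eq_left hlt, norm_mul, h2, sq]
  obtain ⟨h1, h2, h3⟩ := (smul_eStar_eq_iff i).mp hi
  have h11 : 0 < ‖i 1 1‖ := (norm_nonneg _).trans_lt h1
  set A := i * tm n a with hA
  have e10 : A 1 0 = i 1 0 * (p : ℚ_[p]) ^ n := by rw [hA, mul_apply_two]; simp [coe_tm]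
  have e11 : A 1 1 = i 1 0 * a + i 1 1 := by rw [hA, mul_apply_two]; simp [coe_tm]
  have e01 : A 0 1 = i 0 0 * a + i 0 1 := by rw [hA, mul_apply_two]; simp [coe_tm]
  have n11 : ‖A 1 1‖ = ‖i 1 1‖ := by
    have : ‖-(i 1 0 * a)‖ < ‖i 1 1‖ := by
      rw [norm_neg, norm_mul]
      exact (mul_le_of_le_one_right (norm_nonneg _) ha).trans_lt h1
    have := norm_sub_eq_left this
    rwa [sub_neg_eq_add, add_comm, ← e11] at this
  obtain ⟨i', hi', e⟩ := eq_tm_mul (A := A) (by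
    rw [n11, e10, norm_mul]
    refine lt_of_le_of_lt (mul_le_of_le_one_right (norm_nonneg _) ?_) h1
    rw [Padic.norm_p_pow]
    exact zpow_le_one_of_nonpos₀ hp.le (by simp))
  have hm : vdet A - 2 * (A 1 1).valuation = n := by
    generalize vdet A - 2 * (A 1 1).valuation = m at e
    have e4 : i' 1 1 = A 1 1 := by rw [e, mul_apply_two]; simp [coe_tm]
    have e5 : ndet A = (p : ℝ) ^ (-m) * ndet i' := by
      conv_lhs => rw [e]
      rw [map_mul, ndet_eq_zpow_vdet (tm _ _), vdet_tm]
    rw [hn hi', e4, n11, hA, map_mul, hn hi, ndet_eq_zpow_vdet, vdet_tm, mul_comm] at e5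
    have e6 := mul_right_cancel₀ (by positivity) e5
    have e7 := zpow_right_injective₀ (by positivity) hp.ne' e6
    omega
  rw [hm] at e
  refine ⟨_, i', ?_, hi', e⟩
  rw [norm_div, n11, e01]
  refine div_le_one_of_le₀ ?_ h11.le
  refine (IsUltrametricDist.norm_add_le_max _ _).trans (max_le ?_ h3)
  rw [norm_mul, h2]
  exact mul_le_of_le_one_right (norm_nonneg _) ha

variable (C) in
theorem γ_smul_vStar (i : Fin (p + 1)) : S.locGL (C.γ i) • vStar p = vStar p :=
  S.smul_vStar_of_mem_Gam0M (C.γ_mem i)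

variable (C) in
theorem s_smul (k : Fin p) (v : Vertex p) : S.locGL (C.s k) • v =
    (S.locGL (C.γ k.succ))⁻¹ • (S.locGL C.ω)⁻¹ • v := by
  rw [s, map_mul, map_inv, map_inv, mul_smul]

variable (C) in
theorem ω_inv_smul_vStar : (S.locGL C.ω)⁻¹ • vStar p = vHat p := by
  rw [inv_smul_eq_iff, C.ω_smul_vHat]

variable (C) in
theorem ω_inv_smul_vHat : (S.locGL C.ω)⁻¹ • vHat p = vStar p := by
  rw [inv_smul_eq_iff, C.ω_smul_vStar]

variable (C) in
-- `s_k ℤ_p` is the ball of level 1 around `-k`; with indices in `Fin p`, the centre is `-(k + 1)`.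
theorem locGL_s (k : Fin p) : ∃ (a : ℚ_[p]) (i : GLp p), ‖a‖ ≤ 1 ∧ i • eStar p = eStar p ∧
    S.locGL (C.s k) = tm 1 a * i := by
  obtain ⟨u, ⟨hu, hdet⟩, h⟩ := C.γ_local k.succ (Fin.succ_ne_zero k)
  have ha : ‖(-((k.succ : ℕ) : ℚ_[p]))‖ ≤ 1 := by rw [norm_neg]; exact norm_natCast_le_one _
  set a : ℚ_[p] := -((k.succ : ℕ) : ℚ_[p]) with hadef
  refine ⟨a, (tm 1 a)⁻¹ * S.locGL (C.s k), ha, ?_, by rw [mul_inv_cancel_left]⟩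
  have hi : (S.locGL (C.γ k.succ) * tm 1 a * (wm p)⁻¹) • eStar p = eStar p := by
    have e : ((S.locGL (C.γ k.succ) * tm 1 a * (wm p)⁻¹ : GLp p) :
        Matrix (Fin 2) (Fin 2) ℚ_[p]) = u * !![-1, 0; 0, 1] := by
      have h1 : ((S.locGL (C.γ k.succ) * tm 1 a : GLp p) : Matrix (Fin 2) (Fin 2) ℚ_[p]) =
          u * !![-1, 0; 0, 1] * (wm p : Matrix (Fin 2) (Fin 2) ℚ_[p]) := by
        rw [Units.val_mul, show ((S.locGL (C.γ k.succ) : GLp p) : Matrix (Fin 2) (Fin 2) ℚ_[p]) =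
          u * !![0, -1; 1, ((k.succ : ℕ) : ℚ_[p])] from h, mul_assoc, mul_assoc, coe_wm, coe_tm,
          hadef]
        simp
      rw [Units.val_mul, h1, mul_assoc, ← Units.val_mul, mul_inv_cancel, Units.val_one, mul_one]
    apply smul_eStar_of_mem_eichlerLocal
    · rw [e]
      refine mul_mem hu ⟨?_, ?_⟩
      · simp [Fin.forall_fin_two]
      · simp
    · rw [ndet_eq, e, Matrix.det_mul, hdet]
      simp [Matrix.det_fin_two]
  rw [mul_smul, inv_smul_eq_iff]
  refine Edge.ext ?_ ?_
  · change S.locGL (C.s k) • vStar p = tm 1 a • vStar p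
    rw [C.s_smul, C.ω_inv_smul_vStar, inv_smul_eq_iff, ← mul_smul,
      ← inv_mul_cancel_right (S.locGL (C.γ k.succ) * tm 1 a) (wm p), mul_smul, wm_smul_vStar,
      smul_vHat_of_smul_eStar hi]
  · change S.locGL (C.s k) • vHat p = tm 1 a • vHat p
    have h1 := tm_one_smul_vHat (A := 1) ha
    rw [one_mul, one_smul] at h1
    rw [C.s_smul, C.ω_inv_smul_vHat, inv_smul_eq_iff, h1, C.γ_smul_vStar]

theorem s_smul_tm (k : Fin p) (n : ℕ) {a : ℚ_[p]} (ha : ‖a‖ ≤ 1) :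
    depth (S.locGL (C.s k) • tm n a • vStar p) = n + 1 := by
  obtain ⟨b, i, hb, hi, h⟩ := C.locGL_s k
  obtain ⟨a', i', ha', hi', h'⟩ := mul_tm_eq hi n ha
  rw [h, ← mul_smul, mul_assoc, h', ← mul_assoc, tm_mul_tm, mul_smul, smul_vStar_of_smul_eStar hi']
  have := depth_tm (n + 1) (a := b + (p : ℚ_[p]) ^ (1 : ℤ) * a') (by
    refine (IsUltrametricDist.norm_add_le_max _ _).trans (max_le hb ?_)
    rw [zpow_one, norm_mul]
    exact mul_le_one₀ Padic.norm_p_lt_one.le (norm_nonneg _) ha')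
  rwa [Nat.cast_succ, add_comm (n : ℤ)] at this

end Choices

end HeckeRelation

/-! ### The radial system under `s_k`, and the restriction to `ℤ_p`. -/

section HeckeRestriction

variable {p D M : ℕ} [Fact p.Prime] {S : Setup p D M}

namespace Choices

variable {C : Choices S} {γE : Edge p → S.Bˣ} {γV : Vertex p → S.Bˣ} {φ : S.Gam0pM → ℤ}

theorem isEven_tm (n : ℕ) (a : ℚ_[p]) : (tm n a • vStar p).IsEven ↔ Even n := by
  rw [isEven_smul_vStar, vdet_tm, Int.even_coe_nat]

theorem tm_succ_smul_vHat (n : ℕ) (a : ℚ_[p]) :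
    tm ((n + 1 : ℕ) : ℤ) a • vHat p = tm n a • vStar p := by
  rw [tm_smul_vHat, Nat.cast_succ, add_sub_cancel_right]

theorem tm_zero_smul_eStar {a : ℚ_[p]} (ha : ‖a‖ ≤ 1) : tm 0 a • eStar p = eStar p := by
  obtain ⟨i, hi, e⟩ := tm_smul_eq (n := 0) (a := a) (b := 0) (by simpa using ha)
  rw [e, tm_zero_zero, one_mul, hi]

theorem tm_succ_smul_vStar_ne (n : ℕ) (a : ℚ_[p]) :
    tm ((n + 1 : ℕ) : ℤ) a • vStar p ≠ tm n a • vHat p := by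
  rw [tm_smul_vHat]
  intro h
  have := (tm_smul_vStar_eq h).1
  push_cast at this
  omega

/-- For `n > 0` this edge points towards `v_*`. For `n = 0` it is `e_*`, which points outward, and
all representatives involved are 1. -/
theorem IsRadialSystem.γE_tm (hrad : C.IsRadialSystem γE γV) {n : ℕ} (hn : Even n) {a : ℚ_[p]}
    (ha : ‖a‖ ≤ 1) : γE (tm n a • eStar p) = γV (tm n a • vStar p) := by
  obtain _ | n := n
  · have h0 : depth (vStar p) = 0 := by simp [depth]
    have h1 : γE (eStar p) = γV (vHat p) := by
      refine (hrad.outward (eStar p) isEven_vStar ?_).symm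
      change depth (vStar p) < depth (vHat p)
      rw [h0, Nat.pos_iff_ne_zero]
      intro h
      exact not_isEven_vHat (p := p) (by rw [Vertex.IsEven, h]; exact Even.zero)
    have h2 := smul_vStar_of_smul_eStar (tm_zero_smul_eStar ha)
    rw [Nat.cast_zero, tm_zero_smul_eStar ha, h2, h1, hrad.base.1, hrad.base.2]
  · refine (hrad.inward (tm ((n + 1 : ℕ) : ℤ) a • eStar p) ((isEven_tm _ a).mpr hn) ?_).symm
    change depth (tm _ a • vHat p) < depth (tm _ a • vStar p)
    rw [tm_succ_smul_vHat, depth_tm _ ha, depth_tm _ ha]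
    exact Nat.lt_succ_self n

theorem tm_wm_smul_s (n : ℤ) (a : ℚ_[p]) : ((tm n a * wm p) • eStar p).s = tm n a • vHat p := by
  rw [mul_smul, ← wm_smul_vStar]; rfl

theorem tm_wm_smul_t (n : ℤ) (a : ℚ_[p]) : ((tm n a * wm p) • eStar p).t = tm n a • vStar p := by
  rw [mul_smul, ← wm_smul_vHat]; rfl

theorem isEven_tm_wm {n : ℕ} (hn : Even n) (a : ℚ_[p]) :
    ((tm ((n + 1 : ℕ) : ℤ) a * wm p) • eStar p).IsEven := by
  rw [isEven_smul_eStar, vdet_mul, vdet_tm, vdet_wm]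
  obtain ⟨m, rfl⟩ := hn
  exact ⟨m + 1, by push_cast; ring⟩

theorem IsRadialSystem.γE_tm_wm (hrad : C.IsRadialSystem γE γV) {n : ℕ} (hn : Even n) {a : ℚ_[p]}
    (ha : ‖a‖ ≤ 1) : γE ((tm ((n + 1 : ℕ) : ℤ) a * wm p) • eStar p) =
      γV (tm ((n + 1 : ℕ) : ℤ) a • vStar p) := by
  rw [← tm_wm_smul_t]
  refine (hrad.outward _ (isEven_tm_wm hn a) ?_).symm
  rw [tm_wm_smul_s, tm_wm_smul_t, tm_succ_smul_vHat, depth_tm _ ha, depth_tm _ ha]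
  exact Nat.lt_succ_self n

theorem IsRadialSystem.γV_s_smul_zero (hrad : C.IsRadialSystem γE γV) (k : Fin p) :
    γV (S.locGL (C.s k) • vStar p) = C.γ k.succ := by
  obtain ⟨e, h1, he, h2⟩ := hrad.exists_edge_γ isEven_vStar k.succ
  rw [hrad.base.1, mul_one] at h2
  have h3 : e.t = S.locGL (C.s k) • vStar p := by
    rw [C.s_smul, C.ω_inv_smul_vStar, ← h2]
    exact congrArg Edge.t (hrad.edge_eq he)
  have h4 : depth (S.locGL (C.s k) • vStar p) = 1 := by
    simpa [tm_zero_zero] using C.s_smul_tm k 0 (a := 0) (by simp)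
  rw [← h3, ← h2]
  refine hrad.outward e he ?_
  rw [h1, h3, h4]
  simp [depth]

/-- The edge `e` from level `n` to level `n + 1` has `γ_e = γᵢ γ_v`. The edge `f` into `s_k v` with
representative `γ̃ᵢ γ_{s_k v}` has, by the definition of `γ̃ᵢ`, the representative predicted for
`s_k ē`. This identifies its source, and `f` points inward. -/
theorem IsRadialSystem.γV_s_smul_succ_of_even (hrad : C.IsRadialSystem γE γV) (k : Fin p) {n : ℕ}
    (hn : Even n) {a : ℚ_[p]} (ha : ‖a‖ ≤ 1)
    (ih : γV (S.locGL (C.s k) • tm n a • vStar p) =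
      C.ω⁻¹ * γV (tm n a • vStar p) * C.ω * C.γ k.succ) :
    γV (S.locGL (C.s k) • tm ((n + 1 : ℕ) : ℤ) a • vStar p) =
      S.pUnit⁻¹ * C.ω * γV (tm ((n + 1 : ℕ) : ℤ) a • vStar p) * C.ω * C.γ k.succ := by
  have hv := (isEven_tm n a).mpr hn
  set e := (tm ((n + 1 : ℕ) : ℤ) a * wm p) • eStar p with hedef
  have hes : e.s = tm n a • vStar p := by rw [hedef, tm_wm_smul_s, tm_succ_smul_vHat]
  have het : e.t = tm ((n + 1 : ℕ) : ℤ) a • vStar p := by rw [hedef, tm_wm_smul_t]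
  have he : e.IsEven := isEven_tm_wm hn a
  obtain ⟨i, hi⟩ : γE e ∈ Set.range fun i => C.γ i * γV (tm n a • vStar p) := by
    rw [← hrad.source _ hv]; exact ⟨e, hes, rfl⟩
  change C.γ i * γV (tm n a • vStar p) = γE e at hi
  -- Index 0 is taken by the edge `tm n a e_*`, which does not go to level `n + 1`. It must be
  -- excluded because `γ̃₀` is not `p⁻¹ ω_p γ₀ ω_p`.
  have hi0 : i ≠ 0 := by
    rintro rfl
    have h1 : e = tm n a • eStar p := by
      refine hrad.edge_unique he hv (one_mem _) ?_
      rw [one_mul, ← hi, C.γ_zero, one_mul, hrad.γE_tm hn ha]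
    exact tm_succ_smul_vStar_ne n a (het.symm.trans (congrArg Edge.t h1))
  have hw : ¬ (S.locGL (C.s k) • tm n a • vStar p).IsEven := by
    rw [Vertex.IsEven, C.s_smul_tm k n ha, Nat.even_add_one, not_not]; exact hn
  obtain ⟨f, hft, hf, h1⟩ := hrad.exists_edge_γt hw i
  have hF : γE f = S.pUnit⁻¹ * C.ω * γE e * C.ω * C.γ k.succ := by
    rw [h1, ih, γt, if_neg hi0, ← hi]; group
  have hfs : f.s = S.locGL (C.s k) • tm ((n + 1 : ℕ) : ℤ) a • vStar p := by
    have h2 : f.s = (S.locGL (γE f))⁻¹ • vStar p := congrArg Edge.s (hrad.edge_eq hf)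
    rw [h2, inv_smul_eq_iff, hF, C.s_smul]
    simp only [map_mul, map_inv, mul_smul, smul_inv_smul]
    rw [← het, show S.locGL (γE e) • e.t = vHat p from congrArg Edge.t (hrad.edge_rep e he).2,
      C.ω_smul_vHat, eq_inv_smul_iff, S.locGL_pUnit_smul]
  rw [← hfs, ← hrad.γE_tm_wm hn ha, ← hF]
  refine hrad.inward f hf ?_
  rw [hft, hfs, C.s_smul_tm k n ha, C.s_smul_tm k (n + 1) ha]
  exact Nat.lt_succ_self _

/-- The same argument with `γᵢ` and `γ̃ᵢ` exchanged: `f` now leaves the even vertex `s_k v` and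
points outward. -/
theorem IsRadialSystem.γV_s_smul_succ_of_odd (hrad : C.IsRadialSystem γE γV) (k : Fin p) {n : ℕ}
    (hn : ¬ Even n) {a : ℚ_[p]} (ha : ‖a‖ ≤ 1)
    (ih : γV (S.locGL (C.s k) • tm n a • vStar p) =
      S.pUnit⁻¹ * C.ω * γV (tm n a • vStar p) * C.ω * C.γ k.succ) :
    γV (S.locGL (C.s k) • tm ((n + 1 : ℕ) : ℤ) a • vStar p) =
      C.ω⁻¹ * γV (tm ((n + 1 : ℕ) : ℤ) a • vStar p) * C.ω * C.γ k.succ := by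
  have hv : ¬ (tm n a • vStar p).IsEven := fun h => hn ((isEven_tm n a).mp h)
  have hn' : Even (n + 1) := Nat.even_add_one.mpr hn
  set e := tm ((n + 1 : ℕ) : ℤ) a • eStar p with hedef
  have hes : e.s = tm ((n + 1 : ℕ) : ℤ) a • vStar p := rfl
  have het : e.t = tm n a • vStar p := tm_succ_smul_vHat n a
  have he : e.IsEven := (isEven_tm (n + 1) a).mpr hn'
  obtain ⟨i, hi⟩ : γE e ∈ Set.range fun i => C.γt i * γV (tm n a • vStar p) := by
    rw [← hrad.target _ hv]; exact ⟨e, het, rfl⟩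
  change C.γt i * γV (tm n a • vStar p) = γE e at hi
  have hi0 : i ≠ 0 := by
    rintro rfl
    obtain ⟨m, rfl⟩ : ∃ m, n = m + 1 := Nat.exists_eq_succ_of_ne_zero (by rintro rfl; simp at hn)
    have hm : Even m := by rwa [Nat.even_add_one, not_not] at hn
    have h1 : e = (tm ((m + 1 : ℕ) : ℤ) a * wm p) • eStar p := by
      refine hrad.edge_unique he (isEven_tm_wm hm a) (one_mem _) ?_
      rw [one_mul, ← hi, γt, if_pos rfl, one_mul, hrad.γE_tm_wm hm ha]
    refine tm_succ_smul_vStar_ne (m + 1) a ?_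
    rw [← tm_wm_smul_s, ← h1, hes]
  have hw : (S.locGL (C.s k) • tm n a • vStar p).IsEven := by
    rw [Vertex.IsEven, C.s_smul_tm k n ha]; exact hn'
  obtain ⟨f, hfs, hf, h1⟩ := hrad.exists_edge_γ hw i
  have hG : γE f = C.ω⁻¹ * γE e * C.ω * C.γ k.succ := by
    rw [h1, ih, ← hi, γt, if_neg hi0]
    have hc := pUnit_inv_comm (S := S) (C.γ i)
    have hc' := pUnit_inv_comm (S := S) C.ω⁻¹
    calc _ = C.γ i * S.pUnit⁻¹ * C.ω * γV (tm n a • vStar p) * C.ω * C.γ k.succ := by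
          simp only [mul_assoc]
      _ = S.pUnit⁻¹ * C.ω⁻¹ * C.ω * C.γ i * C.ω * γV (tm n a • vStar p) * C.ω * C.γ k.succ := by
          rw [hc]; group
      _ = _ := by rw [← hc']; simp only [mul_assoc]
  have hft : f.t = S.locGL (C.s k) • tm ((n + 1 : ℕ) : ℤ) a • vStar p := by
    have h2 : f.t = (S.locGL (γE f))⁻¹ • vHat p := congrArg Edge.t (hrad.edge_eq hf)
    rw [h2, inv_smul_eq_iff, hG, C.s_smul]
    simp only [map_mul, map_inv, mul_smul, smul_inv_smul]
    rw [← hes, show S.locGL (γE e) • e.s = vStar p from congrArg Edge.s (hrad.edge_rep e he).2,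
      C.ω_inv_smul_vStar]
  rw [← hft, ← hrad.γE_tm hn' ha, ← hG]
  refine hrad.outward f hf ?_
  rw [hft, hfs, C.s_smul_tm k n ha, C.s_smul_tm k (n + 1) ha]
  exact Nat.lt_succ_self _

/-- How the radial system transforms under `s_k` on the half of the tree lying over `ℤ_p`. -/
theorem IsRadialSystem.γV_s_smul (hrad : C.IsRadialSystem γE γV) (k : Fin p) (n : ℕ) {a : ℚ_[p]}
    (ha : ‖a‖ ≤ 1) : γV (S.locGL (C.s k) • tm n a • vStar p) =
      (if Even n then C.ω⁻¹ else S.pUnit⁻¹ * C.ω) * γV (tm n a • vStar p) * C.ω * C.γ k.succ := by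
  induction n with
  | zero =>
    rw [Nat.cast_zero, smul_vStar_of_smul_eStar (tm_zero_smul_eStar ha), hrad.γV_s_smul_zero,
      hrad.base.1, if_pos Even.zero]
    group
  | succ n ih =>
    by_cases hn : Even n
    · rw [if_pos hn] at ih
      rw [if_neg (by rwa [Nat.even_add_one, not_not]), hrad.γV_s_smul_succ_of_even k hn ha ih]
    · rw [if_neg hn] at ih
      rw [if_pos (Nat.even_add_one.mpr hn), hrad.γV_s_smul_succ_of_odd k hn ha ih]

theorem isEven_s_tm_wm (C : Choices S) (k : Fin p) {n : ℕ} (hn : Even (n + 1)) {a : ℚ_[p]}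
    (ha : ‖a‖ ≤ 1) :
    ((S.locGL (C.s k) * tm ((n + 1 : ℕ) : ℤ) a * wm p) • eStar p).IsEven := by
  rw [mul_assoc, mul_smul]
  change (S.locGL (C.s k) • ((tm _ a * wm p) • eStar p).s).IsEven
  rw [tm_wm_smul_s, tm_succ_smul_vHat, Vertex.IsEven, C.s_smul_tm k n ha]
  exact hn

/-- `s_k` reverses parity, so the even edge to consider is `s_k ē`, which points outward and shares
the representative of its target. -/
theorem IsRadialSystem.γE_s_tm_wm (hrad : C.IsRadialSystem γE γV) (k : Fin p) {n : ℕ}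
    (hn : Even (n + 1)) {a : ℚ_[p]} (ha : ‖a‖ ≤ 1) :
    γE ((S.locGL (C.s k) * tm ((n + 1 : ℕ) : ℤ) a * wm p) • eStar p) =
      C.ω⁻¹ * γE (tm ((n + 1 : ℕ) : ℤ) a • eStar p) * C.ω * C.γ k.succ := by
  have he := isEven_s_tm_wm C k hn ha
  have ht : ((S.locGL (C.s k) * tm ((n + 1 : ℕ) : ℤ) a * wm p) • eStar p).t =
      S.locGL (C.s k) • tm ((n + 1 : ℕ) : ℤ) a • vStar p := by
    rw [mul_assoc, mul_smul, ← tm_wm_smul_t]; rfl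
  have hs : ((S.locGL (C.s k) * tm ((n + 1 : ℕ) : ℤ) a * wm p) • eStar p).s =
      S.locGL (C.s k) • tm n a • vStar p := by
    rw [mul_assoc, mul_smul, ← tm_succ_smul_vHat, ← tm_wm_smul_s]; rfl
  have h1 := hrad.γV_s_smul k (n + 1) ha
  rw [if_pos hn, ← hrad.γE_tm hn ha, ← ht] at h1
  rw [← h1]
  refine (hrad.outward _ he ?_).symm
  rw [hs, ht, C.s_smul_tm k n ha, C.s_smul_tm k (n + 1) ha]
  exact Nat.lt_succ_self _

/-- `h(t_k(g), e) = ω_p h(g, s_k ē) ω_p⁻¹` for the edges `e` with `U_e ⊆ ℤ_p` a proper ball. -/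
theorem IsRadialSystem.h_t (hrad : C.IsRadialSystem γE γV) (g : S.Gam0pM) (k : Fin p) {n : ℕ}
    (hn : Even (n + 1)) {a : ℚ_[p]} (ha : ‖a‖ ≤ 1) :
    C.h γE (Subgroup.inclusion S.Gam0pM_le_Gam (C.t k g)) (tm ((n + 1 : ℕ) : ℤ) a • eStar p) =
      C.conjω (C.h γE (Subgroup.inclusion S.Gam0pM_le_Gam g)
        ((S.locGL (C.s k) * tm ((n + 1 : ℕ) : ℤ) a * wm p) • eStar p)) := by
  obtain ⟨j, h0, e1, e2⟩ := C.t_spec k g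
  rw [e2]
  set t := C.conjω h0 with ht
  set y := C.h γE (Subgroup.inclusion S.Gam0pM_le_Gam t) (tm ((n + 1 : ℕ) : ℤ) a • eStar p) with hy
  have hi : (S.locGL (t : S.Bˣ))⁻¹ • eStar p = eStar p := by
    rw [inv_smul_eq_iff, S.smul_eStar_of_mem_Gam0pM t.2]
  -- `t⁻¹` moves the edge to one of the same level, to which the rule for `s_j` applies.
  obtain ⟨a', i', ha', hi', e3⟩ := mul_tm_eq hi (n + 1) ha
  have h1 := hrad.h_spec (Subgroup.inclusion S.Gam0pM_le_Gam t)
    (e := tm ((n + 1 : ℕ) : ℤ) a • eStar p) ((isEven_tm (n + 1) a).mpr hn)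
  rw [← hy] at h1
  change γE _ * (t : S.Bˣ) = y * γE ((S.locGL (t : S.Bˣ))⁻¹ • _) at h1
  rw [← mul_smul, e3, mul_smul, hi'] at h1
  obtain ⟨y', hy'⟩ := C.exists_conjω_eq y
  rw [← hy']
  congr 1
  symm
  refine h_eq y'.2 ?_
  change _ * (g : S.Bˣ) = _ * γE ((S.locGL (g : S.Bˣ))⁻¹ • _)
  -- This is `g⁻¹ s_k = s_j t⁻¹` applied to the reversed edge.
  have h2 : (S.locGL (g : S.Bˣ))⁻¹ • (S.locGL (C.s k) * tm ((n + 1 : ℕ) : ℤ) a * wm p) • eStar p =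
      (S.locGL (C.s j) * tm ((n + 1 : ℕ) : ℤ) a' * wm p) • eStar p := by
    rw [← mul_smul, ← mul_wm_smul_eStar hi']
    congr 1
    have h3 := congrArg S.locGL (C.s_mul_conjω e1)
    rw [map_mul, map_mul, map_inv, map_inv, ← ht] at h3
    rw [← mul_assoc, ← mul_assoc, h3, mul_assoc (S.locGL (C.s j)), e3]
    simp only [mul_assoc]
  rw [h2, hrad.γE_s_tm_wm k hn ha, hrad.γE_s_tm_wm j hn ha', mul_assoc, e1]
  have h4 : (t : S.Bˣ) = C.ω * h0 * C.ω⁻¹ := rfl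
  have h5 : (y : S.Bˣ) = C.ω * y' * C.ω⁻¹ := by rw [← hy']; rfl
  rw [h4, h5] at h1
  calc _ = C.ω⁻¹ * (γE (tm ((n + 1 : ℕ) : ℤ) a • eStar p) * (C.ω * h0 * C.ω⁻¹)) * C.ω *
        C.γ j.succ := by group
    _ = _ := by rw [h1]; group

theorem IsMeasureFamily.apply_t {μ : S.Gam → Meas0 p} (hμ : C.IsMeasureFamily γE φ μ)
    (hrad : C.IsRadialSystem γE γV) (hφ : ∀ g h, φ (g * h) = φ g + φ h) (hnew : C.IsPNew φ)
    {ap : ℤ} (hU : ∀ g, C.Up φ g = ap * φ g) (g : S.Gam0pM) (k : Fin p)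
    {U : Clopens (P1 p)} (hUZ : U ≤ Zp p) :
    μ (Subgroup.inclusion S.Gam0pM_le_Gam (C.t k g)) U =
      (ap • ((S.locGL (C.s k))⁻¹ • μ (Subgroup.inclusion S.Gam0pM_le_Gam g))) U := by
  -- The level must be even for `e` to be even, and positive for `s_k ē` to be covered by the
  -- transformation rule.
  refine Meas0.eq_of_le _ _ 1 (fun N => ⟨2 * N + 1 + 1, by omega, fun a ha => ?_⟩)
    (by rwa [one_smul_clopens])
  have hn : Even (2 * N + 1 + 1) := ⟨N + 1, by ring⟩
  rw [one_mul]
  have he := (isEven_s_tm_wm C k hn ha)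
  rw [hμ.apply _ (by rw [vdet_tm]; exact_mod_cast hn), hrad.h_t g k hn ha,
    hrad.φ_conjω hφ hnew hU, ← hμ _ _ he _ rfl, mul_smul_clopens, wm_smul_Zp]
  change _ = ap * μ _ ((S.locGL (C.s k))⁻¹⁻¹ • _)
  -- Complementation has mass `-1` times the original, which absorbs the sign in `-a_p`.
  rw [inv_inv, smul_clopens_compl, Meas0.map_compl, mul_smul_clopens]
  ring

end Choices

end HeckeRestriction

end QuatMeasure

end

theorem mainTheorem6 {p D M : ℕ} [Fact p.Prime]
    (S : QuatMeasure.Setup p D M) (C : QuatMeasure.Choices S)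
    (γE : QuatMeasure.Edge p → S.Bˣ) (γV : QuatMeasure.Vertex p → S.Bˣ)
    (hrad : C.IsRadialSystem γE γV)
    (φ : S.Gam0pM → ℤ) (hφ : ∀ g h, φ (g * h) = φ g + φ h) (hnew : C.IsPNew φ)
    (ap : ℤ) (hU : ∀ g, C.Up φ g = ap * φ g) :
    ∃ μ : S.Gam → QuatMeasure.Meas0 p,
      C.IsMeasureFamily γE φ μ ∧
      (∀ μ' : S.Gam → QuatMeasure.Meas0 p, C.IsMeasureFamily γE φ μ' → μ' = μ) ∧
      ∀ (g : S.Gam0pM) (k : Fin p) (U : TopologicalSpace.Clopens (QuatMeasure.P1 p)),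
        U ≤ QuatMeasure.Zp p →
          μ (Subgroup.inclusion S.Gam0pM_le_Gam (C.t k g)) U =
            (ap • ((S.locGL (C.s k))⁻¹ • μ (Subgroup.inclusion S.Gam0pM_le_Gam g))) U :=
  have hμ := hrad.isMeasureFamily hnew
  ⟨_, hμ, fun _ hμ' => hμ.unique hμ', fun g k _ hUZ => hμ.apply_t hrad hφ hnew hU g k hUZ⟩
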